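/- **Theorem.** Consider the following three problems on $n$-vertex graphs whose weights are integers in $\{-M,\dots,M\}$. * *4-opt Detection*: given a complete undirected graph $G$ on $n\ge 3$ vertices with edge weights $w:E(G)\to\mathbb Z$ and a Hamiltonian cycle $H$ of $G$ (as the cyclic sequence of its vertices), decide whether $H$ has an improving $4$-move, that is, whether there are sets $E^-\subseteq E(H)$ and $E^+\subseteq E(G)$ with $|E^-|=|E^+|=4$ such that $H'=(E(H)\setminus E^-)\cup E^+$ is the edge set of a Hamiltonian cycle of $G$ and $w(H')<w(E(H))$. * *Negative Edge-Weighted Triangle*: given a complete undirected graph $G$ on $n\ge 1$ vertices with edge weights $w:E(G)\to\mathbb Z$, decide whether $G$ contains a triangle of negative total weight. * *All Pairs Shortest Paths*: given a directed graph on $n\ge 1$ vertices with integer arc weights and without cycles of negative weight, compute for every ordered pair $(u,v)$ of vertices the distance from $u$ to $v$, or report that $v$ cannot be reached from $u$. If there is $\varepsilon>0$ such that 4-opt Detection admits an algorithm in time $O(n^{3-\varepsilon}\cdot\mathrm{polylog}(M))$, then there is $\delta>0$ such that both Negative Edge-Weighted Triangle and All Pairs Shortest Paths admit an algorithm in time $O(n^{3-\delta}\cdot\mathrm{polylog}(M))$.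 Here algorithms are deterministic programs of a unit-cost random access machine (arithmetic, comparison, bitwise and shift operations, loads and stores with computed addresses, tests and loops, each elementary step costing $1$) with integer words of absolute value at most $(n+M+2)^{c}$ for a constant $c$ depending only on the program, and time $O(n^{\alpha}\cdot\mathrm{polylog}(M))$ means at most $C\,n^{\alpha}(\log(M+2))^{k}$ steps for constants $C,k$ and all $n$ and $M\ge 0$. -/

import Mathlib

/-! ### The machine model: a unit-cost random access machine with bounded words -/

/-- Binary machine operations on integer words. -/
inductive WordOp where
  | add | sub | mul | div | mod | lt | eq | land | lor | xor | shiftL | shiftR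

/-- The value of a machine operation; comparisons return `1` for true and `0` for false, and
`div`, `mod` by `0` follow the conventions of `ℤ`. -/
def WordOp.eval : WordOp → ℤ → ℤ → ℤ
  | .add, a, b => a + b
  | .sub, a, b => a - b
  | .mul, a, b => a * b
  | .div, a, b => a / b
  | .mod, a, b => a % b
  | .lt, a, b => if a < b then 1 else 0
  | .eq, a, b => if a = b then 1 else 0
  | .land, a, b => Int.land a b
  | .lor, a, b => Int.lor a b
  | .xor, a, b => Int.xor a b
  | .shiftL, a, b => a * 2 ^ b.toNat
  | .shiftR, a, b => a / 2 ^ b.toNat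

/-- Programs of the machine.  Registers and random access memory banks are named by numerals in
the program text, so a program uses a fixed finite number of each; data-dependent addressing is
done by `load` and `store` inside a bank. -/
inductive RamProgram where
  /-- do nothing -/
  | skip
  /-- `const r c`: register `r` receives the constant `c` -/
  | const (r : ℕ) (c : ℤ)
  /-- `op o r a b`: register `r` receives the result of `o` on the registers `a` and `b` -/
  | op (o : WordOp) (r a b : ℕ)
  /-- `load r A a`: register `r` receives the cell of bank `A` whose address is in register `a` -/
  | load (r A a : ℕ)
  /-- `store A a b`: the cell of bank `A` whose address is in register `a` receives the content
  of register `b` -/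
  | store (A a b : ℕ)
  /-- sequential composition -/
  | seq (P Q : RamProgram)
  /-- `ite r P Q`: run `P` if register `r` is nonzero, and `Q` otherwise -/
  | ite (r : ℕ) (P Q : RamProgram)
  /-- `loop r P`: run `P` as long as register `r` is nonzero -/
  | loop (r : ℕ) (P : RamProgram)

/-- A machine state: the registers, and the memory banks with their cells. -/
structure RamState where
  reg : ℕ → ℤ
  mem : ℕ → ℤ → ℤ

namespace RamState

/-- Overwrite register `r` by `v`. -/
def setReg (s : RamState) (r : ℕ) (v : ℤ) : RamState :=
  { s with reg := Function.update s.reg r v }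

/-- Overwrite the cell with address `x` of bank `A` by `v`. -/
def setMem (s : RamState) (A : ℕ) (x v : ℤ) : RamState :=
  { s with mem := Function.update s.mem A (Function.update (s.mem A) x v) }

/-- The initial state: bank `A` holds the list `input A` in its cells `0, 1, 2, …`, and every
other cell and every register is `0`. -/
def init (input : ℕ → List ℤ) : RamState where
  reg := fun _ => 0
  mem := fun A x => if 0 ≤ x then (input A).getD x.toNat 0 else 0

end RamState

/-- `Exec B P s t s'`: started in state `s`, the program `P` halts in state `s'` after exactly `t`
steps, and every word that it writes has absolute value at most `B`.  Each elementary instruction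
and each test takes one step.  A run that produces a larger word has no derivation. -/
inductive Exec (B : ℕ) : RamProgram → RamState → ℕ → RamState → Prop
  | skip (s : RamState) : Exec B .skip s 1 s
  | const (r : ℕ) (c : ℤ) (s : RamState) (h : |c| ≤ (B : ℤ)) :
      Exec B (.const r c) s 1 (s.setReg r c)
  | op (o : WordOp) (r a b : ℕ) (s : RamState)
      (h : |o.eval (s.reg a) (s.reg b)| ≤ (B : ℤ)) :
      Exec B (.op o r a b) s 1 (s.setReg r (o.eval (s.reg a) (s.reg b)))
  | load (r A a : ℕ) (s : RamState) (h : |s.mem A (s.reg a)| ≤ (B : ℤ)) :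
      Exec B (.load r A a) s 1 (s.setReg r (s.mem A (s.reg a)))
  | store (A a b : ℕ) (s : RamState) :
      Exec B (.store A a b) s 1 (s.setMem A (s.reg a) (s.reg b))
  | seq {P Q : RamProgram} {s s' s'' : RamState} {t t' : ℕ}
      (hP : Exec B P s t s') (hQ : Exec B Q s' t' s'') :
      Exec B (.seq P Q) s (t + t') s''
  | ite_true {r : ℕ} {P Q : RamProgram} {s s' : RamState} {t : ℕ}
      (hr : s.reg r ≠ 0) (hP : Exec B P s t s') :
      Exec B (.ite r P Q) s (t + 1) s'
  | ite_false {r : ℕ} {P Q : RamProgram} {s s' : RamState} {t : ℕ}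
      (hr : s.reg r = 0) (hQ : Exec B Q s t s') :
      Exec B (.ite r P Q) s (t + 1) s'
  | loop_stop {r : ℕ} {P : RamProgram} {s : RamState} (hr : s.reg r = 0) :
      Exec B (.loop r P) s 1 s
  | loop_step {r : ℕ} {P : RamProgram} {s s' s'' : RamState} {t t' : ℕ}
      (hr : s.reg r ≠ 0) (hP : Exec B P s t s') (hL : Exec B (.loop r P) s' t' s'') :
      Exec B (.loop r P) s (t + t' + 1) s''

/-- A computational problem on weighted graphs: its instances, the number of vertices of an
instance, the statement that all its weights lie in `{-M, …, M}`, the way in which the instance is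
written into the memory, and the final states that hold a correct answer. -/
structure GraphProblem where
  Inst : Type
  size : Inst → ℕ
  WeightsBoundedBy : Inst → ℕ → Prop
  input : Inst → ℕ → List ℤ
  Correct : Inst → RamState → Prop

/-- The problem admits an algorithm in time `O(n ^ α * polylog M)` on `n`-vertex graphs with
integer weights from `{-M, …, M}`: one program, whose words are polynomially bounded in `n` and `M`
(that is, have `O(log n + log M)` bits), that is correct on all instances and makes at most
`C * n ^ α * (log (M + 2)) ^ k` steps. -/
def GraphProblem.SolvableInTime (Pr : GraphProblem) (α : ℝ) : Prop :=
  ∃ (P : RamProgram) (C : ℝ) (k c : ℕ), ∀ (I : Pr.Inst) (M : ℕ), Pr.WeightsBoundedBy I M →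
    ∃ (t : ℕ) (s : RamState),
      Exec ((Pr.size I + M + 2) ^ c) P (RamState.init (Pr.input I)) t s ∧
      Pr.Correct I s ∧
      (t : ℝ) ≤ C * (Pr.size I : ℝ) ^ α * Real.log ((M : ℝ) + 2) ^ k

/-- The answer convention of decision problems: register `0` is `1` for yes and `0` for no. -/
def DecidesAs (Q : Prop) (s : RamState) : Prop :=
  (Q ∧ s.reg 0 = 1) ∨ (¬ Q ∧ s.reg 0 = 0)

/-- The row-major list of the entries of a square matrix: entry `(i, j)` has index `i * n + j`. -/
def rowMajor {n : ℕ} (f : Fin n → Fin n → ℤ) : List ℤ :=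
  List.ofFn fun x : Fin (n * n) => f x.divNat x.modNat

/-! ### Negative Edge-Weighted Triangle -/

/-- The symmetric matrix, with zero diagonal, of the edge weights of a complete graph. -/
def weightMatrix {n : ℕ} (w : Sym2 (Fin n) → ℤ) (i j : Fin n) : ℤ :=
  if i = j then 0 else w s(i, j)

/-- All edges of the complete graph have weights in `{-M, …, M}`. -/
def EdgeWeightsBoundedBy {n : ℕ} (w : Sym2 (Fin n) → ℤ) (M : ℕ) : Prop :=
  ∀ e ∈ (⊤ : SimpleGraph (Fin n)).edgeSet, |w e| ≤ (M : ℤ)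

/-- A nonempty undirected complete graph with integer edge weights (the values of `w` on the
diagonal of `Sym2 (Fin n)` play no role). -/
structure TriangleInstance where
  n : ℕ
  n_pos : 1 ≤ n
  w : Sym2 (Fin n) → ℤ

/-- Some three distinct vertices span a triangle of negative total weight. -/
def TriangleInstance.HasNegativeTriangle (I : TriangleInstance) : Prop :=
  ∃ i j k : Fin I.n, i ≠ j ∧ j ≠ k ∧ i ≠ k ∧ I.w s(i, j) + I.w s(j, k) + I.w s(i, k) < 0

/-- Negative Edge-Weighted Triangle.  Bank `0` holds `n`, bank `1` the weight matrix. -/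
def negativeTriangle : GraphProblem where
  Inst := TriangleInstance
  size := fun I => I.n
  WeightsBoundedBy := fun I M => EdgeWeightsBoundedBy I.w M
  input := fun I A => match A with
    | 0 => [(I.n : ℤ)]
    | 1 => rowMajor (weightMatrix I.w)
    | _ => []
  Correct := fun I s => DecidesAs I.HasNegativeTriangle s

/-! ### `k`-opt Detection -/

/-- `S` is the edge set of a Hamiltonian cycle of the complete graph on `Fin n`. -/
def IsTourEdgeSet {n : ℕ} (S : Finset (Sym2 (Fin n))) : Prop :=
  ∃ (a : Fin n) (p : (⊤ : SimpleGraph (Fin n)).Walk a a),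
    p.IsHamiltonianCycle ∧ p.edges.toFinset = S

/-- A complete graph on at least three vertices with integer edge weights, and a tour in it, given
by the cyclic sequence `tour 0, tour 1, …, tour (n - 1)` of all its vertices. -/
structure TourInstance where
  n : ℕ
  three_le : 3 ≤ n
  w : Sym2 (Fin n) → ℤ
  tour : Equiv.Perm (Fin n)

namespace TourInstance

/-- The edges of the given tour: consecutive vertices, cyclically. -/
def tourEdges (I : TourInstance) : Finset (Sym2 (Fin I.n)) :=
  Finset.univ.image fun i => s(I.tour i, I.tour (finRotate I.n i))

/-- The pair `(Em, Ep)` is a `k`-move: `k` edges `Em` of the tour are removed, `k` edges `Ep` of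
the complete graph are added, and the result is again a tour. -/
def IsMove (I : TourInstance) (k : ℕ) (Em Ep : Finset (Sym2 (Fin I.n))) : Prop :=
  Em.card = k ∧ Ep.card = k ∧ Em ⊆ I.tourEdges ∧
    (Ep : Set (Sym2 (Fin I.n))) ⊆ (⊤ : SimpleGraph (Fin I.n)).edgeSet ∧
    IsTourEdgeSet ((I.tourEdges \ Em) ∪ Ep)

/-- Some `k`-move produces a tour of smaller weight. -/
def HasImprovingMove (I : TourInstance) (k : ℕ) : Prop :=
  ∃ Em Ep : Finset (Sym2 (Fin I.n)), I.IsMove k Em Ep ∧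
    ∑ e ∈ (I.tourEdges \ Em) ∪ Ep, I.w e < ∑ e ∈ I.tourEdges, I.w e

end TourInstance

/-- `k`-opt Detection.  Bank `0` holds `n`, bank `1` the weight matrix, bank `2` the tour. -/
def kOptDetection (k : ℕ) : GraphProblem where
  Inst := TourInstance
  size := fun I => I.n
  WeightsBoundedBy := fun I M => EdgeWeightsBoundedBy I.w M
  input := fun I A => match A with
    | 0 => [(I.n : ℤ)]
    | 1 => rowMajor (weightMatrix I.w)
    | 2 => List.ofFn fun i : Fin I.n => ((I.tour i : ℕ) : ℤ)
    | _ => []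
  Correct := fun I s => DecidesAs (I.HasImprovingMove k) s

/-! ### All Pairs Shortest Paths -/

/-- `WalkWeight arc u v d`: some directed walk from `u` to `v` has total weight `d`, where
`arc x y` is the weight of the arc from `x` to `y`, or `none` if there is no such arc. -/
inductive WalkWeight {n : ℕ} (arc : Fin n → Fin n → Option ℤ) : Fin n → Fin n → ℤ → Prop
  | nil (u : Fin n) : WalkWeight arc u u 0
  | cons {u v x : Fin n} {a d : ℤ} (h : arc u v = some a) (hw : WalkWeight arc v x d) :
      WalkWeight arc u x (a + d)

/-- A nonempty directed graph with integer arc weights and without cycles of negative weight. -/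
structure ShortestPathsInstance where
  n : ℕ
  n_pos : 1 ≤ n
  arc : Fin n → Fin n → Option ℤ
  no_negative_cycle : ∀ (u : Fin n) (d : ℤ), WalkWeight arc u u d → 0 ≤ d

/-- The final state holds all distances: for all `u`, `v`, cell `u * n + v` of bank `2` is `1` if
`v` can be reached from `u` and `0` otherwise, and in the former case cell `u * n + v` of bank `1`
is the least weight of a walk from `u` to `v`. -/
def ShortestPathsInstance.HoldsDistances (I : ShortestPathsInstance) (s : RamState) : Prop :=
  ∀ u v : Fin I.n,
    let x : ℤ := (u : ℕ) * (I.n : ℤ) + (v : ℕ)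
    (s.mem 2 x = 1 ∧ IsLeast {d : ℤ | WalkWeight I.arc u v d} (s.mem 1 x)) ∨
    (s.mem 2 x = 0 ∧ ∀ d : ℤ, ¬ WalkWeight I.arc u v d)

/-- All Pairs Shortest Paths.  Bank `0` holds `n`, bank `1` the matrix of the arc weights (`0` where
there is no arc), and bank `2` the `0/1` adjacency matrix; the answer has the same format. -/
def allPairsShortestPaths : GraphProblem where
  Inst := ShortestPathsInstance
  size := fun I => I.n
  WeightsBoundedBy := fun I M => ∀ u v a, I.arc u v = some a → |a| ≤ (M : ℤ)
  input := fun I A => match A with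
    | 0 => [(I.n : ℤ)]
    | 1 => rowMajor fun u v => (I.arc u v).getD 0
    | 2 => rowMajor fun u v => if (I.arc u v).isSome then 1 else 0
    | _ => []
  Correct := fun I s => I.HoldsDistances s

/-! The theorem is a chain of two reductions, both carried out by explicit machine programs.

From triangles to `4`-moves. Take three copies of the vertex set and replace every vertex by a
gadget, a pair of consecutive vertices on a tour through all `6 n` vertices. Gadget edges weigh `0`,
the other tour edges `-b`. An edge off the tour weighs `b`, unless it is a link: it joins the even
vertex of a gadget to the odd vertex of a gadget in the cyclically next copy that belongs to a
different vertex, and then it carries the weight of the corresponding edge of the graph. For `b ≥ 4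
M` an improving exchange of at most four edges can neither remove an edge of weight `-b` nor add one
of weight `b`. As both tours have degree two everywhere, the added links then permute at most four
gadgets, each being moved to the next copy. The cycles of such a permutation have length divisible
by three, so there is a single `3`-cycle, and it is a negative triangle
(`hasNegativeTriangle_of_exchange`). Conversely, a triangle with one vertex in each copy describes
the exchange of two consecutive segments of the tour. This replaces three edges and always yields a
tour; a fourth edge is removed and added back (`hasImprovingMove_of_hasNegativeTriangle`).

From triangles to shortest paths. Distances arise from about `log n` min-plus squarings of the arc
matrix, in which missing arcs have a large finite weight (`distMatrix_correct`). A min-plus product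
is found by binary search for all pairs `(i, j)` at once. A round has to decide for every pair
whether some `k` satisfies `d i k + d k j < v i j + p`. Rows, intermediate indices and columns are
split into `G` blocks of size `s`, about `n ^ (1/4)`. Each of the `G ^ 3` triples of blocks is a
tripartite graph on `3 s` vertices whose negative triangles are the witnesses for pairs not yet
marked (`blockInstance_hasNegativeTriangle`). When the triangle test is positive, the triple of
blocks is searched exhaustively in time `s ^ 3` and at least one new pair gets marked, so there are
at most `n ^ 2` searches. A triangle algorithm with exponent `3 - δ` makes a round cost about `G ^ 3
* s ^ (3 - δ) + n ^ 2 * s ^ 3`, which is of order `n ^ (3 - δ / 4)` up to logarithms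
(`markTime_le`). The weights now depend polynomially on `n` too; the resulting powers of `log n` are
absorbed by `n ^ (δ / 8)`.

The machine. `Achieves` expresses total correctness together with time and word bounds, and has one
rule per program construct. Subroutines run with time-stamped memory, so that one increment of a
counter makes their memory blank again (`Achieves.call`); otherwise the many calls on small
instances would have to pay for clearing it. -/

/-! ### Structured programs

Expressions and structured commands are compiled to the machine.  Variable `v` of the structured
language lives in register `3 * v`, temporaries in the registers `3 * k + 1`, and the registers of
subroutines in the registers `3 * r + 2`. -/

/-- Arithmetic operations. -/
inductive ArithOp where
  | add | sub | mul | div | mod | lt | eq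

/-- The machine operation of an arithmetic operation. -/
def ArithOp.toWordOp : ArithOp → WordOp
  | .add => .add
  | .sub => .sub
  | .mul => .mul
  | .div => .div
  | .mod => .mod
  | .lt => .lt
  | .eq => .eq

/-- Expressions over variables and memory cells. -/
inductive RamExpr where
  | var (v : ℕ)
  | const (c : ℤ)
  | bin (o : ArithOp) (a b : RamExpr)
  | ld (A : ℕ) (e : RamExpr)
  | ite (c a b : RamExpr)

namespace RamExpr

/-- The value of an expression. -/
def eval (s : RamState) : RamExpr → ℤ
  | var v => s.reg v
  | const c => c
  | bin o a b => o.toWordOp.eval (a.eval s) (b.eval s)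
  | ld A e => s.mem A (e.eval s)
  | ite c a b => if c.eval s ≠ 0 then a.eval s else b.eval s

/-- All values arising in an expression are at most the `deg`-th power of a bound on the state. -/
def deg : RamExpr → ℕ
  | var _ => 1
  | const c => c.natAbs
  | bin _ a b => a.deg + b.deg + 1
  | ld _ e => e.deg + 1
  | ite c a b => c.deg + a.deg + b.deg

/-- An upper bound on the number of steps of the evaluation. -/
def cost : RamExpr → ℕ
  | var _ => 2
  | const _ => 1
  | bin _ a b => a.cost + b.cost + 1
  | ld _ e => e.cost + 1
  | ite c a b => c.cost + a.cost + b.cost + 1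

/-- The machine program that evaluates an expression into temporary `k`. -/
def compile : RamExpr → ℕ → RamProgram
  | var v, k => .seq (.const (3 * k + 1) 0) (.op .add (3 * k + 1) (3 * v) (3 * k + 1))
  | const c, k => .const (3 * k + 1) c
  | bin o a b, k => .seq (a.compile k) (.seq (b.compile (k + 1))
      (.op o.toWordOp (3 * k + 1) (3 * k + 1) (3 * (k + 1) + 1)))
  | ld A e, k => .seq (e.compile k) (.load (3 * k + 1) A (3 * k + 1))
  | ite c a b, k => .seq (c.compile k) (.ite (3 * k + 1) (a.compile k) (b.compile k))

/-- The expression does not read bank `A`. -/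
def Avoids (A : ℕ) : RamExpr → Prop
  | var _ => True
  | const _ => True
  | bin _ a b => a.Avoids A ∧ b.Avoids A
  | ld A' e => A' ≠ A ∧ e.Avoids A
  | ite c a b => c.Avoids A ∧ a.Avoids A ∧ b.Avoids A

/-- Side conditions on concrete expressions are thereby settled by evaluation. -/
instance decidableAvoids (A : ℕ) : (e : RamExpr) → Decidable (e.Avoids A)
  | var _ => isTrue trivial
  | const _ => isTrue trivial
  | bin _ a b =>
      have := decidableAvoids A a
      have := decidableAvoids A b
      inferInstanceAs (Decidable (_ ∧ _))
  | ld _ e =>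
      have := decidableAvoids A e
      inferInstanceAs (Decidable (_ ∧ _))
  | ite c a b =>
      have := decidableAvoids A c
      have := decidableAvoids A a
      have := decidableAvoids A b
      inferInstanceAs (Decidable (_ ∧ _ ∧ _))

/-- Used for loops that fill bank `A`: cells already written cannot influence the values still to be
computed. -/
theorem Avoids.eval_congr {A : ℕ} {s s' : RamState} (hr : s.reg = s'.reg)
    (hm : ∀ A', A' ≠ A → s.mem A' = s'.mem A') :
    ∀ {e : RamExpr}, e.Avoids A → e.eval s = e.eval s'
  | var _, _ => by simp [eval, hr]
  | const _, _ => rfl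
  | bin _ a b, h => by simp [eval, eval_congr hr hm h.1, eval_congr hr hm h.2]
  | ld _ e, h => by simp [eval, eval_congr hr hm h.2, hm _ h.1]
  | ite c a b, h => by
      simp [eval, eval_congr hr hm h.1, eval_congr hr hm h.2.1, eval_congr hr hm h.2.2]

end RamExpr

/-- All variables and memory cells have absolute value at most `X`. -/
def RamState.BoundedBy (X : ℕ) (s : RamState) : Prop :=
  (∀ v, |s.reg v| ≤ (X : ℤ)) ∧ ∀ A x, |s.mem A x| ≤ (X : ℤ)

theorem ArithOp.abs_eval_le (o : ArithOp) {X a b : ℕ} {x y : ℤ} (hX : 2 ≤ X)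
    (hx : |x| ≤ (X : ℤ) ^ a) (hy : |y| ≤ (X : ℤ) ^ b) :
    |o.toWordOp.eval x y| ≤ (X : ℤ) ^ (a + b + 1) := by
  have hX' : (2 : ℤ) ≤ X := by exact_mod_cast hX
  have hA : (1 : ℤ) ≤ (X : ℤ) ^ a := one_le_pow₀ (by linarith)
  have hB : (1 : ℤ) ≤ (X : ℤ) ^ b := one_le_pow₀ (by linarith)
  have hAB : (X : ℤ) ^ (a + b + 1) = (X : ℤ) ^ a * (X : ℤ) ^ b * X := by ring
  have h1 : (X : ℤ) ^ a ≤ (X : ℤ) ^ a * (X : ℤ) ^ b := by nlinarith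
  have h2 : (X : ℤ) ^ b ≤ (X : ℤ) ^ a * (X : ℤ) ^ b := by nlinarith
  have h3 : (X : ℤ) ^ a * (X : ℤ) ^ b * 2 ≤ (X : ℤ) ^ a * (X : ℤ) ^ b * X :=
    mul_le_mul_of_nonneg_left hX' (by positivity)
  rw [hAB]
  have hmul : |x * y| ≤ (X : ℤ) ^ a * (X : ℤ) ^ b := by
    rw [abs_mul]; exact mul_le_mul hx hy (abs_nonneg _) (by positivity)
  have hite : ∀ p : Prop, ∀ [Decidable p], |if p then (1 : ℤ) else 0| ≤ 1 := by
    intro p _; split <;> simp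
  cases o <;> simp only [toWordOp, WordOp.eval]
  · have := abs_add_le x y; linarith
  · have := abs_sub x y; linarith
  · linarith
  · have : |x / y| ≤ |x| := Int.abs_ediv_le_abs x y
    linarith
  · have : |x % y| ≤ |x| + |y| := by
      rcases eq_or_ne y 0 with rfl | h
      · simp
      · rw [abs_of_nonneg (Int.emod_nonneg _ h)]
        have := Int.emod_lt_abs x h
        have := abs_nonneg x
        linarith
    linarith
  · have := hite (x < y); linarith
  · have := hite (x = y); linarith

theorem RamExpr.abs_eval_le {X : ℕ} (hX : 2 ≤ X) {s : RamState} (hs : s.BoundedBy X) :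
    ∀ e : RamExpr, |e.eval s| ≤ (X : ℤ) ^ e.deg
  | var v => by simpa [eval, deg] using hs.1 v
  | const c => by
      -- The crude exponent `|c|` suffices because `|c| < X ^ |c|` for `X ≥ 2`.
      have h : c.natAbs ≤ X ^ c.natAbs := (Nat.lt_pow_self (by omega)).le
      simp only [eval, deg]
      rw [Int.abs_eq_natAbs]
      exact_mod_cast h
  | bin o a b => o.abs_eval_le hX (abs_eval_le hX hs a) (abs_eval_le hX hs b)
  | ld A e => by
      have hX1 : (1 : ℤ) ≤ X := by exact_mod_cast (by omega : 1 ≤ X)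
      have h1 : (1 : ℤ) ≤ (X : ℤ) ^ e.deg := one_le_pow₀ hX1
      have := hs.2 A (e.eval s)
      simp only [eval, deg, pow_succ]
      nlinarith
  | ite c a b => by
      have hX1 : (1 : ℤ) ≤ X := by exact_mod_cast (by omega : 1 ≤ X)
      simp only [eval, deg]
      split
      · exact (abs_eval_le hX hs a).trans (pow_le_pow_right₀ hX1 (by omega))
      · exact (abs_eval_le hX hs b).trans (pow_le_pow_right₀ hX1 (by omega))

/-- The machine state `s` represents the structured state `σ`, all of whose words are at most
`X`. -/
structure Represents (X : ℕ) (σ s : RamState) : Prop where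
  reg : ∀ v, s.reg (3 * v) = σ.reg v
  mem : s.mem = σ.mem
  bdd : σ.BoundedBy X

/-- Evaluation into temporary `k` touches only temporaries with index at least `k`, so a left
operand in temporary `k` survives while the right one is computed in temporary `k + 1`. Variables
and subroutine registers lie in the other residue classes modulo `3`. -/
theorem RamExpr.exec_compile {X D : ℕ} (hX : 2 ≤ X) {σ : RamState} (e : RamExpr) :
    ∀ (k : ℕ) (s : RamState), Represents X σ s → e.deg ≤ D →
    ∃ (t : ℕ) (s' : RamState), Exec (X ^ D) (e.compile k) s t s' ∧ t ≤ e.cost ∧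
      s'.mem = s.mem ∧ (∀ r, (∀ j, k ≤ j → r ≠ 3 * j + 1) → s'.reg r = s.reg r) ∧
      s'.reg (3 * k + 1) = e.eval σ := by
  have hX1 : (1 : ℤ) ≤ X := by exact_mod_cast (by omega : 1 ≤ X)
  have key : ∀ (e : RamExpr) (s : RamState), Represents X σ s → e.deg ≤ D →
      |e.eval σ| ≤ ((X ^ D : ℕ) : ℤ) := by
    intro e s hs hD
    push_cast
    exact (e.abs_eval_le hX hs.bdd).trans (pow_le_pow_right₀ hX1 hD)
  have frame : ∀ (k : ℕ) {s s' : RamState}, Represents X σ s → s'.mem = s.mem →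
      (∀ r, (∀ j, k ≤ j → r ≠ 3 * j + 1) → s'.reg r = s.reg r) → Represents X σ s' := by
    intro k s s' hs hm hr
    exact ⟨fun v => by rw [hr _ (by intros; omega), hs.reg], by rw [hm, hs.mem], hs.bdd⟩
  have upd : ∀ (k : ℕ) (s : RamState) (z : ℤ) (r : ℕ), (∀ j, k ≤ j → r ≠ 3 * j + 1) →
      (s.setReg (3 * k + 1) z).reg r = s.reg r := by
    intro k s z r hr
    simp [RamState.setReg, Function.update_of_ne (hr k le_rfl)]
  induction e with
  | var v =>
    intro k s hs hD
    refine ⟨_, _, .seq (.const _ 0 s (by simp)) (.op .add _ _ _ _ ?_), le_rfl, rfl, ?_, ?_⟩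
    · have := key (var v) s hs hD
      simpa [RamState.setReg, WordOp.eval, Function.update_of_ne (by omega : 3 * v ≠ 3 * k + 1),
        hs.reg, eval] using this
    · intro r hr
      rw [upd k _ _ _ hr, upd k _ _ _ hr]
    · simp [RamState.setReg, WordOp.eval, Function.update_of_ne (by omega : 3 * v ≠ 3 * k + 1),
        hs.reg, eval]
  | const c =>
    intro k s hs hD
    exact ⟨_, _, .const _ c s (key _ s hs hD), le_rfl, rfl, upd k s c, by simp [RamState.setReg, eval]⟩
  | bin o a b iha ihb =>
    intro k s hs hD
    have hD' : a.deg + b.deg + 1 ≤ D := hD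
    obtain ⟨t1, s1, e1, c1, m1, r1, v1⟩ := iha k s hs (by omega)
    obtain ⟨t2, s2, e2, c2, m2, r2, v2⟩ := ihb (k + 1) s1 (frame k hs m1 r1) (by omega)
    have h12 : s2.reg (3 * k + 1) = a.eval σ := by rw [r2 _ (by intros; omega), v1]
    refine ⟨_, _, .seq e1 (.seq e2 (.op _ _ _ _ _ ?_)), ?_, ?_, ?_, ?_⟩
    · rw [h12, v2]; exact key (bin o a b) s hs hD
    · simp only [cost]; omega
    · simp [RamState.setReg, m1, m2]
    · intro r hr
      rw [upd k _ _ _ hr, r2 r (fun j hj => hr j (by omega)), r1 r hr]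
    · simp [RamState.setReg, h12, v2, eval]
  | ld A e ih =>
    intro k s hs hD
    have hD' : e.deg + 1 ≤ D := hD
    obtain ⟨t1, s1, e1, c1, m1, r1, v1⟩ := ih k s hs (by omega)
    refine ⟨_, _, .seq e1 (.load _ _ _ _ ?_), ?_, ?_, ?_, ?_⟩
    · rw [v1, m1, hs.mem]; exact key (ld A e) s hs hD
    · simp only [cost]; omega
    · simp [RamState.setReg, m1]
    · intro r hr
      rw [upd k _ _ _ hr, r1 r hr]
    · simp [RamState.setReg, v1, m1, hs.mem, eval]
  | ite c a b ihc iha ihb =>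
    intro k s hs hD
    have hD' : c.deg + a.deg + b.deg ≤ D := hD
    obtain ⟨t1, s1, e1, c1, m1, r1, v1⟩ := ihc k s hs (by omega)
    have hs1 := frame k hs m1 r1
    by_cases h : c.eval σ = 0
    · obtain ⟨t2, s2, e2, c2, m2, r2, v2⟩ := ihb k s1 hs1 (by omega)
      refine ⟨_, _, .seq e1 (.ite_false (by rw [v1, h]) e2), ?_, by rw [m2, m1], ?_, ?_⟩
      · simp only [cost]; omega
      · intro r hr; rw [r2 r hr, r1 r hr]
      · simp [v2, eval, h]
    · obtain ⟨t2, s2, e2, c2, m2, r2, v2⟩ := iha k s1 hs1 (by omega)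
      refine ⟨_, _, .seq e1 (.ite_true (by rw [v1]; exact h) e2), ?_, by rw [m2, m1], ?_, ?_⟩
      · simp only [cost]; omega
      · intro r hr; rw [r2 r hr, r1 r hr]
      · simp [v2, eval, h]

theorem Represents.temp {X : ℕ} {σ s s' : RamState} (hs : Represents X σ s) (hm : s'.mem = s.mem)
    (hr : ∀ v, s'.reg (3 * v) = s.reg (3 * v)) : Represents X σ s' :=
  ⟨fun v => by rw [hr, hs.reg], by rw [hm, hs.mem], hs.bdd⟩

/-! ### Total correctness of structured programs -/

/-- Started in any machine state that represents `σ`, the program halts in a state representing some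
`σ'` after `t` steps such that `Q σ' t`; all words stay below `X ^ D`. -/
def Achieves (X D : ℕ) (P : RamProgram) (σ : RamState) (Q : RamState → ℕ → Prop) : Prop :=
  ∀ s, Represents X σ s → ∃ t s' σ', Exec (X ^ D) P s t s' ∧ Represents X σ' s' ∧ Q σ' t

namespace RamProgram

/-- `assign v e`: variable `v` receives the value of `e`. -/
def assign (v : ℕ) (e : RamExpr) : RamProgram :=
  .seq (e.compile 0) (.seq (.const 4 0) (.op .add (3 * v) 1 4))

/-- `storeE A a e`: the cell of bank `A` at the address `a` receives the value of `e`. -/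
def storeE (A : ℕ) (a e : RamExpr) : RamProgram :=
  .seq (a.compile 0) (.seq (e.compile 1) (.store A 1 4))

/-- Conditional execution. -/
def whenE (c : RamExpr) (P : RamProgram) : RamProgram :=
  .seq (c.compile 0) (.ite 1 P .skip)

/-- `whileE c P`: run `P` as long as `c` is nonzero. -/
def whileE (c : RamExpr) (P : RamProgram) : RamProgram :=
  .seq (c.compile 0) (.loop 1 (.seq P (c.compile 0)))

/-- `forLoop i N P`: run `P` for `i = 0, …, N - 1`, where `i` and `N` are variables. -/
def forLoop (i N : ℕ) (P : RamProgram) : RamProgram :=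
  .seq (assign i (.const 0)) (whileE (.bin .lt (.var i) (.var N))
    (.seq P (assign i (.bin .add (.var i) (.const 1)))))

/-- `fill i A N e`: for `i = 0, …, N - 1`, cell `i` of bank `A` receives the value of `e`. -/
def fill (i A N : ℕ) (e : RamExpr) : RamProgram :=
  forLoop i N (storeE A (.var i) e)

end RamProgram

namespace Achieves

variable {X D : ℕ} {P P' : RamProgram} {σ : RamState} {Q Q' : RamState → ℕ → Prop}

theorem mono (h : Achieves X D P σ Q)
    (hQ : ∀ σ' t, σ'.BoundedBy X → Q σ' t → Q' σ' t) : Achieves X D P σ Q' := by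
  intro s hs
  obtain ⟨t, s', σ', he, hr, hq⟩ := h s hs
  exact ⟨t, s', σ', he, hr, hQ _ _ hr.bdd hq⟩

theorem of_bounded (h : σ.BoundedBy X → Achieves X D P σ Q) : Achieves X D P σ Q :=
  fun s hs => h hs.bdd s hs

theorem seq (h : Achieves X D P σ fun σ' t => Achieves X D P' σ' fun σ'' t' => Q σ'' (t + t')) :
    Achieves X D (.seq P P') σ Q := by
  intro s hs
  obtain ⟨t, s', σ', he, hr, hq⟩ := h s hs
  obtain ⟨t', s'', σ'', he', hr', hq'⟩ := hq s' hr
  exact ⟨_, s'', σ'', .seq he he', hr', hq'⟩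

/-- Intermediate results may reach `X ^ D`, but the stored value must again be at most `X`. Hence
`X` bounds the state however long the program runs, and `D` depends only on the expressions that
occur. -/
theorem assign (hX : 2 ≤ X) {v : ℕ} {e : RamExpr} (hD : e.deg ≤ D)
    (hv : |e.eval σ| ≤ (X : ℤ)) (hDpos : 1 ≤ D)
    (h : ∀ t, t ≤ e.cost + 2 → Q (σ.setReg v (e.eval σ)) t) :
    Achieves X D (.assign v e) σ Q := by
  intro s hs
  obtain ⟨t, s1, e1, c1, m1, r1, v1⟩ := e.exec_compile hX 0 s hs hD
  have hXD : (X : ℤ) ≤ ((X ^ D : ℕ) : ℤ) := by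
    exact_mod_cast Nat.le_self_pow (by omega) X
  have hval : ((s1.setReg 4 0).reg 1 + (s1.setReg 4 0).reg 4) = e.eval σ := by
    simpa [RamState.setReg] using v1
  refine ⟨_, _, _, .seq e1 (.seq (.const 4 0 s1 (by simp)) (.op .add (3 * v) 1 4 _ ?_)), ?_,
    h _ (by omega)⟩
  · simp only [WordOp.eval, hval]; exact hv.trans hXD
  · simp only [WordOp.eval, hval]
    refine ⟨fun w => ?_, ?_, fun w => ?_, hs.bdd.2⟩
    · by_cases hw : w = v
      · subst hw; simp [RamState.setReg]
      · simp only [RamState.setReg]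
        rw [Function.update_of_ne (by omega), Function.update_of_ne (by omega),
          Function.update_of_ne hw, r1 _ (by intros; omega), hs.reg]
    · simp [RamState.setReg, m1, hs.mem]
    · by_cases hw : w = v
      · subst hw; simpa [RamState.setReg] using hv
      · simpa [RamState.setReg, Function.update_of_ne hw] using hs.bdd.1 w

theorem storeE (hX : 2 ≤ X) {A : ℕ} {a e : RamExpr} (hDa : a.deg ≤ D) (hDe : e.deg ≤ D)
    (hv : |e.eval σ| ≤ (X : ℤ))
    (h : ∀ t, t ≤ a.cost + e.cost + 1 → Q (σ.setMem A (a.eval σ) (e.eval σ)) t) :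
    Achieves X D (.storeE A a e) σ Q := by
  intro s hs
  obtain ⟨t, s1, e1, c1, m1, r1, v1⟩ := a.exec_compile hX 0 s hs hDa
  have hs1 : Represents X σ s1 := hs.temp m1 fun v => r1 _ (by intros; omega)
  obtain ⟨t2, s2, e2, c2, m2, r2, v2⟩ := e.exec_compile hX 1 s1 hs1 hDe
  have hs2 : Represents X σ s2 := hs1.temp m2 fun v => r2 _ (by intros; omega)
  have ha : s2.reg 1 = a.eval σ := by rw [r2 _ (by intros; omega), v1]
  refine ⟨_, _, _, .seq e1 (.seq e2 (.store A 1 4 s2)), ?_, h _ (by omega)⟩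
  rw [ha, v2]
  refine ⟨hs2.reg, by simp [RamState.setMem, hs2.mem], hs.bdd.1, fun A' x => ?_⟩
  by_cases hA : A' = A
  · subst hA
    simp only [RamState.setMem, Function.update_self]
    by_cases hx : x = a.eval σ
    · simpa [hx] using hv
    · simpa [hx] using hs.bdd.2 A' x
  · simpa [RamState.setMem, hA] using hs.bdd.2 A' x

theorem whenE (hX : 2 ≤ X) {c : RamExpr} (hD : c.deg ≤ D)
    (h1 : c.eval σ ≠ 0 → Achieves X D P σ fun σ' t => ∀ t', t' ≤ t + c.cost + 2 → t ≤ t' → Q σ' t')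
    (h0 : c.eval σ = 0 → ∀ t, t ≤ c.cost + 2 → Q σ t) :
    Achieves X D (.whenE c P) σ Q := by
  intro s hs
  obtain ⟨t, s1, e1, c1, m1, r1, v1⟩ := c.exec_compile hX 0 s hs hD
  have hs1 : Represents X σ s1 := hs.temp m1 fun v => r1 _ (by intros; omega)
  by_cases hc : c.eval σ = 0
  · exact ⟨_, _, _, .seq e1 (.ite_false (by rw [v1, hc]) (.skip s1)), hs1, h0 hc _ (by omega)⟩
  · obtain ⟨t', s', σ', he, hr, hq⟩ := h1 hc s1 hs1
    exact ⟨_, _, _, .seq e1 (.ite_true (by rw [v1]; exact hc) he), hr,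
      hq _ (by omega) (by omega)⟩

/-- A loop with an invariant indexed by the number of finished rounds and the time so far. -/
theorem whileE (hX : 2 ≤ X) {c : RamExpr} (hD : c.deg ≤ D) (I : ℕ → RamState → ℕ → Prop) (N : ℕ)
    (h0 : I 0 σ 0)
    (hstep : ∀ k < N, ∀ σ t, I k σ t → c.eval σ ≠ 0 ∧
      Achieves X D P σ fun σ' t' => ∀ t'', t'' ≤ t + t' + c.cost + 1 → I (k + 1) σ' t'')
    (hN : ∀ σ t, I N σ t → c.eval σ = 0)
    (hQ : ∀ σ' t t', t' ≤ t + c.cost + 1 → I N σ' t → Q σ' t') :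
    Achieves X D (.whileE c P) σ Q := by
  -- Induction on the number `m` of remaining rounds; register `1` always holds the current value of
  -- the condition. The last, failing test accounts for the `+ 1`.
  have main : ∀ m k, k + m = N → ∀ (σ : RamState) (t : ℕ) (s : RamState), I k σ t →
      Represents X σ s → s.reg 1 = c.eval σ →
      ∃ t' s' σ', Exec (X ^ D) (.loop 1 (.seq P (c.compile 0))) s t' s' ∧ Represents X σ' s' ∧
        ∃ t1, I N σ' t1 ∧ t + t' ≤ t1 + 1 := by
    intro m
    induction m with
    | zero =>
      intro k hk σ t s hI hs hv
      obtain rfl : k = N := hk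
      exact ⟨1, s, σ, Exec.loop_stop (by rw [hv]; exact hN _ _ hI), hs, t, hI, le_rfl⟩
    | succ m ih =>
      intro k hk σ t s hI hs hv
      obtain ⟨hc, hP⟩ := hstep k (by omega) σ t hI
      obtain ⟨t1, s1, σ1, he, hr, hq⟩ := hP s hs
      obtain ⟨t2, s2, e2, c2, m2, r2, v2⟩ := c.exec_compile hX 0 s1 hr hD
      have hs2 : Represents X σ1 s2 := hr.temp m2 fun v => r2 _ (by intros; omega)
      obtain ⟨t3, s3, σ3, he3, hr3, t4, hI4, hle⟩ :=
        ih (k + 1) (by omega) σ1 (t + t1 + t2 + 1) s2 (hq _ (by omega)) hs2 v2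
      exact ⟨_, s3, σ3, .loop_step (by rw [hv]; exact hc) (.seq he e2) he3, hr3, t4, hI4, by omega⟩
  intro s hs
  obtain ⟨t, s1, e1, c1, m1, r1, v1⟩ := c.exec_compile hX 0 s hs hD
  have hs1 : Represents X σ s1 := hs.temp m1 fun v => r1 _ (by intros; omega)
  obtain ⟨t', s', σ', he, hr, t2, hI, hle⟩ := main N 0 (by omega) σ 0 s1 h0 hs1 v1
  exact ⟨_, s', σ', .seq e1 he, hr, hQ _ t2 _ (by omega) hI⟩

/-- A counting loop with an invariant indexed by the counter and the time so far. -/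
theorem forLoop (hX : 2 ≤ X) {i N n : ℕ} (hD : 8 ≤ D) (hiN : i ≠ N) (hn : σ.reg N = n)
    (hnX : n ≤ X) (I : ℕ → RamState → ℕ → Prop)
    (h0 : ∀ t ≤ 3, I 0 (σ.setReg i 0) t)
    (hstep : ∀ k < n, ∀ (σ : RamState) (t : ℕ), I k σ t → σ.reg i = k → σ.reg N = n →
      Achieves X D P σ fun σ' t' => σ'.reg i = k ∧ σ'.reg N = n ∧
        ∀ t'', t'' ≤ t + t' + 12 → I (k + 1) (σ'.setReg i (k + 1)) t'')
    (hQ : ∀ (σ' : RamState) (t t' : ℕ), t' ≤ t + 6 → σ'.reg i = n → σ'.reg N = n → I n σ' t → Q σ' t') :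
    Achieves X D (.forLoop i N P) σ Q := by
  have hXZ : (2 : ℤ) ≤ X := by exact_mod_cast hX
  refine .seq (.assign hX (by simp [RamExpr.deg]) (by simp [RamExpr.eval]) (by omega)
    fun t0 ht0 => ?_)
  simp only [RamExpr.cost, RamExpr.eval] at ht0 ⊢
  refine .whileE hX (by simp [RamExpr.deg]; omega)
    (fun k σ t => σ.reg i = k ∧ σ.reg N = n ∧ I k σ (t0 + t)) n ?_ ?_ ?_ ?_
  · refine ⟨by simp [RamState.setReg], ?_, h0 _ (by omega)⟩
    simp [RamState.setReg, Function.update_of_ne hiN.symm, hn]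
  · rintro k hk σ t ⟨hi, hN, hI⟩
    refine ⟨?_, .seq ((hstep k hk σ _ hI hi hN).mono ?_)⟩
    · simp [RamExpr.eval, ArithOp.toWordOp, WordOp.eval, hi, hN, hk]
    · rintro σ' t' - ⟨hi', hN', hI'⟩
      have hval : (RamExpr.bin .add (.var i) (.const 1)).eval σ' = k + 1 := by
        simp [RamExpr.eval, ArithOp.toWordOp, WordOp.eval, hi']
      refine .assign hX (by simp [RamExpr.deg]; omega) ?_ (by omega) fun t1 ht1 t'' ht'' => ?_
      · rw [hval, abs_of_nonneg (by positivity)]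
        have : k + 1 ≤ X := by omega
        exact_mod_cast this
      · rw [hval]
        simp only [RamExpr.cost] at ht1 ht''
        refine ⟨by simp [RamState.setReg], ?_, hI' _ (by omega)⟩
        simp [RamState.setReg, Function.update_of_ne hiN.symm, hN']
  · rintro σ t ⟨hi, hN, hI⟩
    simp [RamExpr.eval, ArithOp.toWordOp, WordOp.eval, hi, hN]
  · rintro σ' t t' ht' ⟨hi, hN, hI⟩
    simp only [RamExpr.cost] at ht'
    exact hQ _ _ _ (by omega) hi hN hI

end Achieves

/-- The state after the first `n` cells of bank `A` have received the values `f 0, f 1, …`, and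
variable `i` the value `n`. -/
def RamState.filled (σ : RamState) (i A : ℕ) (n : ℕ) (f : ℤ → ℤ) : RamState where
  reg := Function.update σ.reg i n
  mem := Function.update σ.mem A fun x => if 0 ≤ x ∧ x < n then f x else σ.mem A x

theorem Achieves.fill {X D : ℕ} {σ : RamState} {Q : RamState → ℕ → Prop} (hX : 2 ≤ X)
    {i A N n : ℕ} {e : RamExpr} (hD : 8 ≤ D) (hDe : e.deg ≤ D) (hA : e.Avoids A) (hiN : i ≠ N)
    (hn : σ.reg N = n) (hnX : n ≤ X)
    (he : ∀ x : ℤ, 0 ≤ x → x < n → |e.eval (σ.setReg i x)| ≤ (X : ℤ))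
    (hQ : ∀ t, t ≤ (n + 1) * (e.cost + 20) →
      Q (σ.filled i A n fun x => e.eval (σ.setReg i x)) t) :
    Achieves X D (.fill i A N e) σ Q := by
  set f : ℤ → ℤ := fun x => e.eval (σ.setReg i x) with hf
  refine .forLoop hX hD hiN hn hnX
    (fun k σ' t => σ' = σ.filled i A k f ∧ t ≤ 3 + k * (e.cost + 20)) ?_ ?_ ?_
  · intro t ht
    refine ⟨?_, by omega⟩
    have : (fun x : ℤ => if 0 ≤ x ∧ x < ((0 : ℕ) : ℤ) then f x else σ.mem A x) = σ.mem A := by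
      funext x
      exact if_neg fun h => absurd h.2 (not_lt.mpr (by exact_mod_cast h.1))
    simp only [RamState.filled, RamState.setReg]
    rw [this, Function.update_eq_self]
    rfl
  · rintro k hk σ' t ⟨rfl, ht⟩ - hN
    have hev : e.eval (σ.filled i A k f) = f k :=
      RamExpr.Avoids.eval_congr (A := A) (s := σ.filled i A k f) (s' := σ.setReg i k) rfl
        (fun A' h => Function.update_of_ne h _ _) hA
    refine .storeE hX (by simp [RamExpr.deg]; omega) hDe ?_ fun t' ht' => ?_
    · rw [hev]; exact he _ (by positivity) (by exact_mod_cast hk)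
    · refine ⟨by simp [RamState.filled, RamState.setMem], hN, fun t'' ht'' => ⟨?_, ?_⟩⟩
      · rw [hev]
        simp only [RamState.filled, RamState.setMem, RamState.setReg, RamExpr.eval,
          Function.update_self, Function.update_idem, RamState.mk.injEq]
        refine ⟨by push_cast; rfl, ?_⟩
        congr 1
        funext x
        simp only [Function.update_apply]
        by_cases hx : x = k
        · subst hx; simp
        · have : (x < ((k + 1 : ℕ) : ℤ)) ↔ x < k := by push_cast; omega
          simp only [hx, if_false, this]
      · simp only [RamExpr.cost] at ht'
        have : (k + 1) * (e.cost + 20) = k * (e.cost + 20) + (e.cost + 20) := by ring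
        omega
  · rintro σ' t t' ht' - - ⟨rfl, ht⟩
    refine hQ _ ?_
    have : (n + 1) * (e.cost + 20) = n * (e.cost + 20) + (e.cost + 20) := by ring
    omega

/-! ### Subroutine calls

Bank `A` of a subroutine is kept in bank `8 + 2 * A`, and bank `9 + 2 * A` holds time stamps: a cell
counts as written in the present call if its stamp agrees with variable `1`, and as `0` otherwise. -/

namespace RamProgram

/-- A strict upper bound on the registers that occur in a program. -/
def width : RamProgram → ℕ
  | skip => 1
  | const r _ => r + 1
  | op _ r a b => r + a + b + 1
  | load r _ a => r + a + 1
  | store _ a b => a + b + 1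
  | seq P Q => P.width + Q.width
  | ite r P Q => r + 1 + P.width + Q.width
  | loop r P => r + 1 + P.width

theorem width_pos : ∀ P : RamProgram, 1 ≤ P.width
  | skip => le_rfl
  | const r _ => by simp [width]
  | op _ r a b => by simp [width]
  | load r _ a => by simp [width]
  | store _ a b => by simp [width]
  | seq P Q => by have := width_pos P; simp only [width]; omega
  | ite r P Q => by simp only [width]; omega
  | loop r P => by simp only [width]; omega

/-- The program as a subroutine, with stamped memory accesses. -/
def stamped : RamProgram → RamProgram
  | skip => .skip
  | const r c => .const (3 * r + 2) c
  | op o r a b => .op o (3 * r + 2) (3 * a + 2) (3 * b + 2)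
  | load r A a => .seq (.load 1 (9 + 2 * A) (3 * a + 2)) (.seq (.op .eq 1 1 3)
      (.ite 1 (.load (3 * r + 2) (8 + 2 * A) (3 * a + 2)) (.const (3 * r + 2) 0)))
  | store A a b => .seq (.store (8 + 2 * A) (3 * a + 2) (3 * b + 2))
      (.store (9 + 2 * A) (3 * a + 2) 3)
  | seq P Q => .seq P.stamped Q.stamped
  | ite r P Q => .ite (3 * r + 2) P.stamped Q.stamped
  | loop r P => .loop (3 * r + 2) P.stamped

/-- Set the first `n` registers of the subroutine to `0`. -/
def clearRegs : ℕ → RamProgram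
  | 0 => .skip
  | n + 1 => .seq (clearRegs n) (.const (3 * n + 2) 0)

/-- Run `P` as a subroutine; variable `res` receives the content of its register `0`. -/
def call (P : RamProgram) (res : ℕ) : RamProgram :=
  .seq (clearRegs P.width) (.seq P.stamped (.seq (.const 4 0) (.op .add (3 * res) 2 4)))

end RamProgram

/-- The memory that a subroutine sees. -/
def RamState.subMem (σ : RamState) (A : ℕ) (x : ℤ) : ℤ :=
  if σ.mem (9 + 2 * A) x = σ.reg 1 then σ.mem (8 + 2 * A) x else 0

/-- The machine state `s` simulates the state `p` of a subroutine called in `σ`. -/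
structure Simulates (X N : ℕ) (σ s p : RamState) : Prop where
  sub : ∀ r < N, s.reg (3 * r + 2) = p.reg r
  var : ∀ v, s.reg (3 * v) = σ.reg v
  low : ∀ A < 8, s.mem A = σ.mem A
  mem : ∀ A x, p.mem A x = if s.mem (9 + 2 * A) x = σ.reg 1 then s.mem (8 + 2 * A) x else 0
  bddReg : ∀ r, |p.reg r| ≤ (X : ℤ)
  bddMem : ∀ A x, |s.mem A x| ≤ (X : ℤ)
  stamp : ∀ A x, s.mem (9 + 2 * A) x ≤ σ.reg 1

/-! ### Simulation of subroutines on stamped memory. -/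

theorem Simulates.setReg {X N : ℕ} {σ s p : RamState} (h : Simulates X N σ s p) (r : ℕ) (z : ℤ)
    (hz : |z| ≤ (X : ℤ)) : Simulates X N σ (s.setReg (3 * r + 2) z) (p.setReg r z) where
  sub := fun r' hr' => by
    by_cases hr : r' = r
    · subst hr; simp [RamState.setReg]
    · have : 3 * r' + 2 ≠ 3 * r + 2 := by omega
      simpa [RamState.setReg, hr] using h.sub r' hr'
  var := fun v => by
    have : 3 * v ≠ 3 * r + 2 := by omega
    simpa [RamState.setReg, this] using h.var v
  low := h.low
  mem := h.mem
  bddReg := fun r' => by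
    by_cases hr : r' = r
    · subst hr; simpa [RamState.setReg] using hz
    · simpa [RamState.setReg, hr] using h.bddReg r'
  bddMem := h.bddMem
  stamp := h.stamp

theorem Simulates.setTemp {X N : ℕ} {σ s p : RamState} (h : Simulates X N σ s p) (z : ℤ) :
    Simulates X N σ (s.setReg 1 z) p where
  sub := fun r' hr' => by
    have : 3 * r' + 2 ≠ 1 := by omega
    simpa [RamState.setReg, this] using h.sub r' hr'
  var := fun v => by
    have : 3 * v ≠ 1 := by omega
    simpa [RamState.setReg, this] using h.var v
  low := h.low
  mem := h.mem
  bddReg := h.bddReg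
  bddMem := h.bddMem
  stamp := h.stamp

theorem Simulates.setMem {X N : ℕ} {σ s p : RamState} (h : Simulates X N σ s p)
    (hσ : |σ.reg 1| ≤ (X : ℤ)) (A : ℕ) (x z : ℤ) (hz : |z| ≤ (X : ℤ)) :
    Simulates X N σ ((s.setMem (8 + 2 * A) x z).setMem (9 + 2 * A) x (σ.reg 1))
      (p.setMem A x z) where
  sub := h.sub
  var := h.var
  low := fun A' hA' => by
    have h1 : A' ≠ 8 + 2 * A := by omega
    have h2 : A' ≠ 9 + 2 * A := by omega
    simpa [RamState.setMem, h1, h2] using h.low A' hA'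
  mem := fun A' x' => by
    by_cases hA : A' = A
    · subst hA
      by_cases hx : x' = x
      · subst hx
        have h1 : 8 + 2 * A' ≠ 9 + 2 * A' := by omega
        simp [RamState.setMem]
      · have h1 : 8 + 2 * A' ≠ 9 + 2 * A' := by omega
        simpa [RamState.setMem, hx] using h.mem A' x'
    · have h1 : 9 + 2 * A' ≠ 8 + 2 * A := by omega
      have h2 : 8 + 2 * A' ≠ 9 + 2 * A := by omega
      simpa [RamState.setMem, hA, h1, h2] using h.mem A' x'
  bddReg := h.bddReg
  bddMem := fun A' x' => by
    simp only [RamState.setMem]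
    by_cases h9 : A' = 9 + 2 * A
    · subst h9
      by_cases hx : x' = x
      · simpa [hx] using hσ
      · have : 9 + 2 * A ≠ 8 + 2 * A := by omega
        simpa [hx, this] using h.bddMem _ x'
    · by_cases h8 : A' = 8 + 2 * A
      · subst h8
        by_cases hx : x' = x
        · simpa [hx] using hz
        · simpa [hx] using h.bddMem _ x'
      · simpa [h8, h9] using h.bddMem A' x'
  stamp := fun A' x' => by
    by_cases hA : A' = A
    · subst hA
      by_cases hx : x' = x
      · simp [RamState.setMem, hx]
      · have h1 : 9 + 2 * A' ≠ 8 + 2 * A' := by omega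
        simpa [RamState.setMem, hx, h1] using h.stamp A' x'
    · have h1 : 9 + 2 * A' ≠ 8 + 2 * A := by omega
      simpa [RamState.setMem, hA, h1] using h.stamp A' x'

/-- Induction on the run. The factor `4` comes from loads: read the stamp, compare it, branch, then
read the cell or produce `0`. A store writes the cell and its stamp, which makes the cell current.
-/
theorem Exec.stamped {X N B B' : ℕ} {σ : RamState} (hB' : B' ≤ X) (hB : X ≤ B) (hX : 1 ≤ X)
    (hσ : |σ.reg 1| ≤ (X : ℤ)) {P : RamProgram} {p p' : RamState} {t : ℕ} (h : Exec B' P p t p') :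
    P.width ≤ N → ∀ s, Simulates X N σ s p →
      ∃ t' s', Exec B P.stamped s t' s' ∧ t' ≤ 4 * t ∧ Simulates X N σ s' p' := by
  have hB'X : (B' : ℤ) ≤ X := by exact_mod_cast hB'
  have hXB : (X : ℤ) ≤ B := by exact_mod_cast hB
  have h1B : (1 : ℤ) ≤ B := by exact_mod_cast hX.trans hB
  induction h with
  | skip s => exact fun _ s hs => ⟨1, s, .skip s, by omega, hs⟩
  | const r c p hc =>
    intro hw s hs
    have hc' := hc.trans hB'X
    exact ⟨1, _, .const _ c s (hc'.trans hXB), by omega, hs.setReg r c hc'⟩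
  | op o r a b p hc =>
    intro hw s hs
    simp only [RamProgram.width] at hw
    rw [← hs.sub a (by omega), ← hs.sub b (by omega)] at hc ⊢
    have hc' := hc.trans hB'X
    exact ⟨1, _, .op o _ _ _ s (hc'.trans hXB), by omega, hs.setReg r _ hc'⟩
  | load r A a p hc =>
    intro hw s hs
    simp only [RamProgram.width] at hw
    rw [← hs.sub a (by omega)] at hc ⊢
    have hc' := hc.trans hB'X
    set x := s.reg (3 * a + 2) with hx
    have h9 := hs.bddMem (9 + 2 * A) x
    have h3 : s.reg 3 = σ.reg 1 := hs.var 1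
    have hm := hs.mem A x
    have hs1 := hs.setTemp (s.mem (9 + 2 * A) x)
    have hs2 := hs1.setTemp (if s.mem (9 + 2 * A) x = σ.reg 1 then 1 else 0)
    have e1 : Exec B (.load 1 (9 + 2 * A) (3 * a + 2)) s 1 (s.setReg 1 (s.mem (9 + 2 * A) x)) :=
      .load _ _ _ s (h9.trans hXB)
    have e2 : Exec B (.op .eq 1 1 3) (s.setReg 1 (s.mem (9 + 2 * A) x)) 1
        ((s.setReg 1 (s.mem (9 + 2 * A) x)).setReg 1
          (if s.mem (9 + 2 * A) x = σ.reg 1 then 1 else 0)) := by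
      have := Exec.op (B := B) .eq 1 1 3 (s.setReg 1 (s.mem (9 + 2 * A) x)) (by
        simp only [WordOp.eval]; split <;> simp <;> omega)
      simpa [WordOp.eval, RamState.setReg, h3] using this
    set s2 := (s.setReg 1 (s.mem (9 + 2 * A) x)).setReg 1
          (if s.mem (9 + 2 * A) x = σ.reg 1 then 1 else 0) with hs2def
    have hx2 : s2.reg (3 * a + 2) = x := by
      have : 3 * a + 2 ≠ 1 := by omega
      simp [hs2def, RamState.setReg, hx]
    by_cases hst : s.mem (9 + 2 * A) x = σ.reg 1
    · rw [if_pos hst] at hm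
      have e3 : Exec B (.load (3 * r + 2) (8 + 2 * A) (3 * a + 2)) s2 1
          (s2.setReg (3 * r + 2) (s2.mem (8 + 2 * A) (s2.reg (3 * a + 2)))) :=
        .load _ _ _ s2 ((hs2.bddMem _ _).trans hXB)
      refine ⟨_, _, .seq e1 (.seq e2 (.ite_true ?_ e3)), by omega, ?_⟩
      · simp [hs2def, RamState.setReg, hst]
      · rw [hx2, hm]
        exact hs2.setReg r _ (hs.bddMem _ _)
    · rw [if_neg hst] at hm
      refine ⟨_, _, .seq e1 (.seq e2 (.ite_false ?_ (.const (3 * r + 2) 0 s2 (by simp)))),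
        by omega, ?_⟩
      · simp [hs2def, RamState.setReg, hst]
      · rw [hm]
        exact hs2.setReg r 0 (by simp)
  | store A a b p =>
    intro hw s hs
    simp only [RamProgram.width] at hw
    rw [← hs.sub a (by omega), ← hs.sub b (by omega)]
    refine ⟨_, _, .seq (.store _ _ _ s) (.store _ _ _ _), by omega, ?_⟩
    have := hs.setMem hσ A (s.reg (3 * a + 2)) (s.reg (3 * b + 2))
      (by rw [hs.sub b (by omega)]; exact hs.bddReg b)
    have h3 : s.reg 3 = σ.reg 1 := hs.var 1
    rw [← h3] at this
    exact this
  | seq hP hQ ihP ihQ =>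
    intro hw s hs
    simp only [RamProgram.width] at hw
    obtain ⟨t1, s1, e1, c1, h1⟩ := ihP (by omega) s hs
    obtain ⟨t2, s2, e2, c2, h2⟩ := ihQ (by omega) s1 h1
    exact ⟨_, s2, .seq e1 e2, by omega, h2⟩
  | ite_true hr hP ih =>
    intro hw s hs
    simp only [RamProgram.width] at hw
    obtain ⟨t1, s1, e1, c1, h1⟩ := ih (by omega) s hs
    exact ⟨_, s1, .ite_true (by rw [hs.sub _ (by omega)]; exact hr) e1, by omega, h1⟩
  | ite_false hr hP ih =>
    intro hw s hs
    simp only [RamProgram.width] at hw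
    obtain ⟨t1, s1, e1, c1, h1⟩ := ih (by omega) s hs
    exact ⟨_, s1, .ite_false (by rw [hs.sub _ (by omega)]; exact hr) e1, by omega, h1⟩
  | loop_stop hr =>
    intro hw s hs
    simp only [RamProgram.width] at hw
    exact ⟨1, s, Exec.loop_stop (by rw [hs.sub _ (by omega)]; exact hr), by omega, hs⟩
  | loop_step hr hP hL ihP ihL =>
    intro hw s hs
    have hw' := hw
    simp only [RamProgram.width] at hw'
    obtain ⟨t1, s1, e1, c1, h1⟩ := ihP (by omega) s hs
    obtain ⟨t2, s2, e2, c2, h2⟩ := ihL hw s1 h1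
    exact ⟨_, s2, .loop_step (by rw [hs.sub _ (by omega)]; exact hr) e1 e2, by omega, h2⟩

theorem exec_clearRegs (B : ℕ) (s : RamState) : ∀ n : ℕ, ∃ s',
    Exec B (.clearRegs n) s (n + 1) s' ∧ s'.mem = s.mem ∧ (∀ v, s'.reg (3 * v) = s.reg (3 * v)) ∧
      ∀ r < n, s'.reg (3 * r + 2) = 0
  | 0 => ⟨s, .skip s, rfl, fun _ => rfl, by simp⟩
  | n + 1 => by
    obtain ⟨s', he, hm, hv, hr⟩ := exec_clearRegs B s n
    refine ⟨_, .seq he (.const (3 * n + 2) 0 s' (by simp)), hm, fun v => ?_, fun r hrn => ?_⟩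
    · have : 3 * v ≠ 3 * n + 2 := by omega
      simpa [RamState.setReg, this] using hv v
    · by_cases h : r = n
      · subst h; simp [RamState.setReg]
      · have : 3 * r + 2 ≠ 3 * n + 2 := by omega
        simpa [RamState.setReg, h] using hr r (by omega)

/-- The hypothesis on `subMem` says that the cells with a current stamp hold exactly the input. All
stamps remain at most variable `1`, so increasing that variable before the next call makes the whole
memory of the subroutine read as `0`. -/
theorem Achieves.call {X D B : ℕ} {σ p : RamState} {P : RamProgram} {res t : ℕ}
    {input : ℕ → List ℤ} {Q : RamState → ℕ → Prop} (hX : 2 ≤ X) (hD : 1 ≤ D) (hB : B ≤ X)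
    (hP : Exec B P (.init input) t p) (hmem : σ.subMem = (RamState.init input).mem)
    (hstamp : ∀ A x, σ.mem (9 + 2 * A) x ≤ σ.reg 1)
    (hQ : ∀ σ' t', t' ≤ 4 * t + P.width + 3 →
      σ'.reg = Function.update σ.reg res (p.reg 0) → (∀ A < 8, σ'.mem A = σ.mem A) →
      (∀ A x, σ'.mem (9 + 2 * A) x ≤ σ.reg 1) → Q σ' t') :
    Achieves X D (.call P res) σ Q := by
  intro s hs
  have hXD : X ≤ X ^ D := Nat.le_self_pow (by omega) X
  obtain ⟨s1, e1, m1, v1, r1⟩ := exec_clearRegs (X ^ D) s P.width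
  have hsim : Simulates X P.width σ s1 (.init input) := by
    refine ⟨r1, fun v => by rw [v1, hs.reg], fun A _ => by rw [m1, hs.mem], fun A x => ?_,
      by simp [RamState.init], fun A x => by rw [m1, hs.mem]; exact hs.bdd.2 A x,
      fun A x => by rw [m1, hs.mem]; exact hstamp A x⟩
    rw [← hmem, m1, hs.mem]; rfl
  obtain ⟨t2, s2, e2, c2, h2⟩ := hP.stamped hB hXD (by omega) (hs.bdd.1 1) le_rfl s1 hsim
  have h0 : s2.reg 2 = p.reg 0 := h2.sub 0 P.width_pos
  have hval : (s2.setReg 4 0).reg 2 + (s2.setReg 4 0).reg 4 = p.reg 0 := by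
    simpa [RamState.setReg] using h0
  refine ⟨_, _, ⟨Function.update σ.reg res (p.reg 0), s2.mem⟩, .seq e1 (.seq e2 (.seq
    (.const 4 0 s2 (by simp)) (.op .add (3 * res) 2 4 _ ?_))), ?_, hQ _ _ (by omega) rfl h2.low
      h2.stamp⟩
  · simp only [WordOp.eval, hval]
    exact (h2.bddReg 0).trans (by exact_mod_cast hXD)
  · simp only [WordOp.eval, hval]
    refine ⟨fun v => ?_, rfl, fun v => ?_, h2.bddMem⟩
    · by_cases hv : v = res
      · subst hv; simp [RamState.setReg]
      · have h1 : 3 * v ≠ 3 * res := by omega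
        have h4 : 3 * v ≠ 4 := by omega
        simpa [RamState.setReg, hv, h1, h4] using h2.var v
    · by_cases hv : v = res
      · subst hv; simpa using h2.bddReg 0
      · simpa [hv] using hs.bdd.1 v

/-! ### Tours of complete graphs -/

theorem val_finRotate {N : ℕ} (x : Fin N) :
    ((finRotate N x : Fin N) : ℕ) = if (x : ℕ) + 1 = N then 0 else (x : ℕ) + 1 := by
  obtain ⟨m, rfl⟩ : ∃ m, N = m + 1 := ⟨N - 1, by have := x.2; omega⟩
  rw [coe_finRotate]
  by_cases h : x = Fin.last m
  · simp [h]
  · have : (x : ℕ) ≠ m := fun h' => h (Fin.ext h')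
    simp [h, this]

/-- Relabelling by `τ` carries the standard Hamiltonian cycle of `cycleGraph` to this edge set. -/
theorem isTourEdgeSet_perm {n : ℕ} (hn : 3 ≤ n) (τ : Equiv.Perm (Fin n)) :
    IsTourEdgeSet (Finset.univ.image fun i => s(τ i, τ (finRotate n i))) := by
  obtain ⟨m, rfl⟩ : ∃ m, n = m + 3 := ⟨n - 3, by omega⟩
  let f : SimpleGraph.cycleGraph (m + 3) →g (⊤ : SimpleGraph (Fin (m + 3))) :=
    ⟨τ, fun h => by simpa using h.ne⟩
  have hc := SimpleGraph.cycleGraph.isCycle_cycle (n := m)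
  have hham : (SimpleGraph.cycleGraph.cycle m).IsHamiltonianCycle := by
    rw [SimpleGraph.Walk.isHamiltonianCycle_iff_isCycle_and_length_eq]
    exact ⟨hc, by simp⟩
  refine ⟨_, (SimpleGraph.cycleGraph.cycle m).map f, hham.map τ.bijective, ?_⟩
  have hE : (SimpleGraph.cycleGraph.cycle m).edges.toFinset =
      Finset.univ.image fun i => s(i, finRotate (m + 3) i) := by
    -- One inclusion suffices: the cycle has `m + 3` distinct edges, and the image has at most that
    -- many elements.
    refine Finset.eq_of_subset_of_card_le (fun e he => ?_) ?_
    · rw [List.mem_toFinset] at he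
      have := (SimpleGraph.cycleGraph.cycle m).edges_subset_edgeSet he
      induction e with
      | _ u v =>
        rw [SimpleGraph.mem_edgeSet, SimpleGraph.cycleGraph_adj] at this
        rw [Finset.mem_image]
        rcases this with h | h
        · exact ⟨v, Finset.mem_univ _, by
            rw [finRotate_apply, ← h, add_sub_cancel, Sym2.eq_swap]⟩
        · exact ⟨u, Finset.mem_univ _, by rw [finRotate_apply, ← h, add_sub_cancel]⟩
    · rw [List.toFinset_card_of_nodup hc.edges_nodup, SimpleGraph.Walk.length_edges,
        SimpleGraph.cycleGraph.length_cycle]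
      exact Finset.card_image_le.trans (by simp)
  rw [SimpleGraph.Walk.edges_map]
  ext e
  have : ∀ e, e ∈ (SimpleGraph.cycleGraph.cycle m).edges ↔ ∃ i, s(i, finRotate (m + 3) i) = e := by
    intro e
    rw [← List.mem_toFinset, hE]; simp
  simp only [List.mem_toFinset, List.mem_map, this, Finset.mem_image, Finset.mem_univ, true_and]
  constructor
  · rintro ⟨_, ⟨i, rfl⟩, rfl⟩
    exact ⟨i, rfl⟩
  · rintro ⟨i, rfl⟩
    exact ⟨_, ⟨i, rfl⟩, rfl⟩

/-- Degree two at every vertex is, besides the absence of loops, all that is needed about tours to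
extract a triangle from an improving exchange. -/
theorem IsTourEdgeSet.card_filter_mem {n : ℕ} {S : Finset (Sym2 (Fin n))} (h : IsTourEdgeSet S)
    (v : Fin n) : (S.filter (v ∈ ·)).card = 2 := by
  obtain ⟨a, p, hp, rfl⟩ := h
  have h2 := hp.isCycle.ncard_neighborSet_toSubgraph_eq_two (hp.mem_support v)
  have himg : ((p.edges.toFinset.filter (v ∈ ·) : Finset (Sym2 (Fin n))) : Set (Sym2 (Fin n))) =
      (fun w => s(v, w)) '' (p.toSubgraph.neighborSet v) := by
    ext e
    simp only [Finset.coe_filter, List.mem_toFinset, Set.mem_ofPred_eq, Set.mem_image,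
      SimpleGraph.Subgraph.mem_neighborSet]
    constructor
    · rintro ⟨he, hv⟩
      obtain ⟨w, rfl⟩ := Sym2.mem_iff_exists.mp hv
      exact ⟨w, by rwa [← SimpleGraph.Subgraph.mem_edgeSet, SimpleGraph.Walk.mem_edges_toSubgraph],
        rfl⟩
    · rintro ⟨w, hw, rfl⟩
      rw [← SimpleGraph.Subgraph.mem_edgeSet, SimpleGraph.Walk.mem_edges_toSubgraph] at hw
      exact ⟨hw, by simp⟩
  rw [← Set.ncard_coe_finset, himg, Set.ncard_image_of_injective _ ?_, h2]
  exact fun x y hxy => Sym2.congr_right.mp hxy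

theorem IsTourEdgeSet.not_isDiag {n : ℕ} {S : Finset (Sym2 (Fin n))} (h : IsTourEdgeSet S)
    {e : Sym2 (Fin n)} (he : e ∈ S) : ¬ e.IsDiag := by
  obtain ⟨a, p, hp, rfl⟩ := h
  rw [List.mem_toFinset] at he
  exact SimpleGraph.not_isDiag_of_mem_edgeSet _ (p.edges_subset_edgeSet he)

/-! ### From triangles to improving moves

The graph of the reduction has `3 * n` gadgets, and gadget `g` consists of the vertices `2 * g` and
`2 * g + 1`; the gadgets `0, …, n - 1`, the gadgets `n, …, 2 * n - 1` and the gadgets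
`2 * n, …, 3 * n - 1` are three copies of the vertex set of the given graph. -/

/-- The weight of the edge between the vertices `lo < hi` in the reduction. -/
def gadgetWeight (n : ℤ) (entry : ℤ → ℤ → ℤ) (b lo hi : ℤ) : ℤ :=
  if hi = lo + 1 then (if lo % 2 = 0 then 0 else -b)
  else if lo = 0 ∧ hi + 1 = 6 * n then -b
  else
    let e := if lo % 2 = 0 then lo else hi
    let o := if lo % 2 = 0 then hi else lo
    if e % 2 = 0 ∧ o % 2 = 1 ∧ (e / 2 / n + 1) % 3 = o / 2 / n ∧ e / 2 % n ≠ o / 2 % n then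
      entry (e / 2 % n) (o / 2 % n)
    else b

/-- The matrix of the edge weights, with `0` outside. -/
def TriangleInstance.entry (I : TriangleInstance) (i j : ℤ) : ℤ :=
  if h : (0 ≤ i ∧ i < I.n) ∧ 0 ≤ j ∧ j < I.n then
    weightMatrix I.w ⟨i.toNat, by omega⟩ ⟨j.toNat, by omega⟩
  else 0

/-- The tour instance of the reduction. -/
def TriangleInstance.toTour (I : TriangleInstance) (b : ℤ) : TourInstance where
  n := 6 * I.n
  three_le := by have := I.n_pos; omega
  w := Sym2.lift ⟨fun u v => gadgetWeight I.n I.entry b (min (u : ℕ) (v : ℕ) : ℕ)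
    (max (u : ℕ) (v : ℕ) : ℕ), fun u v => by
      simp only [min_comm (u : ℕ), max_comm (u : ℕ)]⟩
  tour := 1

namespace TriangleInstance

variable (I : TriangleInstance) {b : ℤ}

/-- The even vertex of a gadget. -/
def evenVertex (g : Fin (3 * I.n)) : Fin (I.toTour b).n := ⟨2 * g, by
  have := g.2; simp only [toTour]; omega⟩

/-- The odd vertex of a gadget. -/
def oddVertex (g : Fin (3 * I.n)) : Fin (I.toTour b).n := ⟨2 * g + 1, by
  have := g.2; simp only [toTour]; omega⟩

/-- The vertex of the given graph that belongs to a gadget. -/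
def index (g : Fin (3 * I.n)) : Fin I.n := ⟨g % I.n, Nat.mod_lt _ I.n_pos⟩

/-- Gadgets `g`, `g'` of consecutive copies belonging to different vertices. -/
def Linked (g g' : Fin (3 * I.n)) : Prop :=
  ((g : ℕ) / I.n + 1) % 3 = (g' : ℕ) / I.n ∧ I.index g ≠ I.index g'

theorem entry_index (g g' : Fin (3 * I.n)) :
    I.entry (((g : ℕ) % I.n : ℕ) : ℤ) (((g' : ℕ) % I.n : ℕ) : ℤ) =
      weightMatrix I.w (I.index g) (I.index g') := by
  have h1 := Nat.mod_lt (g : ℕ) I.n_pos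
  have h2 := Nat.mod_lt (g' : ℕ) I.n_pos
  rw [entry, dif_pos (by omega)]
  rfl

theorem mem_tourEdges {u v : Fin (I.toTour b).n} : s(u, v) ∈ (I.toTour b).tourEdges ↔
    (v : ℕ) = u + 1 ∨ (u : ℕ) = v + 1 ∨ ((u : ℕ) = 0 ∧ (v : ℕ) + 1 = 6 * I.n) ∨
      ((v : ℕ) = 0 ∧ (u : ℕ) + 1 = 6 * I.n) := by
  have hN : (I.toTour b).n = 6 * I.n := rfl
  have hn := I.n_pos
  simp only [TourInstance.tourEdges, Finset.mem_image, Finset.mem_univ, true_and, Sym2.eq_iff]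
  have key : ∀ x y : Fin (I.toTour b).n, finRotate _ x = y ↔
      ((y : ℕ) = x + 1 ∨ ((y : ℕ) = 0 ∧ (x : ℕ) + 1 = 6 * I.n)) := by
    intro x y
    rw [Fin.ext_iff, val_finRotate]
    have := x.2; have := y.2
    split <;> omega
  constructor
  · rintro ⟨i, ⟨h1, h2⟩ | ⟨h1, h2⟩⟩
    · have h1' : i = u := h1
      have h2' : finRotate _ i = v := h2
      rw [h1', key] at h2'; tauto
    · have h1' : i = v := h1
      have h2' : finRotate _ i = u := h2
      rw [h1', key] at h2'; tauto
  · intro h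
    have h' : finRotate _ u = v ∨ finRotate _ v = u := by rw [key, key]; tauto
    rcases h' with h' | h'
    · exact ⟨u, .inl ⟨rfl, h'⟩⟩
    · exact ⟨v, .inr ⟨rfl, h'⟩⟩

theorem toTour_w (u v : Fin (I.toTour b).n) : (I.toTour b).w s(u, v) =
    gadgetWeight I.n I.entry b (min (u : ℕ) (v : ℕ) : ℕ) (max (u : ℕ) (v : ℕ) : ℕ) := rfl

theorem w_gadget (g : Fin (3 * I.n)) :
    (I.toTour b).w s(I.evenVertex g, I.oddVertex g) = 0 := by
  rw [toTour_w]
  simp [evenVertex, oddVertex, gadgetWeight]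

/-- The price of a removal: nothing for a gadget edge, `b` for every other tour edge. -/
theorem mem_tourEdges_cases {e : Sym2 (Fin (I.toTour b).n)} (he : e ∈ (I.toTour b).tourEdges) :
    (∃ g, e = s(I.evenVertex g, I.oddVertex g)) ∨ (I.toTour b).w e = -b := by
  have hn := I.n_pos
  induction e with
  | _ u v =>
    wlog huv : (u : ℕ) ≤ v generalizing u v
    · rw [Sym2.eq_swap] at he ⊢
      exact this v u he (by omega)
    rw [mem_tourEdges] at he
    have hu : (u : ℕ) < 6 * I.n := u.2
    rw [toTour_w, min_eq_left huv, max_eq_right huv]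
    by_cases h1 : (v : ℕ) = u + 1
    · by_cases h2 : (u : ℕ) % 2 = 0
      · left
        refine ⟨⟨u / 2, by omega⟩, ?_⟩
        congr 1 <;> rw [Fin.ext_iff] <;> simp only [evenVertex, oddVertex] <;> omega
      · right
        rw [gadgetWeight, if_pos (by omega), if_neg (by omega)]
    · right
      rw [gadgetWeight, if_neg (by omega), if_pos (by omega)]

/-- The vertices `2 g` and `2 g' + 1` are neighbours on the tour only if `g' = g`, or `g' + 1 = g`,
or `g = 0` and `g' = 3 n - 1`. Links change the index and lead to the next copy, which excludes all
three cases. -/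
theorem w_linked {g g' : Fin (3 * I.n)} (h : I.Linked g g') :
    (I.toTour b).w s(I.evenVertex g, I.oddVertex g') =
      weightMatrix I.w (I.index g) (I.index g') ∧
    s(I.evenVertex g, I.oddVertex g') ∉ (I.toTour b).tourEdges := by
  have hn := I.n_pos
  obtain ⟨hp, hi⟩ := h
  have hi' : (g : ℕ) % I.n ≠ (g' : ℕ) % I.n := fun h => hi (Fin.ext h)
  have hg := g.2
  have hg' := g'.2
  have hne : (g : ℕ) ≠ g' := by
    intro h
    exact hi' (by rw [h])
  have hc : (I.n : ℤ) ≠ 0 := by omega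
  -- This would be the closing edge of the tour; but a link from copy `0` ends in copy `1`, not in
  -- copy `2`.
  have h0 : ¬ ((g' : ℕ) = 3 * I.n - 1 ∧ (g : ℕ) = 0) := by
    rintro ⟨h1, h2⟩
    have e1 : (g' : ℕ) / I.n = 2 := by
      rw [h1]
      refine Nat.div_eq_of_lt_le ?_ ?_ <;> omega
    rw [e1, h2] at hp
    simp at hp
  have htour : s(I.evenVertex g, I.oddVertex g') ∉ (I.toTour b).tourEdges ∨
      ((g' : ℕ) + 1 = g ) := by
    by_cases h : (g' : ℕ) + 1 = g
    · exact .inr h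
    · left
      rw [mem_tourEdges]
      simp only [evenVertex, oddVertex]
      omega
  -- A link to an earlier gadget can only wrap around from copy `2` to copy `0`, and the nonempty
  -- copy `1` lies between these.
  have hadj : ¬ ((g' : ℕ) + 1 = g) := by
    intro h
    have h1 : (g' : ℕ) / I.n ≤ (g : ℕ) / I.n := Nat.div_le_div_right (by omega)
    have h2 : (g : ℕ) / I.n < 3 := Nat.div_lt_of_lt_mul (by omega)
    have h3 : (g : ℕ) / I.n = 2 := by omega
    have h4 : (g' : ℕ) / I.n = 0 := by omega
    have h5 : (g' : ℕ) < I.n := by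
      rcases Nat.div_eq_zero_iff.mp h4 with h | h <;> omega
    have h6 : 2 * I.n ≤ (g : ℕ) := by
      have := Nat.div_mul_le_self (g : ℕ) I.n
      rw [h3] at this; exact this
    omega
  refine ⟨?_, htour.resolve_right hadj⟩
  rw [toTour_w, ← entry_index]
  simp only [evenVertex, oddVertex]
  have key : ∀ lo hi : ℕ, (lo = 2 * (g : ℕ) ∧ hi = 2 * (g' : ℕ) + 1) ∨
      (hi = 2 * (g : ℕ) ∧ lo = 2 * (g' : ℕ) + 1) → lo < hi →
      gadgetWeight I.n I.entry b lo hi =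
        I.entry (((g : ℕ) % I.n : ℕ) : ℤ) (((g' : ℕ) % I.n : ℕ) : ℤ) := by
    intro lo hi h hlt
    have hE : (if (lo : ℤ) % 2 = 0 then (lo : ℤ) else hi) = ((2 * (g : ℕ) : ℕ) : ℤ) := by
      split <;> omega
    have hO : (if (lo : ℤ) % 2 = 0 then (hi : ℤ) else lo) = ((2 * (g' : ℕ) + 1 : ℕ) : ℤ) := by
      split <;> omega
    have d1 : ((2 * (g : ℕ) : ℕ) : ℤ) / 2 = ((g : ℕ) : ℤ) := by omega
    have d2 : ((2 * (g' : ℕ) + 1 : ℕ) : ℤ) / 2 = ((g' : ℕ) : ℤ) := by omega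
    rw [gadgetWeight, if_neg (by omega), if_neg (by omega)]
    simp only [hE, hO, d1, d2]
    rw [if_pos]
    · push_cast; rfl
    · refine ⟨by omega, by omega, by exact_mod_cast hp, by exact_mod_cast hi'⟩
  rcases Nat.lt_or_ge (2 * (g : ℕ)) (2 * (g' : ℕ) + 1) with h | h
  · rw [min_eq_left h.le, max_eq_right h.le]
    exact key _ _ (.inl ⟨rfl, rfl⟩) h
  · rw [min_eq_right h, max_eq_left h]
    exact key _ _ (.inr ⟨rfl, rfl⟩) (by omega)

theorem not_mem_tourEdges_cases {e : Sym2 (Fin (I.toTour b).n)} (hd : ¬ e.IsDiag)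
    (he : e ∉ (I.toTour b).tourEdges) :
    (∃ g g', I.Linked g g' ∧ e = s(I.evenVertex g, I.oddVertex g')) ∨ (I.toTour b).w e = b := by
  have hn := I.n_pos
  induction e with
  | _ u v =>
    wlog huv : (u : ℕ) ≤ v generalizing u v
    · rw [Sym2.eq_swap] at he hd ⊢
      exact this v u hd he (by omega)
    rw [mem_tourEdges] at he
    have hu : (u : ℕ) < 6 * I.n := u.2
    have hv : (v : ℕ) < 6 * I.n := v.2
    have hc : (I.n : ℤ) ≠ 0 := by omega
    rw [toTour_w, min_eq_left huv, max_eq_right huv]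
    have key : ∀ x y : Fin (I.toTour b).n, ((x : ℕ) : ℤ) % 2 = 0 → ((y : ℕ) : ℤ) % 2 = 1 →
        (((x : ℕ) : ℤ) / 2 / I.n + 1) % 3 = ((y : ℕ) : ℤ) / 2 / I.n →
        ((x : ℕ) : ℤ) / 2 % I.n ≠ ((y : ℕ) : ℤ) / 2 % I.n →
        ∃ g g', I.Linked g g' ∧ s(x, y) = s(I.evenVertex g, I.oddVertex g') := by
      intro x y h1 h2 h3 h4
      have hx : (x : ℕ) < 6 * I.n := x.2
      have hy : (y : ℕ) < 6 * I.n := y.2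
      refine ⟨⟨x / 2, by omega⟩, ⟨y / 2, by omega⟩, ⟨by exact_mod_cast h3, fun h => h4 ?_⟩, ?_⟩
      · rw [index, index, Fin.mk.injEq] at h
        exact_mod_cast h
      · congr 1 <;> rw [Fin.ext_iff] <;> simp only [evenVertex, oddVertex] <;> omega
    rw [gadgetWeight, if_neg (by omega), if_neg (by omega)]
    simp only
    by_cases hp : ((u : ℕ) : ℤ) % 2 = 0
    · simp only [hp, if_true]
      split
      · rename_i h
        left; exact key u v hp h.2.1 h.2.2.1 h.2.2.2
      · exact .inr rfl
    · simp only [hp, if_false]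
      split
      · rename_i h
        left; rw [Sym2.eq_swap]; exact key v u h.1 h.2.1 h.2.2.1 h.2.2.2
      · exact .inr rfl

theorem abs_weightMatrix_le {n : ℕ} {w : Sym2 (Fin n) → ℤ} {M : ℕ} (hM : EdgeWeightsBoundedBy w M)
    (i j : Fin n) : |weightMatrix w i j| ≤ M := by
  unfold weightMatrix
  split
  · simp
  · rename_i h
    exact hM _ (by simpa using h)

end TriangleInstance

/-! ### Improving exchanges correspond to negative triangles. -/

namespace TriangleInstance

variable (I : TriangleInstance) {b : ℤ}

theorem evenVertex_inj {g g' : Fin (3 * I.n)} :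
    (I.evenVertex g : Fin (I.toTour b).n) = I.evenVertex g' ↔ g = g' := by
  rw [Fin.ext_iff, Fin.ext_iff]; simp only [evenVertex]; omega

theorem oddVertex_inj {g g' : Fin (3 * I.n)} :
    (I.oddVertex g : Fin (I.toTour b).n) = I.oddVertex g' ↔ g = g' := by
  rw [Fin.ext_iff, Fin.ext_iff]; simp only [oddVertex]; omega

theorem evenVertex_ne_oddVertex (g g' : Fin (3 * I.n)) :
    (I.evenVertex g : Fin (I.toTour b).n) ≠ I.oddVertex g' := by
  rw [Ne, Fin.ext_iff]; simp only [evenVertex, oddVertex]; omega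

theorem edge_inj {g g' h h' : Fin (3 * I.n)} :
    (s(I.evenVertex g, I.oddVertex g') : Sym2 (Fin (I.toTour b).n)) =
      s(I.evenVertex h, I.oddVertex h') ↔ g = h ∧ g' = h' := by
  rw [Sym2.eq_iff, evenVertex_inj, oddVertex_inj]
  constructor
  · rintro (h | h)
    · exact h
    · exact absurd h.1 (I.evenVertex_ne_oddVertex _ _)
  · exact Or.inl

theorem tourEdges_isTour : IsTourEdgeSet (I.toTour b).tourEdges :=
  isTourEdgeSet_perm (I.toTour b).three_le _

theorem Linked.ne {g g' : Fin (3 * I.n)} (h : I.Linked g g') : g ≠ g' :=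
  fun e => h.2 (by rw [e])

/-- An improving exchange of at most four edges comes from a negative triangle. -/
theorem hasNegativeTriangle_of_exchange {M : ℕ} (hM : EdgeWeightsBoundedBy I.w M)
    (hb : 4 * (M : ℤ) ≤ b) {T : Finset (Sym2 (Fin (I.toTour b).n))} (hT : IsTourEdgeSet T)
    (hm : ((I.toTour b).tourEdges \ T).card ≤ 4) (hp : (T \ (I.toTour b).tourEdges).card ≤ 4)
    (hw : ∑ e ∈ T, (I.toTour b).w e < ∑ e ∈ (I.toTour b).tourEdges, (I.toTour b).w e) :
    I.HasNegativeTriangle := by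
  classical
  set H := (I.toTour b).tourEdges with hH
  set w := (I.toTour b).w with hwdef
  have hHT : IsTourEdgeSet H := I.tourEdges_isTour
  -- The edges common to both tours cancel.
  have hsum : ∑ e ∈ T \ H, w e < ∑ e ∈ H \ T, w e := by
    have h1 := Finset.sum_inter_add_sum_sdiff T H w
    have h2 := Finset.sum_inter_add_sum_sdiff H T w
    rw [Finset.inter_comm] at h2
    linarith
  -- Both tours have degree two at `v`, so as many removed as added edges meet `v`.
  have hdeg : ∀ v, ((H \ T).filter (v ∈ ·)).card = ((T \ H).filter (v ∈ ·)).card := by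
    intro v
    have h1 := hHT.card_filter_mem v
    have h2 := hT.card_filter_mem v
    have e1 : (H.filter (v ∈ ·) \ T.filter (v ∈ ·)) = (H \ T).filter (v ∈ ·) := by
      ext e; simp only [Finset.mem_sdiff, Finset.mem_filter]; tauto
    have e2 : (T.filter (v ∈ ·) \ H.filter (v ∈ ·)) = (T \ H).filter (v ∈ ·) := by
      ext e; simp only [Finset.mem_sdiff, Finset.mem_filter]; tauto
    rw [← e1, ← e2]
    exact Finset.card_sdiff_comm (h1.trans h2.symm)
  have hminus : ∀ e ∈ H \ T, (∃ g, e = s(I.evenVertex g, I.oddVertex g)) ∨ w e = -b :=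
    fun e he => I.mem_tourEdges_cases (Finset.mem_sdiff.mp he).1
  have hplus : ∀ e ∈ T \ H,
      (∃ g g', I.Linked g g' ∧ e = s(I.evenVertex g, I.oddVertex g')) ∨ w e = b :=
    fun e he => I.not_mem_tourEdges_cases (hT.not_isDiag (Finset.mem_sdiff.mp he).1)
      (Finset.mem_sdiff.mp he).2
  have hb0 : 0 ≤ b := by linarith [Int.natCast_nonneg M]
  have hM0 : (0 : ℤ) ≤ M := Int.natCast_nonneg M
  have hminus_le : ∀ e ∈ H \ T, w e ≤ 0 := by
    intro e he
    rcases hminus e he with ⟨g, rfl⟩ | h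
    · exact (I.w_gadget g).le
    · linarith
  have hplus_ge : ∀ e ∈ T \ H, -(M : ℤ) ≤ w e := by
    intro e he
    rcases hplus e he with ⟨g, g', hl, rfl⟩ | h
    · rw [hwdef, (I.w_linked hl).1]
      exact (abs_le.mp (abs_weightMatrix_le hM _ _)).1
    · linarith
  have hsumge : -(4 * (M : ℤ)) ≤ ∑ e ∈ T \ H, w e := by
    have h1 := Finset.card_nsmul_le_sum (T \ H) w (-(M : ℤ)) hplus_ge
    rw [nsmul_eq_mul] at h1
    have : ((T \ H).card : ℤ) ≤ 4 := by exact_mod_cast hp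
    nlinarith
  -- A removed edge of weight `-b` would force the added edges below `-b ≤ -4 M`, whereas there are
  -- at most four of them, each of weight at least `-M`.
  have hminus' : ∀ e ∈ H \ T, ∃ g, e = s(I.evenVertex g, I.oddVertex g) := by
    intro e he
    refine (hminus e he).resolve_right fun h => ?_
    have h1 := Finset.add_sum_erase (H \ T) w he
    have h2 : ∑ x ∈ (H \ T).erase e, w x ≤ 0 :=
      Finset.sum_nonpos fun x hx => hminus_le x (Finset.mem_of_mem_erase hx)
    linarith
  -- The other added edges cannot compensate an edge of weight `b ≥ 4 M`, and the removed edges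
  -- weigh at most `0` in total.
  have hplus' : ∀ e ∈ T \ H, ∃ g g', I.Linked g g' ∧ e = s(I.evenVertex g, I.oddVertex g') := by
    intro e he
    refine (hplus e he).resolve_right fun h => ?_
    have h1 := Finset.card_nsmul_le_sum ((T \ H).erase e) w (-(M : ℤ))
      fun x hx => hplus_ge x (Finset.mem_of_mem_erase hx)
    rw [nsmul_eq_mul] at h1
    have h2 : (((T \ H).erase e).card : ℤ) ≤ 4 := by
      exact_mod_cast (Finset.card_erase_le).trans hp
    have h3 := Finset.add_sum_erase (T \ H) w he
    have h4 := Finset.sum_nonpos hminus_le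
    nlinarith
  have hminus0 : ∑ e ∈ H \ T, w e = 0 := by
    refine Finset.sum_eq_zero fun e he => ?_
    obtain ⟨g, rfl⟩ := hminus' e he
    exact I.w_gadget g
  let K : Finset (Fin (3 * I.n)) :=
    Finset.univ.filter fun g => s(I.evenVertex g, I.oddVertex g) ∈ H \ T
  have hK : K.card ≤ 4 := by
    refine (Finset.card_le_card_of_injOn (fun g => s(I.evenVertex g, I.oddVertex g)) ?_ ?_).trans hm
    · intro g hg; simpa [K] using hg
    · intro g _ g' _ h
      exact (I.edge_inj.mp h).1
  -- The added links as a relation between gadgets. The facts below make it the graph of a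
  -- permutation of the set `K` of gadgets whose edge is removed.
  let R : Fin (3 * I.n) → Fin (3 * I.n) → Prop := fun g g' =>
    s(I.evenVertex g, I.oddVertex g') ∈ T \ H
  have hlink : ∀ {g g'}, R g g' → I.Linked g g' := by
    intro g g' h
    obtain ⟨x, y, hl, he⟩ := hplus' _ h
    obtain ⟨rfl, rfl⟩ := I.edge_inj.mp he
    exact hl
  -- Gadget edges are pairwise disjoint, so a vertex meets at most one removed edge and, by the
  -- balance of degrees, at most one added edge.
  have hcard : ∀ v : Fin (I.toTour b).n, ((T \ H).filter (v ∈ ·)).card ≤ 1 := by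
    intro v
    rw [← hdeg, Finset.card_le_one]
    intro x hx y hy
    rw [Finset.mem_filter] at hx hy
    obtain ⟨g, rfl⟩ := hminus' x hx.1
    obtain ⟨g', rfl⟩ := hminus' y hy.1
    rw [Sym2.mem_iff] at hx hy
    have n1 := I.evenVertex_ne_oddVertex (b := b)
    rcases hx.2 with rfl | rfl <;> rcases hy.2 with h | h
    · rw [I.evenVertex_inj.mp h]
    · exact absurd h (n1 _ _)
    · exact absurd h.symm (n1 _ _)
    · rw [I.oddVertex_inj.mp h]
  have hcov : ∀ v, (∃ e ∈ T \ H, v ∈ e) ↔ ∃ e ∈ H \ T, v ∈ e := by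
    intro v
    have := hdeg v
    rw [← Finset.filter_nonempty_iff, ← Finset.filter_nonempty_iff, ← Finset.card_pos,
      ← Finset.card_pos, this]
  have hKl : ∀ {g g'}, R g g' → g ∈ K := by
    intro g g' h
    obtain ⟨e, he, hv⟩ := (hcov (I.evenVertex g)).mp ⟨_, h, Sym2.mem_mk_left _ _⟩
    obtain ⟨x, rfl⟩ := hminus' e he
    rw [Sym2.mem_iff, evenVertex_inj] at hv
    obtain rfl := hv.resolve_right (I.evenVertex_ne_oddVertex _ _)
    simpa [K] using he
  have hKr : ∀ {g g'}, R g g' → g' ∈ K := by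
    intro g g' h
    obtain ⟨e, he, hv⟩ := (hcov (I.oddVertex g')).mp ⟨_, h, Sym2.mem_mk_right _ _⟩
    obtain ⟨x, rfl⟩ := hminus' e he
    rw [Sym2.mem_iff, oddVertex_inj] at hv
    obtain rfl := hv.resolve_left (I.evenVertex_ne_oddVertex _ _).symm
    simpa [K] using he
  have hnext : ∀ {g}, g ∈ K → ∃ g', R g g' := by
    intro g hg
    obtain ⟨e, he, hv⟩ := (hcov (I.evenVertex g)).mpr
      ⟨_, (Finset.mem_filter.mp hg).2, Sym2.mem_mk_left _ _⟩
    obtain ⟨x, y, hl, rfl⟩ := hplus' e he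
    rw [Sym2.mem_iff, evenVertex_inj] at hv
    obtain rfl := hv.resolve_right (I.evenVertex_ne_oddVertex _ _)
    exact ⟨y, he⟩
  have hfun : ∀ {g x y}, R g x → R g y → x = y := by
    intro g x y hx hy
    have := Finset.card_le_one.mp (hcard (I.evenVertex g)) _
      (Finset.mem_filter.mpr ⟨hx, Sym2.mem_mk_left _ _⟩) _
      (Finset.mem_filter.mpr ⟨hy, Sym2.mem_mk_left _ _⟩)
    exact (I.edge_inj.mp this).2
  have hinj : ∀ {g x y}, R x g → R y g → x = y := by
    intro g x y hx hy
    have := Finset.card_le_one.mp (hcard (I.oddVertex g)) _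
      (Finset.mem_filter.mpr ⟨hx, Sym2.mem_mk_right _ _⟩) _
      (Finset.mem_filter.mpr ⟨hy, Sym2.mem_mk_right _ _⟩)
    exact (I.edge_inj.mp this).1
  have hfive : ∀ x1 x2 x3 x4 x5 : Fin (3 * I.n), x1 ∈ K → x2 ∈ K → x3 ∈ K → x4 ∈ K → x5 ∈ K →
      ¬ [x1, x2, x3, x4, x5].Nodup := by
    intro x1 x2 x3 x4 x5 h1 h2 h3 h4 h5 hnd
    have : [x1, x2, x3, x4, x5].toFinset ⊆ K := by
      intro x hx
      simp only [List.mem_toFinset, List.mem_cons, List.not_mem_nil, or_false] at hx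
      rcases hx with rfl | rfl | rfl | rfl | rfl <;> assumption
    have := Finset.card_le_card this
    rw [List.toFinset_card_of_nodup hnd] at this
    simp only [List.length_cons, List.length_nil] at this
    omega
  obtain ⟨e0, he0⟩ : (T \ H).Nonempty := by
    rw [Finset.nonempty_iff_ne_empty]
    intro h
    rw [h, hminus0] at hsum
    simp at hsum
  obtain ⟨g0, g1, -, rfl⟩ := hplus' e0 he0
  have r0 : R g0 g1 := he0
  obtain ⟨g2, r1⟩ := hnext (hKr r0)
  obtain ⟨g3, r2⟩ := hnext (hKr r1)
  have hpart : ∀ g : Fin (3 * I.n), (g : ℕ) / I.n < 3 := fun g =>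
    Nat.div_lt_of_lt_mul (by have := g.2; omega)
  have p0 := (hlink r0).1
  have p1 := (hlink r1).1
  have p2 := (hlink r2).1
  have q0 := hpart g0
  have n01 : g0 ≠ g1 := (hlink r0).ne
  have n12 : g1 ≠ g2 := (hlink r1).ne
  have n02 : g0 ≠ g2 := by rintro rfl; omega
  -- Each link raises the copy by one modulo three. If the third link did not lead back to `g0`, the
  -- fourth would reach a fifth gadget: `g4` lies in the copy of `g1`, and injectivity of `R` keeps
  -- it different from `g1`.
  have h30 : g3 = g0 := by
    by_contra hne
    have n31 : g3 ≠ g1 := by rintro rfl; omega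
    have n32 : g3 ≠ g2 := (hlink r2).ne.symm
    obtain ⟨g4, r3⟩ := hnext (hKr r2)
    have p3 := (hlink r3).1
    have n43 : g4 ≠ g3 := (hlink r3).ne.symm
    have n41 : g4 ≠ g1 := by rintro rfl; exact hne (hinj r3 r0)
    have n42 : g4 ≠ g2 := by rintro rfl; exact n31 (hinj r3 r1)
    have n40 : g4 ≠ g0 := by rintro rfl; exact n32 (by omega)
    refine hfive g0 g1 g2 g3 g4 (hKl r0) (hKr r0) (hKr r1) (hKr r2) (hKr r3) ?_
    simp only [List.nodup_cons, List.mem_cons, List.not_mem_nil, or_false, not_or]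
    exact ⟨⟨n01, n02, Ne.symm hne, n40.symm⟩, ⟨n12, n31.symm, n41.symm⟩, ⟨n32.symm, n42.symm⟩,
      n43.symm, not_false, List.nodup_nil⟩
  subst h30
  -- A further link would start at a fourth gadget and, by injectivity, end at a fifth.
  have hall : T \ H = {s(I.evenVertex g3, I.oddVertex g1), s(I.evenVertex g1, I.oddVertex g2),
      s(I.evenVertex g2, I.oddVertex g3)} := by
    ext e
    simp only [Finset.mem_insert, Finset.mem_singleton]
    constructor
    · intro he
      obtain ⟨g, g', hl, rfl⟩ := hplus' e he
      have r : R g g' := he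
      by_cases c0 : g = g3
      · subst c0; rw [hfun r r0]; simp
      by_cases c1 : g = g1
      · subst c1; rw [hfun r r1]; simp
      by_cases c2 : g = g2
      · subst c2; rw [hfun r r2]; simp
      exfalso
      have d1 : g' ≠ g1 := by rintro rfl; exact c0 (hinj r r0)
      have d2 : g' ≠ g2 := by rintro rfl; exact c1 (hinj r r1)
      have d3 : g' ≠ g3 := by rintro rfl; exact c2 (hinj r r2)
      refine hfive g3 g1 g2 g g' (hKl r0) (hKr r0) (hKr r1) (hKl r) (hKr r) ?_
      simp only [List.nodup_cons, List.mem_cons, List.not_mem_nil, or_false, not_or]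
      exact ⟨⟨n01, n02, Ne.symm c0, d3.symm⟩, ⟨n12, Ne.symm c1, d1.symm⟩, ⟨Ne.symm c2, d2.symm⟩,
        hl.ne, not_false, List.nodup_nil⟩
    · rintro (rfl | rfl | rfl) <;> assumption
  have hw3 : ∑ e ∈ T \ H, w e = weightMatrix I.w (I.index g3) (I.index g1) +
      weightMatrix I.w (I.index g1) (I.index g2) + weightMatrix I.w (I.index g2) (I.index g3) := by
    rw [hall, Finset.sum_insert, Finset.sum_insert, Finset.sum_singleton, hwdef,
      (I.w_linked (hlink r0)).1, (I.w_linked (hlink r1)).1, (I.w_linked (hlink r2)).1, add_assoc]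
    · rw [Finset.mem_singleton, edge_inj]; tauto
    · rw [Finset.mem_insert, Finset.mem_singleton, edge_inj, edge_inj]; tauto
  have i0 := (hlink r0).2
  have i1 := (hlink r1).2
  have i2 := (hlink r2).2
  refine ⟨I.index g3, I.index g1, I.index g2, i0, i1, i2.symm, ?_⟩
  rw [hw3, hminus0, weightMatrix, weightMatrix, weightMatrix, if_neg i0, if_neg i1, if_neg i2] at hsum
  rw [Sym2.eq_swap (a := I.index g3) (b := I.index g2)]
  exact hsum

/-- The values of the permutation that exchanges the segments `(p, q]` and `(q, r]`. -/
def segmentSwap (p q r x : ℕ) : ℕ :=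
  if x ≤ p then x else if x ≤ p + (r - q) then x + (q - p) else if x ≤ r then x - (r - q) else x

/-- The permutation that exchanges the segments `(p, q]` and `(q, r]`. -/
def segmentSwapPerm {N p q r : ℕ} (hpq : p < q) (hqr : q < r) (hr : r < N) :
    Equiv.Perm (Fin N) where
  toFun x := ⟨segmentSwap p q r x, by have := x.2; unfold segmentSwap; split_ifs <;> omega⟩
  -- The exchange also swaps the lengths of the segments, so its inverse exchanges `(p, p + (r -
  -- q)]` and `(p + (r - q), r]`.
  invFun y := ⟨segmentSwap p (p + (r - q)) r y, by
    have := y.2; unfold segmentSwap; split_ifs <;> omega⟩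
  left_inv x := by
    ext; simp only [segmentSwap]; split_ifs <;> omega
  right_inv x := by
    ext; simp only [segmentSwap]; split_ifs <;> omega

/-- Exchanging two consecutive segments of a tour. -/
theorem isTourEdgeSet_segmentSwap {N p q r : ℕ} (hpq : p < q) (hqr : q < r) (hr : r + 1 < N)
    (S : Finset (Sym2 (Fin N)))
    (hS : ∀ e, e ∈ S ↔ (∃ x : Fin N, (x : ℕ) ≠ p ∧ (x : ℕ) ≠ q ∧ (x : ℕ) ≠ r ∧
        e = s(x, finRotate N x)) ∨
      e = s(⟨p, by omega⟩, ⟨q + 1, by omega⟩) ∨ e = s(⟨q, by omega⟩, ⟨r + 1, by omega⟩) ∨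
      e = s(⟨r, by omega⟩, ⟨p + 1, by omega⟩)) : IsTourEdgeSet S := by
  let τ := segmentSwapPerm hpq hqr (by omega : r < N)
  have hτ : ∀ x, ((τ x : Fin N) : ℕ) = segmentSwap p q r x := fun _ => rfl
  have key : S = Finset.univ.image fun i => s(τ i, τ (finRotate N i)) := by
    ext e
    rw [hS, Finset.mem_image]
    simp only [Finset.mem_univ, true_and]
    constructor
    · rintro (⟨y, h1, h2, h3, rfl⟩ | rfl | rfl | rfl)
      · refine ⟨τ.symm y, ?_⟩
        rw [Equiv.apply_symm_apply]
        congr 1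
        rw [Fin.ext_iff, hτ, val_finRotate, val_finRotate]
        have hy : ((τ.symm y : Fin N) : ℕ) = segmentSwap p (p + (r - q)) r y := rfl
        rw [hy]
        have := y.2
        simp only [segmentSwap]
        split_ifs <;> omega
      · refine ⟨⟨p, by omega⟩, ?_⟩
        congr 1 <;> rw [Fin.ext_iff, hτ] <;> simp only [val_finRotate, segmentSwap] <;>
          split_ifs <;> omega
      -- In the new order vertex `q` stands at position `r`, and vertex `r` at position `p + (r -
      -- q)`; these are the witnesses here and in the next case.
      · refine ⟨⟨r, by omega⟩, ?_⟩
        congr 1 <;> rw [Fin.ext_iff, hτ] <;> simp only [val_finRotate, segmentSwap] <;>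
          split_ifs <;> omega
      · refine ⟨⟨p + (r - q), by omega⟩, ?_⟩
        congr 1 <;> rw [Fin.ext_iff, hτ] <;> simp only [val_finRotate, segmentSwap] <;>
          split_ifs <;> omega
    · rintro ⟨x, rfl⟩
      have hx := x.2
      by_cases h1 : (x : ℕ) = p
      · right; left
        congr 1 <;> rw [Fin.ext_iff, hτ] <;> simp only [val_finRotate, segmentSwap] <;>
          split_ifs <;> omega
      by_cases h2 : (x : ℕ) = r
      · right; right; left
        congr 1 <;> rw [Fin.ext_iff, hτ] <;> simp only [val_finRotate, segmentSwap] <;>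
          split_ifs <;> omega
      by_cases h3 : (x : ℕ) = p + (r - q)
      · right; right; right
        congr 1 <;> rw [Fin.ext_iff, hτ] <;> simp only [val_finRotate, segmentSwap] <;>
          split_ifs <;> omega
      left
      refine ⟨τ x, ?_, ?_, ?_, ?_⟩
      · rw [hτ, segmentSwap]; split_ifs <;> omega
      · rw [hτ, segmentSwap]; split_ifs <;> omega
      · rw [hτ, segmentSwap]; split_ifs <;> omega
      · congr 1
        rw [Fin.ext_iff, hτ, val_finRotate, val_finRotate, hτ]
        simp only [segmentSwap]
        split_ifs <;> omega
  rw [key]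
  exact isTourEdgeSet_perm (by omega) τ

/-- A gadget of a given copy. -/
def gadget (q : Fin 3) (i : Fin I.n) : Fin (3 * I.n) := ⟨q * I.n + i, by
  have := i.2
  have : (q : ℕ) * I.n ≤ 2 * I.n := Nat.mul_le_mul_right _ (by omega)
  omega⟩

theorem linked_gadget {q q' : Fin 3} (h : ((q : ℕ) + 1) % 3 = q') {i j : Fin I.n} (hij : i ≠ j) :
    I.Linked (I.gadget q i) (I.gadget q' j) := by
  have hd : ∀ (q : Fin 3) (i : Fin I.n), ((q : ℕ) * I.n + i) / I.n = q := fun q i => by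
    rw [Nat.mul_comm, Nat.mul_add_div I.n_pos, Nat.div_eq_of_lt i.2, add_zero]
  have hm : ∀ (q : Fin 3) (i : Fin I.n), I.index (I.gadget q i) = i := fun q i => by
    ext
    simp only [index, gadget]
    rw [Nat.mul_comm, Nat.mul_add_mod, Nat.mod_eq_of_lt i.2]
  refine ⟨?_, by rwa [hm, hm]⟩
  simp only [gadget]
  rw [hd, hd, h]

theorem index_gadget (q : Fin 3) (i : Fin I.n) : I.index (I.gadget q i) = i := by
  ext
  simp only [index, gadget]
  rw [Nat.mul_comm, Nat.mul_add_mod, Nat.mod_eq_of_lt i.2]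

set_option maxHeartbeats 400000 in
-- With one vertex of the triangle in each copy, the gadgets satisfy `ga < gb < gc`. Exchanging the
-- two tour segments between their edges removes just these three edges and adds the links from `ga`
-- to `gb`, from `gb` to `gc` and from `gc` to `ga`. The fourth edge required by a `4`-move is a
-- tour edge that is removed and added back, which the definition of a move permits.
theorem hasImprovingMove_of_hasNegativeTriangle (h : I.HasNegativeTriangle) :
    (I.toTour b).HasImprovingMove 4 := by
  classical
  obtain ⟨i, j, k, hij, hjk, hik, hneg⟩ := h
  have hn := I.n_pos
  have hi := i.2
  have hj := j.2
  have hk := k.2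
  set H := (I.toTour b).tourEdges with hH
  set ga := I.gadget 0 i with hga
  set gb := I.gadget 1 j with hgb
  set gc := I.gadget 2 k with hgc
  have va : (ga : ℕ) = i := by simp [hga, gadget]
  have vb : (gb : ℕ) = I.n + j := by simp [hgb, gadget]
  have vc : (gc : ℕ) = 2 * I.n + k := by simp [hgc, gadget]
  have lab : I.Linked ga gb := I.linked_gadget rfl hij
  have lbc : I.Linked gb gc := I.linked_gadget rfl hjk
  have lca : I.Linked gc ga := I.linked_gadget rfl hik.symm
  let E := I.evenVertex (b := b)
  let O := I.oddVertex (b := b)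
  -- The fourth edge leads from the last vertex of copy `0` to the first vertex of copy `1`. It is a
  -- tour edge, but neither a gadget edge nor a link.
  let x0 : Fin (I.toTour b).n := ⟨2 * I.n - 1, by simp only [toTour]; omega⟩
  let y0 : Fin (I.toTour b).n := ⟨2 * I.n, by simp only [toTour]; omega⟩
  let Em : Finset (Sym2 (Fin (I.toTour b).n)) := {s(E ga, O ga), s(E gb, O gb), s(E gc, O gc), s(x0, y0)}
  let Ep : Finset (Sym2 (Fin (I.toTour b).n)) := {s(E ga, O gb), s(E gb, O gc), s(E gc, O ga), s(x0, y0)}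
  have hx0 : ∀ g g' : Fin (3 * I.n), s(E g, O g') = s(x0, y0) → (g : ℕ) = I.n ∧ (g' : ℕ) + 1 = I.n := by
    intro g g' h
    rw [Sym2.eq_iff, Fin.ext_iff, Fin.ext_iff, Fin.ext_iff, Fin.ext_iff] at h
    simp only [E, O, x0, y0, evenVertex, oddVertex] at h
    omega
  have hg0 : ∀ g, s(E g, O g) ≠ s(x0, y0) := fun g h => by
    have := hx0 g g h; omega
  have hl0 : ∀ {g g'}, I.Linked g g' → s(E g, O g') ≠ s(x0, y0) := fun {g g'} hl h => by
    obtain ⟨h1, h2⟩ := hx0 g g' h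
    have := hl.1
    rw [h1, Nat.div_self hn, Nat.div_eq_of_lt (by omega)] at this
    omega
  have nab : ga ≠ gb := lab.ne
  have nbc : gb ≠ gc := lbc.ne
  have nac : ga ≠ gc := lca.ne.symm
  have edge : ∀ g g' h h', s(E g, O g') = s(E h, O h') ↔ g = h ∧ g' = h' := fun _ _ _ _ => I.edge_inj
  have m1 : s(E ga, O ga) ∉ ({s(E gb, O gb), s(E gc, O gc), s(x0, y0)} : Finset (Sym2 _)) := by
    simp only [Finset.mem_insert, Finset.mem_singleton, edge, not_or]
    exact ⟨by tauto, by tauto, hg0 _⟩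
  have m2 : s(E gb, O gb) ∉ ({s(E gc, O gc), s(x0, y0)} : Finset (Sym2 _)) := by
    simp only [Finset.mem_insert, Finset.mem_singleton, edge, not_or]
    exact ⟨by tauto, hg0 _⟩
  have m3 : s(E gc, O gc) ∉ ({s(x0, y0)} : Finset (Sym2 _)) := by
    simpa only [Finset.mem_singleton] using hg0 _
  have p1 : s(E ga, O gb) ∉ ({s(E gb, O gc), s(E gc, O ga), s(x0, y0)} : Finset (Sym2 _)) := by
    simp only [Finset.mem_insert, Finset.mem_singleton, edge, not_or]
    exact ⟨by tauto, by tauto, hl0 lab⟩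
  have p2 : s(E gb, O gc) ∉ ({s(E gc, O ga), s(x0, y0)} : Finset (Sym2 _)) := by
    simp only [Finset.mem_insert, Finset.mem_singleton, edge, not_or]
    exact ⟨by tauto, hl0 lbc⟩
  have p3 : s(E gc, O ga) ∉ ({s(x0, y0)} : Finset (Sym2 _)) := by
    simpa only [Finset.mem_singleton] using hl0 lca
  have hgH : ∀ g, s(E g, O g) ∈ H := fun g => by
    rw [hH, mem_tourEdges]; simp [E, O, evenVertex, oddVertex]
  have h0H : s(x0, y0) ∈ H := by
    rw [hH, mem_tourEdges]; simp only [x0, y0]; omega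
  have hEmH : Em ⊆ H := by
    intro e he
    simp only [Em, Finset.mem_insert, Finset.mem_singleton] at he
    rcases he with rfl | rfl | rfl | rfl
    exacts [hgH _, hgH _, hgH _, h0H]
  have hdisj : Disjoint (H \ Em) Ep := by
    rw [Finset.disjoint_right]
    intro e he
    simp only [Ep, Finset.mem_insert, Finset.mem_singleton] at he
    rw [Finset.mem_sdiff]
    rcases he with rfl | rfl | rfl | rfl
    · exact fun h => (I.w_linked lab).2 h.1
    · exact fun h => (I.w_linked lbc).2 h.1
    · exact fun h => (I.w_linked lca).2 h.1
    · exact fun h => h.2 (by simp [Em])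
  refine ⟨Em, Ep, ⟨?_, ?_, hEmH, ?_, ?_⟩, ?_⟩
  · simp only [Em]
    rw [Finset.card_insert_of_notMem m1, Finset.card_insert_of_notMem m2,
      Finset.card_insert_of_notMem m3, Finset.card_singleton]
  · simp only [Ep]
    rw [Finset.card_insert_of_notMem p1, Finset.card_insert_of_notMem p2,
      Finset.card_insert_of_notMem p3, Finset.card_singleton]
  · intro e he
    have hne : x0 ≠ y0 := by
      rw [Ne, Fin.ext_iff]; simp only [x0, y0]; omega
    simp only [Ep, Finset.coe_insert, Finset.coe_singleton, Set.mem_insert_iff,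
      Set.mem_singleton_iff] at he
    rcases he with rfl | rfl | rfl | rfl <;> simp only [SimpleGraph.mem_edgeSet, SimpleGraph.top_adj]
    exacts [I.evenVertex_ne_oddVertex _ _, I.evenVertex_ne_oddVertex _ _,
      I.evenVertex_ne_oddVertex _ _, hne]
  -- The tour is cut after the even vertices of the three gadgets; their odd vertices begin the next
  -- pieces.
  · refine isTourEdgeSet_segmentSwap (p := 2 * ga) (q := 2 * gb) (r := 2 * gc) (by omega) (by omega)
      (by simp only [toTour]; omega) _ fun e => ?_
    have hgad : ∀ (g : Fin (3 * I.n)) (x : Fin (I.toTour b).n), s(x, finRotate _ x) = s(E g, O g) ↔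
        (x : ℕ) = 2 * g := by
      intro g x
      have hx : (x : ℕ) < 6 * I.n := x.2
      have hN : (I.toTour b).n = 6 * I.n := rfl
      have hg := g.2
      rw [Sym2.eq_iff, Fin.ext_iff, Fin.ext_iff, Fin.ext_iff, Fin.ext_iff, val_finRotate]
      simp only [E, O, evenVertex, oddVertex]
      split_ifs <;> omega
    have hH' : e ∈ H ↔ ∃ x, s(x, finRotate _ x) = e := by
      rw [hH]
      simp only [TourInstance.tourEdges, Finset.mem_image, Finset.mem_univ, true_and]
      rfl
    have hEp : e ∈ Ep ↔ (e = s(E ga, O gb) ∨ e = s(E gb, O gc) ∨ e = s(E gc, O ga)) ∨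
        e = s(x0, y0) := by
      simp only [Ep, Finset.mem_insert, Finset.mem_singleton]; tauto
    rw [Finset.mem_union, Finset.mem_sdiff, hEp]
    change _ ↔ _ ∨ (e = s(E ga, O gb) ∨ e = s(E gb, O gc) ∨ e = s(E gc, O ga))
    have hmain : ((e ∈ H ∧ e ∉ Em) ∨ e = s(x0, y0)) ↔ ∃ x : Fin (I.toTour b).n,
        (x : ℕ) ≠ 2 * ga ∧ (x : ℕ) ≠ 2 * gb ∧ (x : ℕ) ≠ 2 * gc ∧ e = s(x, finRotate _ x) := by
      constructor
      · rintro (⟨h1, h2⟩ | h)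
        · obtain ⟨x, rfl⟩ := hH'.mp h1
          simp only [Em, Finset.mem_insert, Finset.mem_singleton, hgad, not_or] at h2
          exact ⟨x, h2.1, h2.2.1, h2.2.2.1, rfl⟩
        · obtain ⟨x, hx⟩ := hH'.mp (h ▸ h0H)
          refine ⟨x, ?_, ?_, ?_, hx.symm⟩ <;> rw [Ne, ← hgad, hx, h] <;> exact (hg0 _).symm
      · rintro ⟨x, h1, h2, h3, rfl⟩
        by_cases h : s(x, finRotate _ x) = s(x0, y0)
        · exact .inr h
        · refine .inl ⟨hH'.mpr ⟨x, rfl⟩, ?_⟩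
          simp only [Em, Finset.mem_insert, Finset.mem_singleton, hgad, not_or]
          exact ⟨h1, h2, h3, h⟩
    rw [← hmain]
    constructor
    · rintro (h | h | h)
      exacts [.inl (.inl h), .inr h, .inl (.inr h)]
    · rintro ((h | h) | h)
      exacts [.inl h, .inr (.inr h), .inr (.inl h)]
  · have s1 : ∑ e ∈ H \ Em, (I.toTour b).w e + ∑ e ∈ Em, (I.toTour b).w e =
        ∑ e ∈ H, (I.toTour b).w e := Finset.sum_sdiff hEmH
    have s2 : ∑ e ∈ Em, (I.toTour b).w e = (I.toTour b).w s(x0, y0) := by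
      have w1 : ∀ g, (I.toTour b).w s(E g, O g) = 0 := fun g => I.w_gadget g
      simp only [Em]
      rw [Finset.sum_insert m1, Finset.sum_insert m2, Finset.sum_insert m3, Finset.sum_singleton,
        w1, w1, w1]
      ring
    have s3 : ∑ e ∈ Ep, (I.toTour b).w e = weightMatrix I.w i j + (weightMatrix I.w j k +
        (weightMatrix I.w k i + (I.toTour b).w s(x0, y0))) := by
      have w1 : (I.toTour b).w s(E ga, O gb) = weightMatrix I.w i j := by
        rw [← I.index_gadget 0 i, ← I.index_gadget 1 j]; exact (I.w_linked lab).1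
      have w2 : (I.toTour b).w s(E gb, O gc) = weightMatrix I.w j k := by
        rw [← I.index_gadget 1 j, ← I.index_gadget 2 k]; exact (I.w_linked lbc).1
      have w3 : (I.toTour b).w s(E gc, O ga) = weightMatrix I.w k i := by
        rw [← I.index_gadget 2 k, ← I.index_gadget 0 i]; exact (I.w_linked lca).1
      simp only [Ep]
      rw [Finset.sum_insert p1, Finset.sum_insert p2, Finset.sum_insert p3, Finset.sum_singleton,
        w1, w2, w3]
    have s4 : ∑ e ∈ (H \ Em) ∪ Ep, (I.toTour b).w e = ∑ e ∈ H \ Em, (I.toTour b).w e +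
        ∑ e ∈ Ep, (I.toTour b).w e := Finset.sum_union hdisj
    have s5 : weightMatrix I.w i j + weightMatrix I.w j k + weightMatrix I.w k i < 0 := by
      simp only [weightMatrix, if_neg hij, if_neg hjk, if_neg hik.symm]
      rwa [Sym2.eq_swap (a := k) (b := i)]
    change ∑ e ∈ (H \ Em) ∪ Ep, (I.toTour b).w e < ∑ e ∈ H, (I.toTour b).w e
    rw [s4, s3, ← s1, s2]
    linarith

/-- The reduction from Negative Edge-Weighted Triangle to `4`-opt Detection is correct. -/
theorem toTour_hasImprovingMove {M : ℕ} (hM : EdgeWeightsBoundedBy I.w M)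
    (hb : 4 * (M : ℤ) ≤ b) : (I.toTour b).HasImprovingMove 4 ↔ I.HasNegativeTriangle := by
  refine ⟨?_, I.hasImprovingMove_of_hasNegativeTriangle⟩
  rintro ⟨Em, Ep, ⟨c1, c2, hs, -, hT⟩, hw⟩
  refine I.hasNegativeTriangle_of_exchange hM hb hT ?_ ?_ hw
  · refine (Finset.card_le_card fun e he => ?_).trans c1.le
    simp only [Finset.mem_sdiff, Finset.mem_union, not_or, not_and, not_not] at he
    exact he.2.1 he.1
  · refine (Finset.card_le_card fun e he => ?_).trans c2.le
    simp only [Finset.mem_sdiff, Finset.mem_union] at he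
    tauto

theorem toTour_weightsBoundedBy {M b' : ℕ} (hM : EdgeWeightsBoundedBy I.w M) (hMb : M ≤ b') :
    EdgeWeightsBoundedBy (I.toTour b').w b' := by
  intro e he
  have hd := SimpleGraph.not_isDiag_of_mem_edgeSet _ he
  by_cases h : e ∈ (I.toTour b').tourEdges
  · rcases I.mem_tourEdges_cases h with ⟨g, rfl⟩ | h
    · rw [w_gadget]; simp
    · rw [h]; simp
  · rcases I.not_mem_tourEdges_cases hd h with ⟨g, g', hl, rfl⟩ | h
    · rw [(I.w_linked hl).1]
      exact (abs_weightMatrix_le hM _ _).trans (by exact_mod_cast hMb)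
    · rw [h]; simp

end TriangleInstance

/-! ### Evaluation of compound expressions -/

namespace RamExpr

/-- Conjunction of truth values. -/
def both (a b : RamExpr) : RamExpr := ite a b (const 0)

/-- The smaller value. -/
def minE (a b : RamExpr) : RamExpr := ite (bin .lt a b) a b

/-- The larger value. -/
def maxE (a b : RamExpr) : RamExpr := ite (bin .lt a b) b a

/-- The absolute value. -/
def absE (a : RamExpr) : RamExpr := ite (bin .lt a (const 0)) (bin .sub (const 0) a) a

variable (s : RamState) (a b c : RamExpr)

theorem eval_var (v : ℕ) : (var v).eval s = s.reg v := rfl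
theorem eval_const (z : ℤ) : (const z).eval s = z := rfl
theorem eval_add : (bin .add a b).eval s = a.eval s + b.eval s := rfl
theorem eval_sub : (bin .sub a b).eval s = a.eval s - b.eval s := rfl
theorem eval_mul : (bin .mul a b).eval s = a.eval s * b.eval s := rfl
theorem eval_div : (bin .div a b).eval s = a.eval s / b.eval s := rfl
theorem eval_mod : (bin .mod a b).eval s = a.eval s % b.eval s := rfl
theorem eval_lt : (bin .lt a b).eval s = if a.eval s < b.eval s then 1 else 0 := rfl
theorem eval_eq : (bin .eq a b).eval s = if a.eval s = b.eval s then 1 else 0 := rfl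
theorem eval_ld (A : ℕ) : (ld A a).eval s = s.mem A (a.eval s) := rfl

theorem eval_ite : (ite c a b).eval s = if c.eval s = 0 then b.eval s else a.eval s := by
  simp only [eval]; split_ifs <;> simp_all

theorem eval_lt_eq_zero : (bin .lt a b).eval s = 0 ↔ ¬ a.eval s < b.eval s := by
  rw [eval_lt]; split_ifs <;> simp_all

theorem eval_eq_eq_zero : (bin .eq a b).eval s = 0 ↔ ¬ a.eval s = b.eval s := by
  rw [eval_eq]; split_ifs <;> simp_all

theorem eval_both_eq_zero : (both a b).eval s = 0 ↔ ¬ (a.eval s ≠ 0 ∧ b.eval s ≠ 0) := by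
  rw [both, eval_ite]; split_ifs <;> simp_all [eval]

theorem eval_minE : (minE a b).eval s = min (a.eval s) (b.eval s) := by
  rw [minE, eval_ite, eval_lt]; split_ifs <;> (simp_all; try omega)

theorem eval_maxE : (maxE a b).eval s = max (a.eval s) (b.eval s) := by
  rw [maxE, eval_ite, eval_lt]; split_ifs <;> (simp_all; try omega)

theorem eval_absE : (absE a).eval s = |a.eval s| := by
  rw [absE, eval_ite, eval_lt, eval_const]
  split_ifs with h1 h2 h2
  · simp at h2
  · rw [eval_sub, eval_const, zero_sub, abs_of_neg h1]
  · exact (abs_of_nonneg (not_lt.mp h1)).symm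
  · simp at h2

end RamExpr

theorem RamState.filled_reg_of_ne {σ : RamState} {i A n r : ℕ} {f : ℤ → ℤ} (h : r ≠ i) :
    (σ.filled i A n f).reg r = σ.reg r := Function.update_of_ne h _ _

theorem RamState.filled_mem_of_ne {σ : RamState} {i A n A' : ℕ} {f : ℤ → ℤ} (h : A' ≠ A) :
    (σ.filled i A n f).mem A' = σ.mem A' := Function.update_of_ne h _ _

theorem RamState.filled_mem_self {σ : RamState} {i A n : ℕ} {f : ℤ → ℤ} :
    (σ.filled i A n f).mem A = fun x : ℤ => if 0 ≤ x ∧ x < n then f x else σ.mem A x :=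
  Function.update_self _ _ _

theorem RamState.subMem_eq_zero {σ : RamState} (h : ∀ A x, σ.mem (9 + 2 * A) x < σ.reg 1) (A : ℕ)
    (x : ℤ) : σ.subMem A x = 0 := if_neg (h A x).ne

/-- Write the first `N` cells of bank `A` of the subroutine. -/
def RamProgram.fillSub (i A N : ℕ) (e : RamExpr) : RamProgram :=
  .seq (fill i (8 + 2 * A) N e) (fill i (9 + 2 * A) N (.var 1))

/-- The values and the stamps are written in two passes over the same range. Cells outside of it
keep both, and hence their meaning for the subroutine. -/
theorem Achieves.fillSub {X D : ℕ} {σ : RamState} {Q : RamState → ℕ → Prop} (hX : 2 ≤ X)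
    {i A N n : ℕ} {e : RamExpr} (hD : 8 ≤ D) (hDe : e.deg ≤ D) (hA : e.Avoids (8 + 2 * A))
    (hiN : i ≠ N) (hi1 : i ≠ 1) (hn : σ.reg N = n) (hnX : n ≤ X)
    (he : ∀ x : ℤ, 0 ≤ x → x < n → |e.eval (σ.setReg i x)| ≤ (X : ℤ))
    (hstamp : ∀ A x, σ.mem (9 + 2 * A) x ≤ σ.reg 1)
    (hQ : ∀ σ' t, t ≤ (n + 1) * (e.cost + 42) → σ'.reg = Function.update σ.reg i n →
      (∀ A' < 8, σ'.mem A' = σ.mem A') →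
      (∀ (A' : ℕ) (x : ℤ), σ'.subMem A' x =
        if A' = A ∧ 0 ≤ x ∧ x < n then e.eval (σ.setReg i x) else σ.subMem A' x) →
      (∀ A' x, σ'.mem (9 + 2 * A') x ≤ σ.reg 1) → Q σ' t) :
    Achieves X D (.fillSub i A N e) σ Q := by
  refine .of_bounded fun hbdd => .seq (.fill hX hD hDe hA hiN hn hnX he fun t ht => ?_)
  have hreg1 : (σ.filled i (8 + 2 * A) n fun x => e.eval (σ.setReg i x)).reg 1 = σ.reg 1 := by
    simp [RamState.filled, Function.update_of_ne hi1.symm]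
  have hvar : ∀ x : ℤ, (RamExpr.var 1).eval (((σ.filled i (8 + 2 * A) n
      fun x => e.eval (σ.setReg i x))).setReg i x) = σ.reg 1 := fun x => by
    rw [RamExpr.eval_var, RamState.setReg]
    simp only [Function.update_of_ne hi1.symm, hreg1]
  refine .fill hX hD (by simp only [RamExpr.deg]; omega) trivial hiN (n := n) ?_ hnX
    (fun x _ _ => ?_) fun t' ht' => ?_
  · simp [RamState.filled, Function.update_of_ne hiN.symm, hn]
  · rw [hvar]; exact hbdd.1 1
  · simp only [hvar]
    refine hQ _ _ ?_ ?_ ?_ ?_ ?_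
    · simp only [RamExpr.cost] at ht'
      calc t + t' ≤ (n + 1) * (e.cost + 20) + (n + 1) * (2 + 20) := by omega
        _ = _ := by ring
    · simp [RamState.filled]
    · intro A' hA'
      rw [RamState.filled_mem_of_ne (by omega), RamState.filled_mem_of_ne (by omega)]
    · intro A' x
      have hr : ((σ.filled i (8 + 2 * A) n fun x => e.eval (σ.setReg i x)).filled i (9 + 2 * A) n
          fun _ => σ.reg 1).reg 1 = σ.reg 1 := by
        simp [RamState.filled, Function.update_of_ne hi1.symm]
      rw [RamState.subMem, hr]
      by_cases hA' : A' = A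
      · subst hA'
        rw [RamState.filled_mem_self, RamState.filled_mem_of_ne (by omega : 9 + 2 * A' ≠ 8 + 2 * A'),
          RamState.filled_mem_of_ne (by omega : 8 + 2 * A' ≠ 9 + 2 * A'),
          RamState.filled_mem_self]
        by_cases hx : 0 ≤ x ∧ x < n <;> simp [hx, RamState.subMem]
      · rw [RamState.filled_mem_of_ne (by omega), RamState.filled_mem_of_ne (by omega),
          RamState.filled_mem_of_ne (by omega), RamState.filled_mem_of_ne (by omega)]
        simp [hA', RamState.subMem]
    · intro A' x
      by_cases hA' : A' = A
      · subst hA'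
        rw [RamState.filled_mem_self]
        simp only
        split_ifs
        · exact le_rfl
        · rw [RamState.filled_mem_of_ne (by omega)]; exact hstamp _ _
      · rw [RamState.filled_mem_of_ne (by omega), RamState.filled_mem_of_ne (by omega)]
        exact hstamp _ _

/-! ### Memory contents -/

theorem init_mem_eq {input : ℕ → List ℤ} {A : ℕ} {L : List ℤ} (hL : input A = L) (f : ℤ → ℤ)
    (hf : ∀ (k : ℕ) (h : k < L.length), L[k] = f k) (x : ℤ) :
    (RamState.init input).mem A x = if 0 ≤ x ∧ x < L.length then f x else 0 := by
  simp only [RamState.init, hL]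
  by_cases h0 : 0 ≤ x
  · by_cases h1 : x < L.length
    · have h1' : x.toNat < L.length := by omega
      rw [if_pos h0, if_pos ⟨h0, h1⟩, List.getD_eq_getElem _ _ h1', hf _ h1', Int.toNat_of_nonneg h0]
    · rw [if_pos h0, if_neg (fun h => h1 h.2), List.getD_eq_default _ _ (by omega)]
  · rw [if_neg h0, if_neg (fun h => h0 h.1)]

theorem length_rowMajor {n : ℕ} (f : Fin n → Fin n → ℤ) : (rowMajor f).length = n * n := by
  simp [rowMajor]

theorem getElem_rowMajor {n : ℕ} (f : Fin n → Fin n → ℤ) {k : ℕ} (h : k < (rowMajor f).length) :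
    (rowMajor f)[k] = f ⟨k / n, by rw [length_rowMajor] at h; exact Nat.div_lt_of_lt_mul h⟩
      ⟨k % n, Nat.mod_lt _ (by
        rw [length_rowMajor] at h; exact Nat.pos_of_mul_pos_left (by omega : 0 < n * n))⟩ := by
  simp only [rowMajor, List.getElem_ofFn]
  rfl

theorem init_mem_rowMajor {input : ℕ → List ℤ} {A n : ℕ} {f : Fin n → Fin n → ℤ}
    (h : input A = rowMajor f) (i j : Fin n) :
    (RamState.init input).mem A ((i : ℕ) * (n : ℤ) + (j : ℕ)) = f i j := by
  have hlt : (i : ℕ) * n + j < n * n := by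
    have : ((i : ℕ) + 1) * n ≤ n * n := Nat.mul_le_mul_right _ i.2
    have := j.2
    nlinarith
  have hx : ((i : ℕ) * (n : ℤ) + (j : ℕ)) = (((i : ℕ) * n + j : ℕ) : ℤ) := by push_cast; ring
  have hl : (i : ℕ) * n + j < (rowMajor f).length := by rwa [length_rowMajor]
  have hn : 0 < n := i.pos
  rw [hx]
  simp only [RamState.init, h, if_pos (Int.natCast_nonneg _), Int.toNat_natCast]
  rw [List.getD_eq_getElem _ _ hl, getElem_rowMajor]
  congr 1 <;> ext <;> simp only
  · rw [Nat.mul_comm, Nat.mul_add_div hn, Nat.div_eq_of_lt j.2, add_zero]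
  · rw [Nat.mul_comm, Nat.mul_add_mod, Nat.mod_eq_of_lt j.2]

theorem init_mem_induction {input : ℕ → List ℤ} {p : ℤ → Prop} (h0 : p 0) {A : ℕ}
    (h : ∀ z ∈ input A, p z) (x : ℤ) : p ((RamState.init input).mem A x) := by
  simp only [RamState.init]
  split_ifs
  · by_cases h1 : x.toNat < (input A).length
    · rw [List.getD_eq_getElem _ _ h1]; exact h _ (List.getElem_mem h1)
    · rwa [List.getD_eq_default _ _ (by omega)]
  · exact h0

theorem forall_mem_rowMajor {n : ℕ} {f : Fin n → Fin n → ℤ} {p : ℤ → Prop} (h : ∀ i j, p (f i j)) :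
    ∀ z ∈ rowMajor f, p z := by
  intro z hz
  rw [rowMajor, List.mem_ofFn] at hz
  obtain ⟨x, rfl⟩ := hz
  exact h _ _

theorem represents_init {input : ℕ → List ℤ} {X : ℕ} (h : ∀ A, ∀ z ∈ input A, |z| ≤ (X : ℤ)) :
    Represents X (RamState.init input) (RamState.init input) :=
  ⟨fun _ => rfl, rfl, fun _ => by simp [RamState.init],
    fun A => init_mem_induction (p := fun z => |z| ≤ (X : ℤ)) (by simp) (h A)⟩

theorem RamState.setReg_reg_self (σ : RamState) (r : ℕ) (z : ℤ) : (σ.setReg r z).reg r = z :=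
  Function.update_self _ _ _

theorem RamState.setReg_reg_of_ne (σ : RamState) {r r' : ℕ} (h : r' ≠ r) (z : ℤ) :
    (σ.setReg r z).reg r' = σ.reg r' := Function.update_of_ne h _ _

theorem RamState.setReg_mem (σ : RamState) (r : ℕ) (z : ℤ) : (σ.setReg r z).mem = σ.mem := rfl

/-- A loop that computes the maximum of the absolute values of the first `n` cells of a bank. -/
theorem Achieves.maxLoop {X D : ℕ} {σ : RamState} {Q : RamState → ℕ → Prop} (hX : 2 ≤ X)
    (hD : 40 ≤ D) {i N v A n : ℕ} (hiN : i ≠ N) (hiv : i ≠ v) (hvN : v ≠ N) (hn : σ.reg N = n)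
    (hnX : n ≤ X) (hv : σ.reg v = 0)
    (hQ : ∀ (σ' : RamState) (t m : ℕ), t ≤ (n + 1) * 50 → σ'.mem = σ.mem → σ'.reg v = m →
      (∀ r, r ≠ i → r ≠ v → σ'.reg r = σ.reg r) →
      (∀ x : ℤ, 0 ≤ x → x < n → |σ.mem A x| ≤ m) →
      (∀ M : ℕ, (∀ x : ℤ, 0 ≤ x → x < n → |σ.mem A x| ≤ M) → m ≤ M) → Q σ' t) :
    Achieves X D (.forLoop i N (.assign v (.maxE (.var v) (.absE (.ld A (.var i)))))) σ Q := by
  refine .of_bounded fun hbdd => .forLoop hX (by omega) hiN hn hnX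
    (fun k σ' t => t ≤ 3 + k * 50 ∧ σ'.mem = σ.mem ∧ (∀ r, r ≠ i → r ≠ v → σ'.reg r = σ.reg r) ∧
      ∃ m : ℕ, σ'.reg v = m ∧ (m : ℤ) ≤ X ∧ (∀ x : ℤ, 0 ≤ x → x < k → |σ.mem A x| ≤ m) ∧
        ∀ M : ℕ, (∀ x : ℤ, 0 ≤ x → x < k → |σ.mem A x| ≤ M) → m ≤ M) ?_ ?_ ?_
  · intro t ht
    refine ⟨by omega, rfl, fun r hr _ => σ.setReg_reg_of_ne hr 0, 0, ?_, by simp, ?_, by simp⟩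
    · rw [σ.setReg_reg_of_ne hiv.symm, hv]; rfl
    · intro x h0 h1; omega
  · rintro k hk σ' t ⟨ht, hm, hr, m, hvm, hmX, h1, h2⟩ hi hN
    have hmax : max (m : ℤ) |σ.mem A k| = ((max m (σ.mem A k).natAbs : ℕ) : ℤ) := by
      push_cast; rfl
    have hev : (RamExpr.maxE (.var v) (.absE (.ld A (.var i)))).eval σ' =
        ((max m (σ.mem A k).natAbs : ℕ) : ℤ) := by
      rw [RamExpr.eval_maxE, RamExpr.eval_absE, RamExpr.eval_ld, RamExpr.eval_var, RamExpr.eval_var,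
        hvm, hi, hm, hmax]
    have hle : ((max m (σ.mem A k).natAbs : ℕ) : ℤ) ≤ X := by
      rw [← hmax]; exact max_le hmX (hbdd.2 _ _)
    refine .assign hX ?_ ?_ (by omega) fun t' ht' => ?_
    · simp only [RamExpr.maxE, RamExpr.absE, RamExpr.deg]; simp; omega
    · rw [hev, abs_of_nonneg (by positivity)]; exact hle
    rw [hev]
    refine ⟨by rw [σ'.setReg_reg_of_ne hiv, hi], by rw [σ'.setReg_reg_of_ne hvN.symm, hN],
      fun t'' ht'' => ⟨?_, hm, ?_, max m (σ.mem A k).natAbs, ?_, hle, ?_, ?_⟩⟩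
    · simp only [RamExpr.maxE, RamExpr.absE, RamExpr.cost] at ht'
      omega
    · intro r h h'
      rw [RamState.setReg_reg_of_ne _ h, RamState.setReg_reg_of_ne _ h', hr r h h']
    · rw [RamState.setReg_reg_of_ne _ hiv.symm, RamState.setReg_reg_self]
    · intro x hx0 hx1
      rw [← hmax]
      by_cases hxk : x = k
      · subst hxk; exact le_max_right _ _
      · exact (h1 x hx0 (by push_cast at hx1; omega)).trans (le_max_left _ _)
    · intro M hM
      refine max_le (h2 M fun x h h' => hM x h (by push_cast; omega)) ?_
      have := hM k (by positivity) (by push_cast; omega)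
      rw [Int.abs_eq_natAbs] at this
      exact_mod_cast this
  · rintro σ' t t' ht' hi hN ⟨ht, hm, hr, m, hvm, hmX, h1, h2⟩
    exact hQ σ' t' m (by omega) hm hvm hr h1 h2

/-! ### The program for Negative Edge-Weighted Triangle -/

namespace RamExpr

/-- The expression for `gadgetWeight`; `n` is in variable `20`, the large weight in variable `23` and
the given matrix in bank `1`. -/
def gadgetWeightE (lo hi : RamExpr) : RamExpr :=
  let loEven := bin .eq (bin .mod lo (const 2)) (const 0)
  let e := ite loEven lo hi
  let o := ite loEven hi lo
  let e' := bin .div e (const 2)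
  let o' := bin .div o (const 2)
  let n := var 20
  ite (bin .eq hi (bin .add lo (const 1)))
    (ite loEven (const 0) (bin .sub (const 0) (var 23)))
    (ite (both (bin .eq lo (const 0)) (bin .eq (bin .add hi (const 1)) (bin .mul (const 6) n)))
      (bin .sub (const 0) (var 23))
      (ite (both (bin .eq (bin .mod e (const 2)) (const 0))
          (both (bin .eq (bin .mod o (const 2)) (const 1))
            (both (bin .eq (bin .mod (bin .add (bin .div e' n) (const 1)) (const 3)) (bin .div o' n))
              (bin .eq (bin .eq (bin .mod e' n) (bin .mod o' n)) (const 0)))))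
        (ld 1 (bin .add (bin .mul (bin .mod e' n) n) (bin .mod o' n)))
        (var 23)))

theorem eval_gadgetWeightE (s : RamState) (lo hi : RamExpr) : (gadgetWeightE lo hi).eval s =
    gadgetWeight (s.reg 20) (fun i j => s.mem 1 (i * s.reg 20 + j)) (s.reg 23) (lo.eval s)
      (hi.eval s) := by
  simp only [gadgetWeightE, gadgetWeight, eval_ite, eval_both_eq_zero, eval_eq_eq_zero, eval_var,
    eval_const, eval_add, eval_sub, eval_mul, eval_div, eval_mod, eval_ld, ite_not, ne_eq, not_not,
    zero_sub]

/-- The expression for the entry with index `x` of the matrix of the reduction; variable `24`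
holds the number of vertices. -/
def gadgetEntryE (x : RamExpr) : RamExpr :=
  let u := bin .div x (var 24)
  let v := bin .mod x (var 24)
  ite (bin .eq u v) (const 0) (gadgetWeightE (minE u v) (maxE u v))

theorem eval_gadgetEntryE (s : RamState) (x : RamExpr) : (gadgetEntryE x).eval s =
    if x.eval s / s.reg 24 = x.eval s % s.reg 24 then 0 else
    gadgetWeight (s.reg 20) (fun i j => s.mem 1 (i * s.reg 20 + j)) (s.reg 23)
      (min (x.eval s / s.reg 24) (x.eval s % s.reg 24))
      (max (x.eval s / s.reg 24) (x.eval s % s.reg 24)) := by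
  simp only [gadgetEntryE, eval_gadgetWeightE, eval_ite, eval_eq_eq_zero, eval_minE, eval_maxE,
    ite_not, eval_const, eval_div, eval_mod, eval_var]

end RamExpr

/-- The matrix is read at residues modulo `n` only, so agreement within the range suffices. -/
theorem gadgetWeight_congr {n : ℤ} (hn : 0 < n) {f g : ℤ → ℤ → ℤ}
    (h : ∀ i j, 0 ≤ i → i < n → 0 ≤ j → j < n → f i j = g i j) (b lo hi : ℤ) :
    gadgetWeight n f b lo hi = gadgetWeight n g b lo hi := by
  simp only [gadgetWeight]
  rw [h _ _ (Int.emod_nonneg _ hn.ne') (Int.emod_lt_of_pos _ hn) (Int.emod_nonneg _ hn.ne')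
    (Int.emod_lt_of_pos _ hn)]

/-- The program for Negative Edge-Weighted Triangle, given a program for `4`-opt Detection. -/
def triangleProgram (P : RamProgram) : RamProgram :=
  .seq (.assign 20 (.ld 0 (.const 0))) <|
  .seq (.assign 21 (.bin .mul (.var 20) (.var 20))) <|
  .seq (.forLoop 2 21 (.assign 22 (.maxE (.var 22) (.absE (.ld 1 (.var 2)))))) <|
  .seq (.assign 23 (.bin .mul (.const 4) (.var 22))) <|
  .seq (.assign 24 (.bin .mul (.const 6) (.var 20))) <|
  .seq (.assign 25 (.bin .mul (.var 24) (.var 24))) <|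
  .seq (.assign 26 (.const 1)) <|
  .seq (.assign 1 (.const 1)) <|
  .seq (.fillSub 2 0 26 (.var 24)) <|
  .seq (.fillSub 2 1 25 (.gadgetEntryE (.var 2))) <|
  .seq (.fillSub 2 2 24 (.var 2)) <|
  .call P 0

theorem gadgetEntryE_deg : (RamExpr.gadgetEntryE (.var 2)).deg ≤ 5000 := by decide +kernel

theorem gadgetEntryE_cost : (RamExpr.gadgetEntryE (.var 2)).cost ≤ 5000 := by decide +kernel

theorem TriangleInstance.mem_entry (I : TriangleInstance) {i j : ℤ} (hi0 : 0 ≤ i) (hi : i < I.n)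
    (hj0 : 0 ≤ j) (hj : j < I.n) :
    (RamState.init (negativeTriangle.input I)).mem 1 (i * I.n + j) = I.entry i j := by
  rw [TriangleInstance.entry, dif_pos ⟨⟨hi0, hi⟩, hj0, hj⟩]
  have := init_mem_rowMajor (input := negativeTriangle.input I) (A := 1)
    (f := weightMatrix I.w) rfl ⟨i.toNat, by omega⟩ ⟨j.toNat, by omega⟩
  rw [← this]
  simp only
  rw [Int.toNat_of_nonneg hi0, Int.toNat_of_nonneg hj0]

set_option maxHeartbeats 1000000 in
-- The bound `M` is not part of the input. The program therefore uses the largest absolute value `m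
-- ≤ M` of an entry and sets `b = 4 m`, for which the reduction is correct and the new weights are
-- at most `4 M`. The quadratic term is the cost of writing the matrix on `6 n` vertices.
theorem achieves_triangleProgram {P : RamProgram} {I : TriangleInstance} {M X B t : ℕ}
    (hM : EdgeWeightsBoundedBy I.w M) (hBX : B ≤ X) (hX : 36 * (I.n * I.n) + 4 * M + 2 ≤ X)
    (hP : ∀ m : ℕ, m ≤ M → EdgeWeightsBoundedBy I.w m → ∃ t' ≤ t, ∃ p,
      Exec B P (.init ((kOptDetection 4).input (I.toTour (4 * m : ℕ)))) t' p ∧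
        DecidesAs ((I.toTour (4 * m : ℕ)).HasImprovingMove 4) p) :
    Achieves X 5000 (triangleProgram P) (.init (negativeTriangle.input I)) fun σ' t' =>
      DecidesAs I.HasNegativeTriangle σ' ∧ t' ≤ 4 * t + P.width + 1000000 * (I.n * I.n) := by
  have hX2 : 2 ≤ X := by omega
  have hn := I.n_pos
  have hnn : I.n ≤ I.n * I.n := Nat.le_mul_of_pos_left _ hn
  have hXZ : 36 * ((I.n : ℤ) * I.n) + 4 * M + 2 ≤ X := by exact_mod_cast hX
  have hnZ : (1 : ℤ) ≤ I.n := by exact_mod_cast hn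
  have hnnZ : (I.n : ℤ) ≤ (I.n : ℤ) * I.n := by exact_mod_cast hnn
  have h36Z : 6 * (I.n : ℤ) * (6 * I.n) = 36 * (I.n * I.n) := by ring
  set σ0 := RamState.init (negativeTriangle.input I) with hσ0
  have h0 : σ0.mem 0 0 = I.n := by simp [hσ0, RamState.init, negativeTriangle]
  have hstamp0 : ∀ A x, σ0.mem (9 + 2 * A) x = 0 := by
    intro A x
    have : negativeTriangle.input I (9 + 2 * A) = [] := by
      rw [show 9 + 2 * A = (7 + 2 * A) + 2 by ring]; rfl
    simp [hσ0, RamState.init, this]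
  refine .seq (.assign hX2 (by decide) ?_ (by omega) fun t1 ht1 => ?_)
  · rw [RamExpr.eval_ld, RamExpr.eval_const, h0, abs_of_nonneg] <;> linarith [Int.natCast_nonneg M]
  rw [RamExpr.eval_ld, RamExpr.eval_const, h0]
  refine .seq (.assign hX2 (by decide) ?_ (by omega) fun t2 ht2 => ?_)
  · rw [RamExpr.eval_mul, RamExpr.eval_var, RamState.setReg_reg_self, abs_of_nonneg] <;>
      linarith [Int.natCast_nonneg M]
  rw [RamExpr.eval_mul, RamExpr.eval_var, RamState.setReg_reg_self]
  refine .seq (.maxLoop hX2 (by omega) (n := I.n * I.n) (by omega) (by omega) (by omega)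
    (by rw [RamState.setReg_reg_self]; push_cast; rfl) (by omega)
    (by simp [RamState.setReg, hσ0, RamState.init]) ?_)
  intro σ t3 m ht3 hmem hreg22 hreg hm1 hm2
  rw [RamState.setReg_mem, RamState.setReg_mem] at hmem hm1 hm2
  have r20 : σ.reg 20 = I.n := by
    rw [hreg 20 (by omega) (by omega)]; simp [RamState.setReg]
  have hmM : m ≤ M := hm2 M fun x _ _ => init_mem_induction (p := fun z => |z| ≤ (M : ℤ)) (by simp)
    (forall_mem_rowMajor (f := weightMatrix I.w) fun i j =>
      TriangleInstance.abs_weightMatrix_le hM i j) x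
  have hIm : EdgeWeightsBoundedBy I.w m := by
    intro e he
    induction e with
    | _ i j =>
      have hij : i ≠ j := by simpa using he
      have := init_mem_rowMajor (input := negativeTriangle.input I) (A := 1)
        (f := weightMatrix I.w) rfl i j
      rw [weightMatrix, if_neg hij] at this
      rw [← this]
      have hi : ((i : ℕ) : ℤ) + 1 ≤ I.n := by exact_mod_cast i.2
      have hj : ((j : ℕ) : ℤ) + 1 ≤ I.n := by exact_mod_cast j.2
      refine hm1 _ (by positivity) ?_
      push_cast
      nlinarith
  obtain ⟨t', ht', p, hrun, hdec⟩ := hP m hmM hIm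
  have hmZ : (m : ℤ) ≤ M := by exact_mod_cast hmM
  have hm0 : (0 : ℤ) ≤ m := by positivity
  set J := I.toTour ((4 * m : ℕ) : ℤ) with hJ
  have hJn : J.n = 6 * I.n := rfl
  refine .seq (.assign hX2 (by decide) ?_ (by omega) fun t4 ht4 => ?_)
  · rw [RamExpr.eval_mul, RamExpr.eval_var, RamExpr.eval_const, hreg22, abs_of_nonneg] <;> linarith
  rw [RamExpr.eval_mul, RamExpr.eval_var, RamExpr.eval_const, hreg22]
  refine .seq (.assign hX2 (by decide) ?_ (by omega) fun t5 ht5 => ?_)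
  · rw [RamExpr.eval_mul, RamExpr.eval_var, RamExpr.eval_const,
      RamState.setReg_reg_of_ne _ (by omega), r20, abs_of_nonneg] <;> linarith
  rw [RamExpr.eval_mul, RamExpr.eval_var, RamExpr.eval_const,
    RamState.setReg_reg_of_ne _ (by omega), r20]
  refine .seq (.assign hX2 (by decide) ?_ (by omega) fun t6 ht6 => ?_)
  · rw [RamExpr.eval_mul, RamExpr.eval_var, RamState.setReg_reg_self, h36Z, abs_of_nonneg] <;> linarith
  rw [RamExpr.eval_mul, RamExpr.eval_var, RamState.setReg_reg_self]
  refine .seq (.assign hX2 (by decide) ?_ (by omega) fun t7 ht7 => ?_)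
  · rw [RamExpr.eval_const, abs_of_nonneg] <;> linarith
  rw [RamExpr.eval_const]
  refine .seq (.assign hX2 (by decide) ?_ (by omega) fun t8 ht8 => ?_)
  · rw [RamExpr.eval_const, abs_of_nonneg] <;> linarith
  rw [RamExpr.eval_const]
  simp only [RamExpr.cost] at ht1 ht2 ht4 ht5 ht6 ht7 ht8
  generalize hσ1 : ((((σ.setReg 23 (4 * m)).setReg 24 (6 * I.n)).setReg 25
    (6 * I.n * (6 * I.n))).setReg 26 1).setReg 1 1 = σ1
  have m1 : σ1.mem = σ0.mem := by rw [← hσ1, ← hmem]; rfl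
  have a1 : σ1.reg 1 = 1 := by rw [← hσ1]; simp [RamState.setReg]
  have a20 : σ1.reg 20 = I.n := by rw [← hσ1]; simp [RamState.setReg, r20]
  have a23 : σ1.reg 23 = ((4 * m : ℕ) : ℤ) := by rw [← hσ1]; simp [RamState.setReg]
  have a24 : σ1.reg 24 = ((6 * I.n : ℕ) : ℤ) := by rw [← hσ1]; simp [RamState.setReg]
  have a25 : σ1.reg 25 = ((6 * I.n * (6 * I.n) : ℕ) : ℤ) := by rw [← hσ1]; simp [RamState.setReg]
  have a26 : σ1.reg 26 = ((1 : ℕ) : ℤ) := by rw [← hσ1]; simp [RamState.setReg]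
  clear hσ1
  have hX6 : 6 * I.n ≤ X := by omega
  have h36 : 6 * I.n * (6 * I.n) = 36 * (I.n * I.n) := by ring
  have hX36 : 6 * I.n * (6 * I.n) ≤ X := by omega
  refine .seq (.fillSub hX2 (n := 1) (by omega) (by decide) trivial (by omega) (by omega) a26
    (by omega) ?_ (fun A x => by rw [m1, hstamp0, a1]; omega) ?_)
  · intro x _ _
    rw [RamExpr.eval_var, RamState.setReg_reg_of_ne _ (by omega), a24, Nat.abs_cast]
    exact_mod_cast hX6
  intro σ2 t9 ht9 hr2 hl2 hs2 hst2
  have hsub1 : ∀ A x, σ1.subMem A x = 0 :=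
    RamState.subMem_eq_zero fun A x => by rw [m1, hstamp0, a1]; omega
  have e2 : ∀ r, r ≠ 2 → σ2.reg r = σ1.reg r := fun r hr => by
    rw [hr2, Function.update_of_ne hr]
  rw [a1] at hst2
  have hentry : ∀ (s : RamState), s.reg 20 = I.n → s.reg 23 = ((4 * m : ℕ) : ℤ) →
      s.reg 24 = ((6 * I.n : ℕ) : ℤ) → s.mem 1 = σ0.mem 1 → ∀ k : ℕ, ∀ hk : k < J.n * J.n,
      (RamExpr.gadgetEntryE (.var 2)).eval (s.setReg 2 k) = weightMatrix J.w
        ⟨k / J.n, Nat.div_lt_of_lt_mul hk⟩ ⟨k % J.n, Nat.mod_lt _ (by omega)⟩ := by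
    intro s h20 h23 h24 hs1 k hk
    have d1 : ((k : ℤ) / ((6 * I.n : ℕ) : ℤ)) = ((k / J.n : ℕ) : ℤ) := by rw [hJn]; push_cast; rfl
    have d2 : ((k : ℤ) % ((6 * I.n : ℕ) : ℤ)) = ((k % J.n : ℕ) : ℤ) := by rw [hJn]; push_cast; rfl
    rw [RamExpr.eval_gadgetEntryE, RamExpr.eval_var, RamState.setReg_reg_self,
      RamState.setReg_reg_of_ne _ (by omega), RamState.setReg_reg_of_ne _ (by omega),
      RamState.setReg_reg_of_ne _ (by omega), RamState.setReg_mem, h20, h23, h24, hs1, d1, d2,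
      weightMatrix]
    simp only [Fin.mk.injEq, Nat.cast_inj]
    by_cases huv : k / J.n = k % J.n
    · rw [if_pos huv, if_pos huv]
    · rw [if_neg huv, if_neg huv, gadgetWeight_congr (by omega) (g := I.entry)
        (fun i j h1 h2 h3 h4 => I.mem_entry h1 h2 h3 h4), ← Nat.cast_min,
        ← Nat.cast_max]
      rfl
  have hJM := I.toTour_weightsBoundedBy (b' := 4 * m) hIm (by omega)
  have hentryX : ∀ (s : RamState), s.reg 20 = I.n → s.reg 23 = ((4 * m : ℕ) : ℤ) →
      s.reg 24 = ((6 * I.n : ℕ) : ℤ) → s.mem 1 = σ0.mem 1 → ∀ x : ℤ, 0 ≤ x →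
      x < ((6 * I.n * (6 * I.n) : ℕ) : ℤ) →
      |(RamExpr.gadgetEntryE (.var 2)).eval (s.setReg 2 x)| ≤ (X : ℤ) := by
    intro s h1 h2 h3 h4 x hx0 hx1
    obtain ⟨k, rfl⟩ := Int.eq_ofNat_of_zero_le hx0
    rw [hentry s h1 h2 h3 h4 k (by exact_mod_cast hx1)]
    refine (TriangleInstance.abs_weightMatrix_le hJM _ _).trans ?_
    push_cast
    linarith
  refine .seq (.fillSub hX2 (n := 6 * I.n * (6 * I.n)) (by omega) gadgetEntryE_deg
    (by decide +kernel) (by omega) (by omega) (by rw [e2 _ (by omega), a25]) hX36 ?_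
    (fun A x => by rw [e2 _ (by omega), a1]; exact hst2 A x) ?_)
  · exact hentryX σ2 (by rw [e2 _ (by omega), a20]) (by rw [e2 _ (by omega), a23])
      (by rw [e2 _ (by omega), a24]) (by rw [hl2 _ (by omega), m1])
  intro σ3 t10 ht10 hr3 hl3 hs3 hst3
  have e3 : ∀ r, r ≠ 2 → σ3.reg r = σ1.reg r := fun r hr => by
    rw [hr3, Function.update_of_ne hr, e2 r hr]
  rw [e2 _ (by omega), a1] at hst3
  refine .seq (.fillSub hX2 (n := 6 * I.n) (by omega) (by decide) trivial (by omega) (by omega)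
    (by rw [e3 _ (by omega), a24]) hX6 ?_
    (fun A x => by rw [e3 _ (by omega), a1]; exact hst3 A x) ?_)
  · intro x h h'
    rw [RamExpr.eval_var, RamState.setReg_reg_self, abs_of_nonneg h]
    have : ((6 * I.n : ℕ) : ℤ) ≤ X := by exact_mod_cast hX6
    linarith
  intro σ4 t11 ht11 hr4 hl4 hs4 hst4
  have e4 : ∀ r, r ≠ 2 → σ4.reg r = σ1.reg r := fun r hr => by
    rw [hr4, Function.update_of_ne hr, e3 r hr]
  rw [e3 _ (by omega), a1] at hst4
  -- Bank by bank, the freshly stamped cells form the input of the tour instance, and everything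
  -- else reads as `0`.
  have hsub4 : σ4.subMem = (RamState.init ((kOptDetection 4).input J)).mem := by
    funext A x
    rw [hs4, hs3, hs2, hsub1]
    match A with
    | 0 =>
      rw [init_mem_eq (L := [(J.n : ℤ)]) rfl (fun _ => (J.n : ℤ)) (by simp)]
      simp [RamExpr.eval_var, RamState.setReg_reg_of_ne, a24, hJn]
    | 1 =>
      have hlen : (rowMajor (weightMatrix J.w)).length = 6 * I.n * (6 * I.n) := by
        rw [length_rowMajor, hJn]
      rw [init_mem_eq (L := rowMajor (weightMatrix J.w)) rfl
        (fun x => (RamExpr.gadgetEntryE (.var 2)).eval (σ2.setReg 2 x)), hlen]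
      · simp
      · intro k hk
        rw [getElem_rowMajor, hentry σ2 (by rw [e2 _ (by omega), a20])
          (by rw [e2 _ (by omega), a23]) (by rw [e2 _ (by omega), a24])
          (by rw [hl2 _ (by omega), m1]) k (by rwa [length_rowMajor] at hk)]
    | 2 =>
      rw [init_mem_eq (L := List.ofFn fun i : Fin J.n => ((J.tour i : ℕ) : ℤ)) rfl (fun x => x)]
      · simp [RamExpr.eval_var, RamState.setReg_reg_self, hJn]
      · intro k hk
        rw [List.getElem_ofFn]; rfl
    | A + 3 =>
      have : (RamState.init ((kOptDetection 4).input J)).mem (A + 3) x = 0 := by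
        have : (kOptDetection 4).input J (A + 3) = [] := rfl
        simp [RamState.init, this]
      rw [this]; simp
  refine .call hX2 (by omega) hBX hrun hsub4
    (fun A x => by rw [e4 _ (by omega), a1]; exact hst4 A x) ?_
  intro σ5 t12 ht12 hr5 _ _
  constructor
  · have h50 : σ5.reg 0 = p.reg 0 := by rw [hr5, Function.update_self]
    rw [DecidesAs, h50, ← I.toTour_hasImprovingMove hIm (b := ((4 * m : ℕ) : ℤ)) (by push_cast; rfl)]
    exact hdec
  · have hc := gadgetEntryE_cost
    have h10 : t10 ≤ (6 * I.n * (6 * I.n) + 1) * 5042 :=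
      ht10.trans (Nat.mul_le_mul_left _ (by omega))
    simp only [RamExpr.cost] at ht9 ht11
    rw [h36] at h10
    omega

/-! ### Running times -/

theorem GraphProblem.SolvableInTime.mono {Pr : GraphProblem} {α β : ℝ} (h : Pr.SolvableInTime α)
    (hsize : ∀ I, 1 ≤ Pr.size I) (hαβ : α ≤ β) : Pr.SolvableInTime β := by
  obtain ⟨P, C, k, c, h⟩ := h
  -- The constant `C` might be negative, and then enlarging the exponent would go in the wrong
  -- direction.
  refine ⟨P, |C|, k, c, fun I M hM => ?_⟩
  obtain ⟨t, s, he, hc, ht⟩ := h I M hM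
  refine ⟨t, s, he, hc, ht.trans ?_⟩
  have hn : (1 : ℝ) ≤ Pr.size I := by exact_mod_cast hsize I
  have hlog : 0 ≤ Real.log ((M : ℝ) + 2) ^ k :=
    pow_nonneg (Real.log_nonneg (by linarith [Nat.cast_nonneg (α := ℝ) M])) k
  refine mul_le_mul_of_nonneg_right ?_ hlog
  exact mul_le_mul (le_abs_self C) (Real.rpow_le_rpow_of_exponent_le hn hαβ)
    (Real.rpow_nonneg (by linarith) _) (abs_nonneg C)

theorem log_two_le_log_add_two (M : ℕ) : Real.log 2 ≤ Real.log ((M : ℝ) + 2) :=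
  Real.log_le_log (by norm_num) (by linarith [Nat.cast_nonneg (α := ℝ) M])

theorem Achieves.exists_exec {X D : ℕ} {P : RamProgram} {input : ℕ → List ℤ}
    {Q : RamState → ℕ → Prop} (h : Achieves X D P (.init input) Q)
    (hX : ∀ A, ∀ z ∈ input A, |z| ≤ (X : ℤ)) :
    ∃ t s σ, Exec (X ^ D) P (.init input) t s ∧ Represents X σ s ∧ Q σ t := by
  obtain ⟨t, s, σ, h1, h2, h3⟩ := h _ (represents_init hX)
  exact ⟨t, s, σ, h1, h2, h3⟩

/-- For `ε ≤ 1` the quadratic cost of writing the instance is below `n ^ (3 - ε)`; passing to `6 n`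
vertices and weights up to `4 M` costs constant factors only. -/
theorem negativeTriangle_solvable {ε : ℝ} (hε : ε ≤ 1)
    (h : (kOptDetection 4).SolvableInTime (3 - ε)) : negativeTriangle.SolvableInTime (3 - ε) := by
  obtain ⟨P, C, k, c, h⟩ := h
  obtain ⟨K, hK⟩ : ∃ K : ℕ, K = 1000000 := ⟨_, rfl⟩
  refine ⟨triangleProgram P,
    -- The simulation gives the `4`, the `6 n` vertices give `6 ^ (3 - ε)`, and `log (4 M + 2) ≤ 3
    -- log (M + 2)` gives `3 ^ k`. As `log (M + 2)` can be below `1`, the overhead is divided by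
    -- `log 2 ^ k` before the logarithmic factor is attached.
    4 * (|C| * (6 : ℝ) ^ (3 - ε) * 3 ^ k) + (P.width + K) / Real.log 2 ^ k,
    -- With `Y = n + M + 2`, the words of the state are at most `X = Y ^ (8 * c + 8)`, and the
    -- evaluation of expressions stays below `X ^ 5000`.
    k, (8 * c + 8) * 5000, fun I M hM => ?_⟩
  have hn := I.n_pos
  change ∃ t s, Exec ((I.n + M + 2) ^ ((8 * c + 8) * 5000)) _ _ t s ∧ DecidesAs _ s ∧
    (t : ℝ) ≤ _ * (I.n : ℝ) ^ (3 - ε) * _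
  set Y := I.n + M + 2 with hY
  have hY3 : 3 ≤ Y := by omega
  have hYpow : ∀ e, 1 ≤ Y ^ e := fun e => Nat.one_le_pow _ _ (by omega)
  have hY8 : Y ^ 8 ≤ Y ^ (8 * c + 8) := Nat.pow_le_pow_right (by omega) (by omega)
  have hYc : Y ^ (8 * c) ≤ Y ^ (8 * c + 8) := Nat.pow_le_pow_right (by omega) (by omega)
  have hY6 : 729 ≤ Y ^ 6 := by
    calc 729 = 3 ^ 6 := by norm_num
      _ ≤ Y ^ 6 := Nat.pow_le_pow_left hY3 6
  have hY8' : 729 * (Y * Y) ≤ Y ^ 8 := by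
    calc 729 * (Y * Y) ≤ Y ^ 6 * (Y * Y) := Nat.mul_le_mul_right _ hY6
      _ = Y ^ 8 := by ring
  have hYY : I.n * I.n ≤ Y * Y := Nat.mul_le_mul (by omega) (by omega)
  have hYY' : Y ≤ Y * Y := Nat.le_mul_of_pos_left _ (by omega)
  have hX : 36 * (I.n * I.n) + 4 * M + 2 ≤ Y ^ (8 * c + 8) := by omega
  have hbase : 6 * I.n + 4 * M + 2 ≤ Y ^ 8 := by omega
  have hB : (6 * I.n + 4 * M + 2) ^ c ≤ Y ^ (8 * c + 8) := by
    calc (6 * I.n + 4 * M + 2) ^ c ≤ (Y ^ 8) ^ c := Nat.pow_le_pow_left hbase c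
      _ = Y ^ (8 * c) := (pow_mul _ _ _).symm
      _ ≤ _ := hYc
  have hMR : (0 : ℝ) ≤ M := Nat.cast_nonneg M
  have hlog2 : 0 < Real.log 2 := Real.log_pos (by norm_num)
  have hlog : Real.log 2 ≤ Real.log ((M : ℝ) + 2) := log_two_le_log_add_two M
  have hlog4 : Real.log (((4 * M : ℕ) : ℝ) + 2) ≤ 3 * Real.log ((M : ℝ) + 2) := by
    have h1 : ((4 * M : ℕ) : ℝ) + 2 ≤ 2 ^ 2 * ((M : ℝ) + 2) := by push_cast; linarith
    calc _ ≤ Real.log (2 ^ 2 * ((M : ℝ) + 2)) := Real.log_le_log (by positivity) h1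
      _ = 2 * Real.log 2 + Real.log ((M : ℝ) + 2) := by
          rw [Real.log_mul (by norm_num) (by positivity), Real.log_pow]; norm_num
      _ ≤ _ := by linarith
  have hnR : (1 : ℝ) ≤ I.n := by exact_mod_cast hn
  set L := Real.log ((M : ℝ) + 2) with hL
  have hL0 : 0 ≤ L := hlog2.le.trans hlog
  set τ : ℝ := |C| * (6 : ℝ) ^ (3 - ε) * 3 ^ k * (I.n : ℝ) ^ (3 - ε) * L ^ k with hτ
  have hτ0 : 0 ≤ τ := by positivity
  have hP : ∀ m : ℕ, m ≤ M → EdgeWeightsBoundedBy I.w m → ∃ t' ≤ ⌊τ⌋₊, ∃ p,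
      Exec ((6 * I.n + 4 * M + 2) ^ c) P
        (.init ((kOptDetection 4).input (I.toTour (4 * m : ℕ)))) t' p ∧
        DecidesAs ((I.toTour (4 * m : ℕ)).HasImprovingMove 4) p := by
    intro m hm hIm
    obtain ⟨t', p, he, hc, ht⟩ := h (I.toTour (4 * m : ℕ)) (4 * M) fun e he =>
      (I.toTour_weightsBoundedBy hIm (by omega) e he).trans (by exact_mod_cast (by omega))
    refine ⟨t', Nat.le_floor (ht.trans ?_), p, he, hc⟩
    have hsz : ((kOptDetection 4).size (I.toTour (4 * m : ℕ)) : ℝ) = 6 * I.n := by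
      change ((6 * I.n : ℕ) : ℝ) = _
      push_cast; rfl
    rw [hsz, Real.mul_rpow (by norm_num) (by positivity)]
    have h1 : Real.log (((4 * M : ℕ) : ℝ) + 2) ^ k ≤ (3 * L) ^ k := by
      refine pow_le_pow_left₀ (Real.log_nonneg ?_) hlog4 k
      have : (0 : ℝ) ≤ ((4 * M : ℕ) : ℝ) := Nat.cast_nonneg _
      linarith
    calc C * ((6 : ℝ) ^ (3 - ε) * (I.n : ℝ) ^ (3 - ε)) * Real.log (((4 * M : ℕ) : ℝ) + 2) ^ k
        ≤ |C| * ((6 : ℝ) ^ (3 - ε) * (I.n : ℝ) ^ (3 - ε)) * (3 * L) ^ k := by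
          refine mul_le_mul ?_ h1 ?_ (by positivity)
          · exact mul_le_mul_of_nonneg_right (le_abs_self C) (by positivity)
          · refine pow_nonneg (Real.log_nonneg ?_) k
            have : (0 : ℝ) ≤ ((4 * M : ℕ) : ℝ) := Nat.cast_nonneg _
            linarith
      _ = τ := by rw [hτ, mul_pow]; ring
  obtain ⟨t, s, σ, he, hs, hdec, ht⟩ := (achieves_triangleProgram hM hB hX hP).exists_exec (by
    intro A z hz
    have hXM : (M : ℤ) ≤ ((Y ^ (8 * c + 8) : ℕ) : ℤ) := by exact_mod_cast (by omega)
    have hXn : (I.n : ℤ) ≤ ((Y ^ (8 * c + 8) : ℕ) : ℤ) := by exact_mod_cast (by omega)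
    have h1 : ∀ z ∈ rowMajor (weightMatrix I.w), |z| ≤ ((Y ^ (8 * c + 8) : ℕ) : ℤ) :=
      forall_mem_rowMajor fun i j => (TriangleInstance.abs_weightMatrix_le hM i j).trans hXM
    match A with
    | 0 =>
      obtain rfl : z = I.n := by simpa [negativeTriangle] using hz
      rwa [Nat.abs_cast]
    | 1 => exact h1 z hz
    | A + 2 => simp [negativeTriangle] at hz)
  rw [← pow_mul] at he
  rw [← hK] at ht
  clear hK
  refine ⟨t, s, he, ?_, ?_⟩
  · have h0 : s.reg 0 = σ.reg 0 := hs.reg 0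
    rwa [DecidesAs, ← h0] at hdec
  · clear he hs hdec hP h hX hB hY8 hYc hYpow hbase hY8' hY6
    have htR : (t : ℝ) ≤ 4 * τ + (P.width + K) * (I.n : ℝ) ^ (2 : ℝ) := by
      have h1 : (t : ℝ) ≤ 4 * (⌊τ⌋₊ : ℝ) + P.width + K * ((I.n : ℝ) * I.n) := by
        exact_mod_cast ht
      have h2 := Nat.floor_le hτ0
      have h3 : (I.n : ℝ) ^ (2 : ℝ) = (I.n : ℝ) * I.n := by
        rw [Real.rpow_two, sq]
      have h4 : (1 : ℝ) ≤ (I.n : ℝ) * I.n := by nlinarith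
      have h5 : (0 : ℝ) ≤ P.width := Nat.cast_nonneg _
      rw [h3]
      nlinarith
    have hpow : (I.n : ℝ) ^ (2 : ℝ) ≤ (I.n : ℝ) ^ (3 - ε) :=
      Real.rpow_le_rpow_of_exponent_le hnR (by linarith)
    have hLk : Real.log 2 ^ k ≤ L ^ k := pow_le_pow_left₀ hlog2.le hlog k
    have hlk : 0 < Real.log 2 ^ k := by positivity
    calc (t : ℝ) ≤ 4 * τ + (P.width + K) * (I.n : ℝ) ^ (2 : ℝ) := htR
      _ ≤ 4 * τ + (P.width + K) * (I.n : ℝ) ^ (3 - ε) * (L ^ k / Real.log 2 ^ k) := by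
          have h1 : 1 ≤ L ^ k / Real.log 2 ^ k := (one_le_div hlk).mpr hLk
          have h2 : ((P.width : ℝ) + K) * (I.n : ℝ) ^ (2 : ℝ) ≤
              (P.width + K) * (I.n : ℝ) ^ (3 - ε) :=
            mul_le_mul_of_nonneg_left hpow (by positivity)
          have h3 : 0 ≤ ((P.width : ℝ) + K) * (I.n : ℝ) ^ (3 - ε) := by positivity
          nlinarith
      _ = _ := by rw [hτ]; ring

/-! ### Shortest paths by repeated squaring of the distance matrix -/

namespace ShortestPathsInstance

variable (I : ShortestPathsInstance)

/-- The sequence `p` of vertices is a walk with `l` arcs of the weights `a 0, a 1, …`. -/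
def IsArcSeq (p : ℕ → Fin I.n) (a : ℕ → ℤ) (l : ℕ) : Prop :=
  ∀ i < l, I.arc (p i) (p (i + 1)) = some (a i)

variable {I}

theorem exists_isArcSeq {u v : Fin I.n} {d : ℤ} (h : WalkWeight I.arc u v d) :
    ∃ l p a, I.IsArcSeq p a l ∧ p 0 = u ∧ p l = v ∧ ∑ i ∈ Finset.range l, a i = d := by
  induction h with
  | nil u => exact ⟨0, fun _ => u, fun _ => 0, by simp [IsArcSeq], rfl, rfl, rfl⟩
  | @cons u v x a d h _ ih =>
    obtain ⟨l, p, b, hp, h0, hl, hd⟩ := ih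
    refine ⟨l + 1, fun i => Nat.casesOn i u p, fun i => Nat.casesOn i a b, ?_, rfl, hl, ?_⟩
    · rintro (_ | i) hi
      · simpa [h0] using h
      · exact hp i (by omega)
    · rw [Finset.sum_range_succ', ← hd]
      exact add_comm _ _

/-- Needed to cut walks: the part between two visits of a vertex is a closed walk, to which the
absence of negative cycles applies. -/
theorem IsArcSeq.walkWeight {p : ℕ → Fin I.n} {a : ℕ → ℤ} {l : ℕ} (h : I.IsArcSeq p a l) (m : ℕ) :
    ∀ i, i + m ≤ l → WalkWeight I.arc (p i) (p (i + m)) (∑ j ∈ Finset.range m, a (i + j)) := by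
  induction m with
  | zero => intro i _; exact .nil _
  | succ m ih =>
    intro i hi
    have h1 := ih (i + 1) (by omega)
    rw [Finset.sum_range_succ', add_comm (Finset.sum _ _)]
    have h2 : i + 1 + m = i + (m + 1) := by ring
    have h3 : ∀ j, a (i + 1 + j) = a (i + (j + 1)) := fun j => by congr 1; ring
    simp only [h2, h3] at h1
    exact .cons (h i (by omega)) h1

/-- A sequence with at least `n` arcs visits some vertex twice. The closed part in between has
nonnegative weight and can be cut out, whence strong induction on the length. -/
theorem exists_short_isArcSeq {u v : Fin I.n} (l : ℕ) : ∀ (p : ℕ → Fin I.n) (a : ℕ → ℤ),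
    I.IsArcSeq p a l → p 0 = u → p l = v → ∃ l' p' a', l' < I.n ∧ I.IsArcSeq p' a' l' ∧
      p' 0 = u ∧ p' l' = v ∧ ∑ i ∈ Finset.range l', a' i ≤ ∑ i ∈ Finset.range l, a i := by
  induction l using Nat.strong_induction_on with
  | _ l ih =>
    intro p a hp h0 hl
    by_cases hln : l < I.n
    · exact ⟨l, p, a, hln, hp, h0, hl, le_rfl⟩
    obtain ⟨i, hi, j, hj, hne, hij⟩ := Finset.exists_ne_map_eq_of_card_lt_of_maps_to
      (s := Finset.range (I.n + 1)) (t := (Finset.univ : Finset (Fin I.n))) (by simp)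
      (f := p) (fun _ _ => Finset.mem_univ _)
    wlog hlt : i < j generalizing i j
    · exact this j hj i hi hne.symm hij.symm (by omega)
    rw [Finset.mem_range] at hi hj
    obtain ⟨c, rfl⟩ : ∃ c, j = i + c := ⟨j - i, by omega⟩
    obtain ⟨r, rfl⟩ : ∃ r, l = i + c + r := ⟨l - (i + c), by omega⟩
    have hcyc := hp.walkWeight c i (by omega)
    rw [← hij] at hcyc
    have hc := I.no_negative_cycle _ _ hcyc
    -- Follow the walk up to position `i` and continue from position `i + c`, where the same vertex
    -- stands.
    obtain ⟨hs1, hs2, hs3⟩ :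
        I.IsArcSeq (fun t => if t ≤ i then p t else p (t + c))
          (fun t => if t < i then a t else a (t + c)) (i + r) ∧
        (if 0 ≤ i then p 0 else p (0 + c)) = u ∧
        (if i + r ≤ i then p (i + r) else p (i + r + c)) = v := by
      refine ⟨?_, ?_, ?_⟩
      · intro t ht
        by_cases h1 : t < i
        · simp only [h1, h1.le, if_true, Nat.succ_le_of_lt h1]
          exact hp t (by omega)
        · have h2 : ¬ t + 1 ≤ i := by omega
          simp only [h1, h2, if_false]
          have h3 : t + 1 + c = t + c + 1 := by ring
          rw [h3]
          by_cases h4 : t ≤ i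
          · obtain rfl : t = i := by omega
            rw [if_pos h4, hij]; exact hp _ (by omega)
          · rw [if_neg h4]; exact hp _ (by omega)
      · simpa using h0
      · by_cases hr : r = 0
        · subst hr
          simp only [add_zero, le_refl, if_true] at hl ⊢
          rw [hij, hl]
        · rw [if_neg (by omega), ← hl]; congr 1; ring
    obtain ⟨l', p', a', h1, h2, h3, h4, h5⟩ := ih (i + r) (by omega) _ _ hs1 hs2 hs3
    refine ⟨l', p', a', h1, h2, h3, h4, h5.trans ?_⟩
    rw [Finset.sum_range_add, Finset.sum_range_add _ (i + c), Finset.sum_range_add]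
    have e1 : ∑ t ∈ Finset.range i, (if t < i then a t else a (t + c)) =
        ∑ t ∈ Finset.range i, a t :=
      Finset.sum_congr rfl fun t ht => if_pos (Finset.mem_range.mp ht)
    have e2 : ∑ t ∈ Finset.range r, (if i + t < i then a (i + t) else a (i + t + c)) =
        ∑ t ∈ Finset.range r, a (i + c + t) :=
      Finset.sum_congr rfl fun t _ => by rw [if_neg (by omega)]; congr 1; ring
    rw [e1, e2]
    linarith

/-- The matrix of the arc weights, with `0` on the diagonal and `Q` where there is no arc. -/
def arcMatrix (I : ShortestPathsInstance) (Q : ℤ) (u v : Fin I.n) : ℤ :=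
  if u = v then 0 else (I.arc u v).getD Q

/-- The repeated min-plus squares of the matrix of the arc weights. -/
def distMatrix (I : ShortestPathsInstance) (Q : ℤ) : ℕ → Fin I.n → Fin I.n → ℤ
  | 0, u, v => arcMatrix I Q u v
  | k + 1, u, v => Finset.univ.inf' ⟨u, Finset.mem_univ u⟩ fun x =>
      distMatrix I Q k u x + distMatrix I Q k x v

variable {Q : ℤ} {M : ℕ}

theorem distMatrix_succ_le (k : ℕ) (u x v : Fin I.n) :
    I.distMatrix Q (k + 1) u v ≤ I.distMatrix Q k u x + I.distMatrix Q k x v := by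
  rw [distMatrix]
  exact Finset.inf'_le (f := fun x => I.distMatrix Q k u x + I.distMatrix Q k x v)
    (Finset.mem_univ x)

theorem exists_distMatrix_succ_eq (k : ℕ) (u v : Fin I.n) :
    ∃ x, I.distMatrix Q (k + 1) u v = I.distMatrix Q k u x + I.distMatrix Q k x v := by
  rw [distMatrix]
  obtain ⟨x, -, hx⟩ := Finset.exists_mem_eq_inf' ⟨u, Finset.mem_univ u⟩
    fun x => I.distMatrix Q k u x + I.distMatrix Q k x v
  exact ⟨x, hx⟩

/-- An entry of the `k`-th square is a sum of `2 ^ k` entries of the base matrix, each at least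
`-M`. -/
theorem neg_le_distMatrix (hM : ∀ u v a, I.arc u v = some a → |a| ≤ (M : ℤ)) (hQ : 0 ≤ Q) (k : ℕ) :
    ∀ u v, -(2 ^ k * (M : ℤ)) ≤ I.distMatrix Q k u v := by
  induction k with
  | zero =>
    intro u v
    simp only [distMatrix, arcMatrix, pow_zero, one_mul]
    have hM0 : (0 : ℤ) ≤ M := by positivity
    split
    · linarith
    · cases h : I.arc u v with
      | none => simp only [Option.getD_none]; linarith
      | some a => exact (abs_le.mp (hM u v a h)).1
  | succ k ih =>
    intro u v
    obtain ⟨x, hx⟩ := exists_distMatrix_succ_eq (Q := Q) k u v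
    have h1 := ih u x
    have h2 := ih x v
    rw [hx, pow_succ]
    linarith

theorem distMatrix_le (hM : ∀ u v a, I.arc u v = some a → |a| ≤ (M : ℤ)) (hQ : (M : ℤ) ≤ Q) (k : ℕ) :
    ∀ u v, I.distMatrix Q k u v ≤ 2 ^ k * Q := by
  induction k with
  | zero =>
    intro u v
    simp only [distMatrix, arcMatrix, pow_zero, one_mul]
    have hM0 : (0 : ℤ) ≤ M := by positivity
    split
    · linarith
    · cases h : I.arc u v with
      | none => simp
      | some a => exact (abs_le.mp (hM u v a h)).2.trans hQ
  | succ k ih =>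
    intro u v
    have h1 := ih u u
    have h2 := ih u v
    have h3 := distMatrix_succ_le (Q := Q) k u u v
    rw [pow_succ]
    linarith

/-- If no summand is the surrogate `Q` for a missing arc, the summands concatenate to a walk, with
diagonal zeros as empty walks. Otherwise `Q` occurs, and the remaining summands lower it by at most
`2 ^ k * M`. -/
theorem distMatrix_cases (hM : ∀ u v a, I.arc u v = some a → |a| ≤ (M : ℤ)) (hQ : 0 ≤ Q) (k : ℕ) :
    ∀ u v, WalkWeight I.arc u v (I.distMatrix Q k u v) ∨ Q - 2 ^ k * M ≤ I.distMatrix Q k u v := by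
  have happ : ∀ {u v x : Fin I.n} {d e : ℤ}, WalkWeight I.arc u v d → WalkWeight I.arc v x e →
      WalkWeight I.arc u x (d + e) := by
    intro u v x d e h1 h2
    induction h1 with
    | nil u => rwa [zero_add]
    | cons h _ ih => rw [add_assoc]; exact .cons h (ih h2)
  induction k with
  | zero =>
    intro u v
    have hM0 : (0 : ℤ) ≤ M := by positivity
    simp only [distMatrix, arcMatrix, pow_zero, one_mul]
    split
    · rename_i h
      subst h; exact .inl (.nil u)
    · cases h : I.arc u v with
      | none => right; simp only [Option.getD_none]; linarith
      | some a => left; simpa using WalkWeight.cons h (.nil v)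
  | succ k ih =>
    intro u v
    obtain ⟨x, hx⟩ := exists_distMatrix_succ_eq (Q := Q) k u v
    have l1 := neg_le_distMatrix hM hQ k u x
    have l2 := neg_le_distMatrix hM hQ k x v
    rw [hx, pow_succ]
    rcases ih u x with h1 | h1
    · rcases ih x v with h2 | h2
      · exact .inl (happ h1 h2)
      · right; linarith
    · right; linarith

/-- A sequence of at most `2 ^ (k + 1)` arcs splits into two of at most `2 ^ k` arcs each. The zero
diagonal takes care of sequences that are too short. -/
theorem distMatrix_le_of_isArcSeq (k : ℕ) : ∀ (l : ℕ) (p : ℕ → Fin I.n) (a : ℕ → ℤ),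
    I.IsArcSeq p a l → l ≤ 2 ^ k → I.distMatrix Q k (p 0) (p l) ≤ ∑ i ∈ Finset.range l, a i := by
  induction k with
  | zero =>
    intro l p a hp hl
    rw [pow_zero] at hl
    simp only [distMatrix, arcMatrix]
    interval_cases l
    · simp
    · have h := hp 0 (by omega)
      rw [zero_add] at h
      split
      -- The single arc is a loop: the diagonal entry is `0`, and the loop has nonnegative weight.
      · rename_i h'
        rw [← h'] at h
        simpa using I.no_negative_cycle _ _ (WalkWeight.cons h (.nil _))
      · simp [h]
  | succ k ih =>
    intro l p a hp hl
    obtain ⟨l1, l2, rfl, h1, h2⟩ : ∃ l1 l2, l = l1 + l2 ∧ l1 ≤ 2 ^ k ∧ l2 ≤ 2 ^ k := by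
      rw [pow_succ] at hl
      exact ⟨min l (2 ^ k), l - min l (2 ^ k), by omega, by omega, by omega⟩
    refine (distMatrix_succ_le k (p 0) (p l1) (p (l1 + l2))).trans ?_
    rw [Finset.sum_range_add]
    exact add_le_add (ih l1 p a (fun i hi => hp i (by omega)) h1)
      (ih l2 (fun i => p (l1 + i)) (fun i => a (l1 + i)) (fun i hi => hp (l1 + i) (by omega)) h2)

/-- The repeatedly squared matrix holds the distances. -/
theorem distMatrix_correct (hM : ∀ u v a, I.arc u v = some a → |a| ≤ (M : ℤ)) {k : ℕ}
    (hk : I.n ≤ 2 ^ k) (hk' : 2 ^ k ≤ 2 * I.n) (hQ : Q = 4 * I.n * M + 1) (u v : Fin I.n) :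
    (I.distMatrix Q k u v ≤ 2 * I.n * M ∧
      IsLeast {d : ℤ | WalkWeight I.arc u v d} (I.distMatrix Q k u v)) ∨
    (¬ I.distMatrix Q k u v ≤ 2 * I.n * M ∧ ∀ d : ℤ, ¬ WalkWeight I.arc u v d) := by
  have hM0 : (0 : ℤ) ≤ M := by positivity
  have hn0 : (0 : ℤ) ≤ I.n := by positivity
  have hQ0 : 0 ≤ Q := by rw [hQ]; positivity
  have hkZ : (2 : ℤ) ^ k * M ≤ 2 * I.n * M :=
    mul_le_mul_of_nonneg_right (by exact_mod_cast hk') hM0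
  -- Entries that involve the surrogate are at least `Q - 2 * n * M = 2 * n * M + 1`, so the
  -- threshold `2 * n * M` separates them from weights of walks.
  have hwalk : I.distMatrix Q k u v ≤ 2 * I.n * M → WalkWeight I.arc u v (I.distMatrix Q k u v) := by
    intro h
    refine (distMatrix_cases hM hQ0 k u v).resolve_right fun h' => ?_
    nlinarith
  -- A walk can be shortened to fewer than `n ≤ 2 ^ k` arcs, and then weighs at most `n * M`.
  have hle : ∀ d, WalkWeight I.arc u v d → I.distMatrix Q k u v ≤ d ∧
      I.distMatrix Q k u v ≤ 2 * I.n * M := by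
    intro d hd
    obtain ⟨l, p, a, hp, h0, hl, rfl⟩ := exists_isArcSeq hd
    obtain ⟨l', p', a', hl', hp', h0', hl'', hle⟩ := exists_short_isArcSeq l p a hp h0 hl
    have h1 := distMatrix_le_of_isArcSeq (Q := Q) k l' p' a' hp' (by omega)
    rw [h0', hl''] at h1
    refine ⟨h1.trans hle, h1.trans ?_⟩
    have h2 : ∑ i ∈ Finset.range l', a' i ≤ (Finset.range l').card • (M : ℤ) :=
      Finset.sum_le_card_nsmul _ _ _ fun i hi =>
        (abs_le.mp (hM _ _ _ (hp' i (Finset.mem_range.mp hi)))).2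
    rw [Finset.card_range, nsmul_eq_mul] at h2
    have h3 : ((l' : ℕ) : ℤ) ≤ I.n := by exact_mod_cast hl'.le
    nlinarith
  by_cases h : I.distMatrix Q k u v ≤ 2 * I.n * M
  · exact .inl ⟨h, hwalk h, fun d hd => (hle d hd).1⟩
  · exact .inr ⟨h, fun d hd => h (hle d hd).2⟩

end ShortestPathsInstance

/-! ### Triangles in triples of blocks -/

/-- The weight of the edge between the vertices `lo < hi` of the tripartite graph of a triple of
blocks of `s` rows, `s` intermediate indices and `s` columns. -/
def blockWeight (n s B p io ko jo : ℤ) (d v mk : ℤ → ℤ) (lo hi : ℤ) : ℤ :=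
  if lo < s then
    if hi < s then B
    else if hi < 2 * s then
      if io + lo < n ∧ ko + (hi - s) < n then d ((io + lo) * n + (ko + (hi - s))) else B
    else
      if io + lo < n ∧ jo + (hi - 2 * s) < n ∧ mk ((io + lo) * n + (jo + (hi - 2 * s))) = 0 then
        0 - (v ((io + lo) * n + (jo + (hi - 2 * s))) + p)
      else B
  else if lo < 2 * s then
    if hi < 2 * s then B
    else
      if ko + (lo - s) < n ∧ jo + (hi - 2 * s) < n then
        d ((ko + (lo - s)) * n + (jo + (hi - 2 * s)))
      else B
  else B

/-- The instance of Negative Edge-Weighted Triangle of a triple of blocks. -/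
def blockInstance (n s : ℕ) (hs : 1 ≤ s) (B p io ko jo : ℤ) (d v mk : ℤ → ℤ) : TriangleInstance where
  n := 3 * s
  n_pos := by omega
  w := Sym2.lift ⟨fun u v' => blockWeight n s B p io ko jo d v mk (min (u : ℕ) (v' : ℕ) : ℕ)
    (max (u : ℕ) (v' : ℕ) : ℕ), fun u v' => by
      dsimp only; rw [min_comm, max_comm]⟩

section

variable {n s : ℕ} {R p io ko jo : ℤ} {d v mk : ℤ → ℤ}

/-- Genuine edges have absolute value at most `R`, missing ones weigh `2 * R`. The lower bound `-R`
makes the latter prohibitive: a triangle with a missing edge weighs at least `2 * R - R - R = 0`. -/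
theorem abs_blockWeight_le (hR : 0 ≤ R)
    (hd : ∀ i j : ℤ, 0 ≤ i → i < n → 0 ≤ j → j < n → |d (i * n + j)| ≤ R)
    (hv : ∀ i j : ℤ, 0 ≤ i → i < n → 0 ≤ j → j < n → |v (i * n + j) + p| ≤ R)
    (hio : 0 ≤ io) (hko : 0 ≤ ko) (hjo : 0 ≤ jo) {lo hi : ℤ} (hlo : 0 ≤ lo) :
    |blockWeight n s (2 * R) p io ko jo d v mk lo hi| ≤ 2 * R ∧
      -R ≤ blockWeight n s (2 * R) p io ko jo d v mk lo hi := by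
  have key : ∀ z : ℤ, |z| ≤ R → |z| ≤ 2 * R ∧ -R ≤ z := fun z hz =>
    ⟨hz.trans (by linarith), (abs_le.mp hz).1⟩
  have hB : |2 * R| ≤ 2 * R ∧ -R ≤ 2 * R := ⟨(abs_of_nonneg (by linarith)).le, by linarith⟩
  unfold blockWeight
  split_ifs with h1 h2 h3 h4 h4 h3 h4 h5
  all_goals first | exact hB | refine key _ ?_
  · exact hd _ _ (by omega) (by omega) (by omega) (by omega)
  · rw [zero_sub, abs_neg]; exact hv _ _ (by omega) (by omega) (by omega) (by omega)
  · exact hd _ _ (by omega) (by omega) (by omega) (by omega)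

theorem blockWeight_cases (B : ℤ) (lo hi : ℤ) : blockWeight n s B p io ko jo d v mk lo hi = B ∨
    (lo < s ∧ s ≤ hi ∧ hi < 2 * s ∧ io + lo < n ∧ ko + (hi - s) < n ∧
      blockWeight n s B p io ko jo d v mk lo hi = d ((io + lo) * n + (ko + (hi - s)))) ∨
    (lo < s ∧ 2 * s ≤ hi ∧ io + lo < n ∧ jo + (hi - 2 * s) < n ∧
      mk ((io + lo) * n + (jo + (hi - 2 * s))) = 0 ∧
      blockWeight n s B p io ko jo d v mk lo hi =
        0 - (v ((io + lo) * n + (jo + (hi - 2 * s))) + p)) ∨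
    (s ≤ lo ∧ lo < 2 * s ∧ 2 * s ≤ hi ∧ ko + (lo - s) < n ∧ jo + (hi - 2 * s) < n ∧
      blockWeight n s B p io ko jo d v mk lo hi =
        d ((ko + (lo - s)) * n + (jo + (hi - 2 * s)))) := by
  unfold blockWeight
  split_ifs with h1 h2 h3 h4 h4 h3 h4 h5
  all_goals first | exact .inl rfl | skip
  · exact .inr (.inl ⟨h1, by omega, h3, h4.1, h4.2, rfl⟩)
  · exact .inr (.inr (.inl ⟨h1, by omega, h4.1, h4.2.1, h4.2.2, rfl⟩))
  · exact .inr (.inr (.inr ⟨by omega, h3, by omega, h5.1, h5.2, rfl⟩))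

theorem blockInstance_weightsBoundedBy {hs : 1 ≤ s} {R : ℕ}
    (hd : ∀ i j : ℤ, 0 ≤ i → i < n → 0 ≤ j → j < n → |d (i * n + j)| ≤ R)
    (hv : ∀ i j : ℤ, 0 ≤ i → i < n → 0 ≤ j → j < n → |v (i * n + j) + p| ≤ R)
    (hio : 0 ≤ io) (hko : 0 ≤ ko) (hjo : 0 ≤ jo) :
    EdgeWeightsBoundedBy (blockInstance n s hs (2 * R) p io ko jo d v mk).w (2 * R) := by
  intro e _
  induction e with
  | _ i j =>
    push_cast
    exact (abs_blockWeight_le (by positivity) hd hv hio hko hjo (by positivity)).1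

/-- The parts are rows, intermediate indices and columns. A triangle without missing edges has one
vertex in each part and weighs `d i k + d k j - (v i j + p)`. The edge between a row and a column is
present only while the pair is unmarked. -/
theorem blockInstance_hasNegativeTriangle {hs : 1 ≤ s} {R : ℕ}
    (hd : ∀ i j : ℤ, 0 ≤ i → i < n → 0 ≤ j → j < n → |d (i * n + j)| ≤ R)
    (hv : ∀ i j : ℤ, 0 ≤ i → i < n → 0 ≤ j → j < n → |v (i * n + j) + p| ≤ R)
    (hio : 0 ≤ io) (hko : 0 ≤ ko) (hjo : 0 ≤ jo) :
    (blockInstance n s hs (2 * R) p io ko jo d v mk).HasNegativeTriangle ↔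
      ∃ i k j : ℤ, io ≤ i ∧ i < io + s ∧ i < n ∧ ko ≤ k ∧ k < ko + s ∧ k < n ∧
        jo ≤ j ∧ j < jo + s ∧ j < n ∧ mk (i * n + j) = 0 ∧
        d (i * n + k) + d (k * n + j) < v (i * n + j) + p := by
  set J := blockInstance n s hs (2 * R) p io ko jo d v mk with hJ
  set f := blockWeight n s (2 * R) p io ko jo d v mk with hf
  have hw : ∀ a b : Fin J.n, a < b → J.w s(a, b) = f (a : ℕ) (b : ℕ) := by
    intro a b hab
    have hab' : (a : ℕ) ≤ b := hab.le
    change f (min (a : ℕ) (b : ℕ) : ℕ) (max (a : ℕ) (b : ℕ) : ℕ) = _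
    rw [min_eq_left hab', max_eq_right hab']
  constructor
  · rintro ⟨x, y, z, hxy, hyz, hxz, hneg⟩
    have key : ∀ a b c : Fin J.n, a < b → b < c →
        J.w s(a, b) + J.w s(b, c) + J.w s(a, c) < 0 → ∃ i k j : ℤ, io ≤ i ∧ i < io + s ∧ i < n ∧
        ko ≤ k ∧ k < ko + s ∧ k < n ∧ jo ≤ j ∧ j < jo + s ∧ j < n ∧ mk (i * n + j) = 0 ∧
        d (i * n + k) + d (k * n + j) < v (i * n + j) + p := by
      intro a b c hab hbc h
      rw [hw _ _ hab, hw _ _ hbc, hw _ _ (hab.trans hbc)] at h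
      have hR : (0 : ℤ) ≤ R := by positivity
      have l1 := (abs_blockWeight_le (s := s) (mk := mk) (lo := (a : ℕ)) (hi := (b : ℕ)) hR hd hv
        hio hko hjo (by positivity)).2
      have l2 := (abs_blockWeight_le (s := s) (mk := mk) (lo := (b : ℕ)) (hi := (c : ℕ)) hR hd hv
        hio hko hjo (by positivity)).2
      have l3 := (abs_blockWeight_le (s := s) (mk := mk) (lo := (a : ℕ)) (hi := (c : ℕ)) hR hd hv
        hio hko hjo (by positivity)).2
      have c1 := blockWeight_cases (n := n) (s := s) (p := p) (io := io) (ko := ko) (jo := jo)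
        (d := d) (v := v) (mk := mk) (2 * R) (a : ℕ) (b : ℕ)
      have c2 := blockWeight_cases (n := n) (s := s) (p := p) (io := io) (ko := ko) (jo := jo)
        (d := d) (v := v) (mk := mk) (2 * R) (b : ℕ) (c : ℕ)
      have c3 := blockWeight_cases (n := n) (s := s) (p := p) (io := io) (ko := ko) (jo := jo)
        (d := d) (v := v) (mk := mk) (2 * R) (a : ℕ) (c : ℕ)
      rw [← hf] at l1 l2 l3 c1 c2 c3
      have hc : (c : ℕ) < 3 * s := c.2
      have ha0 : (0 : ℤ) ≤ (a : ℕ) := by positivity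
      -- The other two edges weigh at least `-R` each, so a missing edge of weight `2 * R` is
      -- impossible in a negative triangle.
      replace c1 := c1.resolve_left (by omega)
      replace c2 := c2.resolve_left (by omega)
      replace c3 := c3.resolve_left (by omega)
      rcases c1 with ⟨a1, a2, a3, a4, a5, a6⟩ | ⟨a1, a2, a3⟩ | ⟨a1, a2, a3, a4⟩
      · rcases c2 with ⟨b1, b2⟩ | ⟨b1, b2, b3⟩ | ⟨b1, b2, b3, b4, b5, b6⟩
        · omega
        · omega
        · rcases c3 with ⟨c1, c2, c3, c4⟩ | ⟨c1, c2, c3, c4, c5, c6⟩ | ⟨c1, c2, c3⟩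
          · omega
          · refine ⟨_, _, _, ?_, ?_, c3, ?_, ?_, a5, ?_, ?_, c4, c5, ?_⟩ <;> omega
          · omega
      · rcases c2 with ⟨b1, b2⟩ | ⟨b1, b2, b3⟩ | ⟨b1, b2, b3, b4⟩ <;> omega
      · rcases c2 with ⟨b1, b2⟩ | ⟨b1, b2, b3⟩ | ⟨b1, b2, b3, b4⟩ <;> omega
    have hs' : ∀ a b : Fin J.n, J.w s(a, b) = J.w s(b, a) := fun a b => by rw [Sym2.eq_swap]
    -- Sorting the vertices: six of the eight sign patterns are orders, the other two are cyclic and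
    -- impossible.
    rcases lt_or_gt_of_ne hxy with h1 | h1 <;> rcases lt_or_gt_of_ne hyz with h2 | h2 <;>
      rcases lt_or_gt_of_ne hxz with h3 | h3
    · exact key x y z h1 h2 hneg
    · exact absurd (h1.trans h2) (not_lt.mpr h3.le)
    · exact key x z y h3 h2 (by linarith [hs' y z])
    · exact key z x y h3 h1 (by linarith [hs' y z, hs' x z])
    · exact key y x z h1 h3 (by linarith [hs' x y])
    · exact key y z x h2 h3 (by linarith [hs' x y, hs' x z])
    · exact absurd (h2.trans h1) (not_lt.mpr h3.le)
    · exact key z y x h2 h1 (by linarith [hs' x y, hs' y z, hs' x z])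
  · rintro ⟨i, k, j, i1, i2, i3, k1, k2, k3, j1, j2, j3, hm, hlt⟩
    obtain ⟨a, ha⟩ := Int.eq_ofNat_of_zero_le (show 0 ≤ i - io by omega)
    obtain ⟨b, hb⟩ := Int.eq_ofNat_of_zero_le (show 0 ≤ k - ko by omega)
    obtain ⟨c, hc⟩ := Int.eq_ofNat_of_zero_le (show 0 ≤ j - jo by omega)
    obtain rfl : i = io + a := by omega
    obtain rfl : k = ko + b := by omega
    obtain rfl : j = jo + c := by omega
    have hJn : J.n = 3 * s := rfl
    refine ⟨⟨a, by omega⟩, ⟨s + b, by omega⟩, ⟨2 * s + c, by omega⟩, by simp; omega, by simp; omega,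
      by simp; omega, ?_⟩
    rw [hw _ _ (Fin.mk_lt_mk.mpr (by omega)), hw _ _ (Fin.mk_lt_mk.mpr (by omega)),
      hw _ _ (Fin.mk_lt_mk.mpr (by omega))]
    have e1 : f (a : ℕ) ((s + b : ℕ) : ℤ) = d ((io + a) * n + (ko + b)) := by
      rw [hf, blockWeight, if_pos (by omega), if_neg (by omega), if_pos (by omega),
        if_pos (by omega)]
      congr 1; push_cast; ring
    have ej : jo + (((2 * s + c : ℕ) : ℤ) - 2 * s) = jo + c := by push_cast; ring
    have e2 : f ((s + b : ℕ) : ℤ) ((2 * s + c : ℕ) : ℤ) = d ((ko + b) * n + (jo + c)) := by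
      have ek : ko + (((s + b : ℕ) : ℤ) - s) = ko + b := by push_cast; ring
      rw [hf, blockWeight, ek, ej, if_neg (by omega), if_pos (by omega), if_neg (by omega),
        if_pos (by omega)]
    have e3 : f (a : ℕ) ((2 * s + c : ℕ) : ℤ) = 0 - (v ((io + a) * n + (jo + c)) + p) := by
      rw [hf, blockWeight, ej, if_pos (by omega), if_neg (by omega), if_neg (by omega),
        if_pos ⟨by omega, by omega, hm⟩]
    rw [e1, e2, e3]
    linarith

end

/-! ### The program that marks the entries exceeding the min-plus product -/

/-- A loop that writes `1` into those cells `a` of a bank for which the condition `c` holds. -/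
theorem Achieves.scatter {X D : ℕ} {σ : RamState} {Q : RamState → ℕ → Prop} (hX : 2 ≤ X)
    {i A N n : ℕ} {a c : RamExpr} (hD : 8 ≤ D) (hDa : a.deg ≤ D)
    (hDe : (RamExpr.ite c (.const 1) (.ld A a)).deg ≤ D) (ha : a.Avoids A) (hc : c.Avoids A)
    (hiN : i ≠ N) (hn : σ.reg N = n)
    (hQ : ∀ (σ' : RamState) (t : ℕ), t ≤ (n + 1) * (c.cost + 2 * a.cost + 30) →
      (∀ r, r ≠ i → σ'.reg r = σ.reg r) → (∀ A', A' ≠ A → σ'.mem A' = σ.mem A') →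
      (∀ y : ℤ, 0 ≤ y → y < n → c.eval (σ.setReg i y) ≠ 0 →
        σ'.mem A (a.eval (σ.setReg i y)) = 1) →
      (∀ z : ℤ, σ'.mem A z = σ.mem A z ∨ σ'.mem A z = 1 ∧ ∃ y : ℤ, 0 ≤ y ∧ y < n ∧
        c.eval (σ.setReg i y) ≠ 0 ∧ a.eval (σ.setReg i y) = z) → Q σ' t) :
    Achieves X D (.forLoop i N (.storeE A a (.ite c (.const 1) (.ld A a)))) σ Q := by
  refine .of_bounded fun hbdd => ?_
  have hnX : n ≤ X := by
    have := (le_abs_self _).trans (hbdd.1 N); rw [hn] at this; exact_mod_cast this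
  refine .forLoop hX hD hiN hn hnX
    (fun k σ' t => t ≤ 3 + k * (c.cost + 2 * a.cost + 30) ∧ (∀ r, r ≠ i → σ'.reg r = σ.reg r) ∧
      (∀ A', A' ≠ A → σ'.mem A' = σ.mem A') ∧
      (∀ y : ℤ, 0 ≤ y → y < k → c.eval (σ.setReg i y) ≠ 0 →
        σ'.mem A (a.eval (σ.setReg i y)) = 1) ∧
      ∀ z : ℤ, σ'.mem A z = σ.mem A z ∨ σ'.mem A z = 1 ∧ ∃ y : ℤ, 0 ≤ y ∧ y < k ∧
        c.eval (σ.setReg i y) ≠ 0 ∧ a.eval (σ.setReg i y) = z) ?_ ?_ ?_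
  · intro t ht
    exact ⟨by omega, fun r hr => σ.setReg_reg_of_ne hr 0, fun _ _ => rfl,
      fun y h0 h1 => by omega, fun z => .inl rfl⟩
  · rintro k hk σ' t ⟨ht, hr, hm, h1, h2⟩ hi hN
    have hreg : σ'.reg = (σ.setReg i k).reg := by
      funext r
      by_cases h : r = i
      · subst h; rw [hi, RamState.setReg_reg_self]
      · rw [hr r h, RamState.setReg_reg_of_ne _ h]
    have eva : a.eval σ' = a.eval (σ.setReg i k) := ha.eval_congr hreg hm
    have evc : c.eval σ' = c.eval (σ.setReg i k) := hc.eval_congr hreg hm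
    have hev : (RamExpr.ite c (.const 1) (.ld A a)).eval σ' =
        if c.eval (σ.setReg i k) = 0 then σ'.mem A (a.eval (σ.setReg i k)) else 1 := by
      rw [RamExpr.eval_ite, RamExpr.eval_const, RamExpr.eval_ld, eva, evc]
    refine .of_bounded fun hb' => .storeE hX hDa hDe ?_ fun t' ht' => ?_
    · rw [hev]
      split_ifs
      · exact hb'.2 _ _
      · rw [abs_one]; exact_mod_cast (by omega)
    rw [hev, eva]
    refine ⟨hi, hN, fun t'' ht'' => ⟨?_, ?_, ?_, ?_, ?_⟩⟩
    · simp only [RamExpr.cost] at ht'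
      have : (k + 1) * (c.cost + 2 * a.cost + 30) =
        k * (c.cost + 2 * a.cost + 30) + (c.cost + 2 * a.cost + 30) := by ring
      omega
    · intro r h
      rw [RamState.setReg_reg_of_ne _ h]; exact hr r h
    · intro A' h
      rw [RamState.setReg_mem, RamState.setMem]
      simp only [Function.update_of_ne h]
      exact hm A' h
    · intro y hy0 hy1 hcy
      simp only [RamState.setReg_mem, RamState.setMem, Function.update_self, Function.update_apply]
      by_cases hyk : y = k
      · subst hyk
        rw [if_pos rfl, if_neg hcy]
      · have hy : y < k := by push_cast at hy1; omega
        have := h1 y hy0 hy hcy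
        split_ifs with h3 h4
        · rwa [← h3]
        · rfl
        · exact this
    · intro z
      simp only [RamState.setReg_mem, RamState.setMem, Function.update_self, Function.update_apply]
      have h2z := h2 z
      have hup : (σ'.mem A z = 1 ∧ ∃ y : ℤ, 0 ≤ y ∧ y < k ∧
          c.eval (σ.setReg i y) ≠ 0 ∧ a.eval (σ.setReg i y) = z) → σ'.mem A z = 1 ∧ ∃ y : ℤ,
          0 ≤ y ∧ y < ((k + 1 : ℕ) : ℤ) ∧ c.eval (σ.setReg i y) ≠ 0 ∧
          a.eval (σ.setReg i y) = z := by
        rintro ⟨h, y, y0, y1, y2⟩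
        exact ⟨h, y, y0, by push_cast; omega, y2⟩
      split_ifs with h3 h4
      · subst h3; exact h2z.imp_right hup
      · exact .inr ⟨rfl, k, by positivity, by push_cast; omega, h4, h3.symm⟩
      · exact h2z.imp_right hup
  · rintro σ' t t' ht' - - ⟨ht, hr, hm, h1, h2⟩
    refine hQ σ' t' ?_ hr hm h1 h2
    have : (n + 1) * (c.cost + 2 * a.cost + 30) =
      n * (c.cost + 2 * a.cost + 30) + (c.cost + 2 * a.cost + 30) := by ring
    omega

namespace RamExpr

/-- The expression for `blockWeight`. -/
def blockWeightE (lo hi : RamExpr) : RamExpr :=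
  let n := var 20
  let s := var 22
  let s2 := bin .mul (const 2) (var 22)
  let i := bin .add (var 6) lo
  let k := bin .add (var 7) (bin .sub hi s)
  let k' := bin .add (var 7) (bin .sub lo s)
  let j := bin .add (var 8) (bin .sub hi s2)
  let ij := bin .add (bin .mul i n) j
  ite (bin .lt lo s)
    (ite (bin .lt hi s) (var 28)
      (ite (bin .lt hi s2)
        (ite (both (bin .lt i n) (bin .lt k n)) (ld 3 (bin .add (bin .mul i n) k)) (var 28))
        (ite (both (bin .lt i n) (both (bin .lt j n) (bin .eq (ld 5 ij) (const 0))))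
          (bin .sub (const 0) (bin .add (ld 4 ij) (var 11))) (var 28))))
    (ite (bin .lt lo s2)
      (ite (bin .lt hi s2) (var 28)
        (ite (both (bin .lt k' n) (bin .lt j n)) (ld 3 (bin .add (bin .mul k' n) j)) (var 28)))
      (var 28))

theorem eval_blockWeightE (σ : RamState) (lo hi : RamExpr) : (blockWeightE lo hi).eval σ =
    blockWeight (σ.reg 20) (σ.reg 22) (σ.reg 28) (σ.reg 11) (σ.reg 6) (σ.reg 7) (σ.reg 8)
      (σ.mem 3) (σ.mem 4) (σ.mem 5) (lo.eval σ) (hi.eval σ) := by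
  simp only [blockWeightE, blockWeight, eval_ite, eval_both_eq_zero, eval_lt_eq_zero,
    eval_eq_eq_zero, eval_var, eval_const, eval_add, eval_sub, eval_mul, eval_ld, ite_not, ne_eq,
    not_not]

/-- The expression for the entry with index `var 2` of the weight matrix of `blockInstance`. -/
def blockEntryE : RamExpr :=
  let u := bin .div (var 2) (var 23)
  let v := bin .mod (var 2) (var 23)
  ite (bin .eq u v) (const 0) (blockWeightE (minE u v) (maxE u v))

theorem eval_blockEntryE (σ : RamState) : blockEntryE.eval σ =
    if σ.reg 2 / σ.reg 23 = σ.reg 2 % σ.reg 23 then 0 else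
    blockWeight (σ.reg 20) (σ.reg 22) (σ.reg 28) (σ.reg 11) (σ.reg 6) (σ.reg 7) (σ.reg 8)
      (σ.mem 3) (σ.mem 4) (σ.mem 5) (min (σ.reg 2 / σ.reg 23) (σ.reg 2 % σ.reg 23))
      (max (σ.reg 2 / σ.reg 23) (σ.reg 2 % σ.reg 23)) := by
  simp only [blockEntryE, eval_blockWeightE, eval_ite, eval_eq_eq_zero, eval_minE, eval_maxE,
    ite_not, eval_const, eval_div, eval_mod, eval_var]

theorem blockEntryE_deg : blockEntryE.deg ≤ 5000 := by decide +kernel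

theorem blockEntryE_cost : blockEntryE.cost ≤ 5000 := by decide +kernel

/-- The row of the triple with index `var 2` in the current triple of blocks. -/
def tripleRowE : RamExpr := bin .add (var 6) (bin .div (var 2) (bin .mul (var 22) (var 22)))

/-- The intermediate index of the triple with index `var 2` in the current triple of blocks. -/
def tripleMidE : RamExpr := bin .add (var 7) (bin .mod (bin .div (var 2) (var 22)) (var 22))

/-- The column of the triple with index `var 2` in the current triple of blocks. -/
def tripleColE : RamExpr := bin .add (var 8) (bin .mod (var 2) (var 22))

/-- The cell of the triple with index `var 2` in the current triple of blocks. -/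
def tripleCellE : RamExpr := bin .add (bin .mul tripleRowE (var 20)) tripleColE

/-- The triple with index `var 2` in the current triple of blocks is in range and undercuts the
threshold. -/
def tripleCondE : RamExpr :=
  both (bin .lt tripleRowE (var 20)) (both (bin .lt tripleMidE (var 20))
    (both (bin .lt tripleColE (var 20)) (bin .lt
      (bin .add (ld 3 (bin .add (bin .mul tripleRowE (var 20)) tripleMidE))
        (ld 3 (bin .add (bin .mul tripleMidE (var 20)) tripleColE)))
      (bin .add (ld 4 tripleCellE) (var 11)))))

theorem eval_tripleCondE_ne_zero (σ : RamState) : tripleCondE.eval σ ≠ 0 ↔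
    tripleRowE.eval σ < σ.reg 20 ∧ tripleMidE.eval σ < σ.reg 20 ∧ tripleColE.eval σ < σ.reg 20 ∧
    σ.mem 3 (tripleRowE.eval σ * σ.reg 20 + tripleMidE.eval σ) +
      σ.mem 3 (tripleMidE.eval σ * σ.reg 20 + tripleColE.eval σ) <
      σ.mem 4 (tripleRowE.eval σ * σ.reg 20 + tripleColE.eval σ) + σ.reg 11 := by
  simp only [tripleCondE, tripleCellE, eval_both_eq_zero, eval_lt_eq_zero, eval_var, eval_add,
    eval_mul, eval_ld, ne_eq, not_not]

end RamExpr

/-- The triangle test on the current triple of blocks. -/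
def blockCall (P : RamProgram) : RamProgram :=
  .seq (.fillSub 2 0 29 (.var 23)) (.seq (.fillSub 2 1 24 .blockEntryE) (.call P 3))

/-- The exhaustive search in the current triple of blocks. -/
def blockSearch : RamProgram :=
  .forLoop 2 25 (.storeE 5 .tripleCellE (.ite .tripleCondE (.const 1) (.ld 5 .tripleCellE)))

/-- The constants kept in the variables from `20` on: the number `n` of rows, the block size `s`, the
number `G` of blocks, the bound `R` and derived numbers. -/
structure HoldsParams (n s G R : ℕ) (σ : RamState) : Prop where
  n_eq : σ.reg 20 = n
  nn_eq : σ.reg 21 = (n * n : ℕ)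
  s_eq : σ.reg 22 = s
  s3_eq : σ.reg 23 = (3 * s : ℕ)
  s33_eq : σ.reg 24 = (3 * s * (3 * s) : ℕ)
  sss_eq : σ.reg 25 = (s * s * s : ℕ)
  G_eq : σ.reg 26 = G
  GGG_eq : σ.reg 27 = (G * G * G : ℕ)
  big_eq : σ.reg 28 = 2 * (R : ℤ)
  one_eq : σ.reg 29 = (1 : ℕ)

theorem HoldsParams.congr {n s G R : ℕ} {σ σ' : RamState} (h : HoldsParams n s G R σ)
    (hr : ∀ r, 20 ≤ r → r < 30 → σ'.reg r = σ.reg r) : HoldsParams n s G R σ' where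
  n_eq := by rw [hr _ (by omega) (by omega), h.n_eq]
  nn_eq := by rw [hr _ (by omega) (by omega), h.nn_eq]
  s_eq := by rw [hr _ (by omega) (by omega), h.s_eq]
  s3_eq := by rw [hr _ (by omega) (by omega), h.s3_eq]
  s33_eq := by rw [hr _ (by omega) (by omega), h.s33_eq]
  sss_eq := by rw [hr _ (by omega) (by omega), h.sss_eq]
  G_eq := by rw [hr _ (by omega) (by omega), h.G_eq]
  GGG_eq := by rw [hr _ (by omega) (by omega), h.GGG_eq]
  big_eq := by rw [hr _ (by omega) (by omega), h.big_eq]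
  one_eq := by rw [hr _ (by omega) (by omega), h.one_eq]

/-- The subroutine decides Negative Edge-Weighted Triangle on `m` vertices with weights up to `M`
within `τ` steps and with words up to `B`. -/
def DecidesTriangle (P : RamProgram) (m M B τ : ℕ) : Prop :=
  ∀ J : TriangleInstance, J.n = m → EdgeWeightsBoundedBy J.w M → ∃ t ≤ τ, ∃ p,
    Exec B P (.init (negativeTriangle.input J)) t p ∧ DecidesAs J.HasNegativeTriangle p

/-- All stamps are strictly below variable `1`, so the subroutine sees only the instance written
here. Apart from the call itself, the cost is quadratic in the block size. -/
theorem achieves_blockCall {X D B τ n s G R : ℕ} {P : RamProgram} {σ : RamState}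
    {Q : RamState → ℕ → Prop} {p io ko jo : ℤ} (hX : 2 ≤ X) (hD : 5000 ≤ D) (hB : B ≤ X)
    (hP : DecidesTriangle P (3 * s) (2 * R) B τ) (hs : 1 ≤ s) (hσ : HoldsParams n s G R σ)
    (hp : σ.reg 11 = p) (h6 : σ.reg 6 = io) (h7 : σ.reg 7 = ko) (h8 : σ.reg 8 = jo)
    (hio : 0 ≤ io) (hko : 0 ≤ ko) (hjo : 0 ≤ jo)
    (hd : ∀ i j : ℤ, 0 ≤ i → i < n → 0 ≤ j → j < n → |σ.mem 3 (i * n + j)| ≤ R)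
    (hv : ∀ i j : ℤ, 0 ≤ i → i < n → 0 ≤ j → j < n → |σ.mem 4 (i * n + j) + p| ≤ R)
    (hstamp : ∀ A x, σ.mem (9 + 2 * A) x < σ.reg 1)
    (hQ : ∀ (σ' : RamState) (t : ℕ), t ≤ 4 * τ + P.width + 100000 * (s * s) →
      (∀ r, r ≠ 2 → r ≠ 3 → σ'.reg r = σ.reg r) → (∀ A < 8, σ'.mem A = σ.mem A) →
      (∀ A x, σ'.mem (9 + 2 * A) x ≤ σ.reg 1) →
      ((∃ i k j : ℤ, io ≤ i ∧ i < io + s ∧ i < n ∧ ko ≤ k ∧ k < ko + s ∧ k < n ∧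
        jo ≤ j ∧ j < jo + s ∧ j < n ∧ σ.mem 5 (i * n + j) = 0 ∧
        σ.mem 3 (i * n + k) + σ.mem 3 (k * n + j) < σ.mem 4 (i * n + j) + p) ↔ σ'.reg 3 ≠ 0) →
      Q σ' t) :
    Achieves X D (blockCall P) σ Q := by
  refine .of_bounded fun hbdd => ?_
  have hregX : ∀ {r m : ℕ}, σ.reg r = m → m ≤ X := fun {r m} h => by
    have := (le_abs_self _).trans (hbdd.1 r); rw [h] at this; exact_mod_cast this
  set J := blockInstance n s hs (2 * R) p io ko jo (σ.mem 3) (σ.mem 4) (σ.mem 5) with hJ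
  have hJn : J.n = 3 * s := rfl
  have hJM : EdgeWeightsBoundedBy J.w (2 * R) := blockInstance_weightsBoundedBy hd hv hio hko hjo
  have hJneg := blockInstance_hasNegativeTriangle (hs := hs) (mk := σ.mem 5) hd hv hio hko hjo
  rw [← hJ] at hJneg
  obtain ⟨t0, ht0, q, hrun, hdec⟩ := hP J hJn hJM
  have h2R : ((2 * R : ℕ) : ℤ) ≤ X := by
    have := (le_abs_self _).trans (hbdd.1 28); rw [hσ.big_eq] at this
    push_cast; exact this
  refine .seq (.fillSub hX (n := 1) (by omega) (by simp [RamExpr.deg]; omega) trivial (by omega)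
    (by omega) hσ.one_eq (by omega) ?_ (fun A x => (hstamp A x).le) ?_)
  · intro x _ _
    rw [RamExpr.eval_var, RamState.setReg_reg_of_ne _ (by omega)]
    exact hbdd.1 _
  intro σ2 t2 ht2 hr2 hl2 hs2 hst2
  have e2 : ∀ r, r ≠ 2 → σ2.reg r = σ.reg r := fun r hr => by
    rw [hr2, Function.update_of_ne hr]
  have hentry : ∀ k : ℕ, ∀ hk : k < J.n * J.n,
      RamExpr.blockEntryE.eval (σ2.setReg 2 k) = weightMatrix J.w
        ⟨k / J.n, Nat.div_lt_of_lt_mul hk⟩ ⟨k % J.n, Nat.mod_lt _ (by omega)⟩ := by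
    intro k hk
    have d1 : ((k : ℤ) / ((3 * s : ℕ) : ℤ)) = ((k / J.n : ℕ) : ℤ) := by rw [hJn]; push_cast; rfl
    have d2 : ((k : ℤ) % ((3 * s : ℕ) : ℤ)) = ((k % J.n : ℕ) : ℤ) := by rw [hJn]; push_cast; rfl
    have er : ∀ r, r ≠ 2 → (σ2.setReg 2 k).reg r = σ.reg r := fun r hr => by
      rw [RamState.setReg_reg_of_ne _ hr, e2 r hr]
    rw [RamExpr.eval_blockEntryE, RamState.setReg_reg_self, er 23 (by omega), er 20 (by omega),
      er 22 (by omega), er 28 (by omega), er 11 (by omega), er 6 (by omega), er 7 (by omega),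
      er 8 (by omega), RamState.setReg_mem, hl2 3 (by omega), hl2 4 (by omega), hl2 5 (by omega),
      hσ.s3_eq, hσ.n_eq, hσ.s_eq, hσ.big_eq, hp, h6, h7, h8, d1, d2, weightMatrix]
    simp only [Fin.mk.injEq, Nat.cast_inj]
    by_cases huv : k / J.n = k % J.n
    · rw [if_pos huv, if_pos huv]
    · rw [if_neg huv, if_neg huv, ← Nat.cast_min, ← Nat.cast_max]
      rfl
  refine .seq (.fillSub hX (n := 3 * s * (3 * s)) (by omega) (RamExpr.blockEntryE_deg.trans hD)
    (by decide +kernel) (by omega) (by omega) (by rw [e2 _ (by omega), hσ.s33_eq])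
    (hregX hσ.s33_eq) ?_ (fun A x => by rw [e2 _ (by omega)]; exact hst2 A x) ?_)
  · intro x hx0 hx1
    obtain ⟨k, rfl⟩ := Int.eq_ofNat_of_zero_le hx0
    have hk : k < J.n * J.n := by rw [hJn]; exact_mod_cast hx1
    rw [hentry k hk]
    exact (TriangleInstance.abs_weightMatrix_le hJM _ _).trans h2R
  intro σ3 t3 ht3 hr3 hl3 hs3 hst3
  have e3 : ∀ r, r ≠ 2 → σ3.reg r = σ.reg r := fun r hr => by
    rw [hr3, Function.update_of_ne hr, e2 r hr]
  rw [e2 _ (by omega)] at hst3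
  have hsub3 : σ3.subMem = (RamState.init (negativeTriangle.input J)).mem := by
    funext A x
    rw [hs3, hs2, RamState.subMem_eq_zero hstamp]
    match A with
    | 0 =>
      rw [init_mem_eq (L := [(J.n : ℤ)]) rfl (fun _ => (J.n : ℤ)) (by simp)]
      simp [RamExpr.eval_var, RamState.setReg_reg_of_ne, hσ.s3_eq, hJn]
    | 1 =>
      have hlen : (rowMajor (weightMatrix J.w)).length = 3 * s * (3 * s) := by
        rw [length_rowMajor, hJn]
      rw [init_mem_eq (L := rowMajor (weightMatrix J.w)) rfl
        (fun x => RamExpr.blockEntryE.eval (σ2.setReg 2 x)), hlen]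
      · simp
      · intro k hk
        rw [getElem_rowMajor, hentry k (by rwa [length_rowMajor] at hk)]
    | A + 2 =>
      have : (RamState.init (negativeTriangle.input J)).mem (A + 2) x = 0 := by
        have : negativeTriangle.input J (A + 2) = [] := rfl
        simp [RamState.init, this]
      rw [this]; simp
  refine .call hX (by omega) hB hrun hsub3
    (fun A x => by rw [e3 _ (by omega)]; exact hst3 A x) ?_
  intro σ4 t4 ht4 hr4 hl4 hst4
  rw [e3 _ (by omega)] at hst4
  refine hQ _ _ ?_ ?_ ?_ hst4 ?_
  · have hc := RamExpr.blockEntryE_cost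
    have h3 : t3 ≤ (3 * s * (3 * s) + 1) * 5042 := ht3.trans (Nat.mul_le_mul_left _ (by omega))
    simp only [RamExpr.cost] at ht2
    have h9 : 3 * s * (3 * s) = 9 * (s * s) := by ring
    have hss : 1 ≤ s * s := Nat.mul_le_mul hs hs
    rw [h9] at h3
    omega
  · intro r h h'
    rw [hr4, Function.update_of_ne h', e3 r h]
  · intro A hA
    rw [hl4 A hA, hl3 A hA, hl2 A hA]
  · rw [hr4, Function.update_self, ← hJneg]
    rcases hdec with ⟨h, h'⟩ | ⟨h, h'⟩ <;> simp [h, h']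

/-- Lets one counter replace three nested loops: in base `s` for the index triples inside a triple
of blocks, in base `G` for the triples of blocks themselves. -/
theorem Int.digits_of_triple {s a b c : ℤ} (ha : 0 ≤ a) (ha' : a < s) (hb : 0 ≤ b) (hb' : b < s)
    (hc : 0 ≤ c) (hc' : c < s) :
    0 ≤ (a * s + b) * s + c ∧ (a * s + b) * s + c < s * s * s ∧
      ((a * s + b) * s + c) / (s * s) = a ∧ ((a * s + b) * s + c) / s % s = b ∧
      ((a * s + b) * s + c) % s = c := by
  have hs : 0 < s := by omega
  have h1 : ((a * s + b) * s + c) / s = a * s + b := by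
    rw [add_comm, Int.add_mul_ediv_right _ _ hs.ne', Int.ediv_eq_zero_of_lt hc hc', zero_add]
  have h2 : (a * s + b) / s = a := by
    rw [add_comm, Int.add_mul_ediv_right _ _ hs.ne', Int.ediv_eq_zero_of_lt hb hb', zero_add]
  refine ⟨by positivity, ?_, ?_, ?_, ?_⟩
  · have h3 : a * s + b + 1 ≤ s * s := by nlinarith
    nlinarith
  · rw [← Int.ediv_ediv_of_nonneg hs.le, h1, h2]
  · rw [h1, add_comm, Int.add_mul_emod_self_right, Int.emod_eq_of_lt hb hb']
  · rw [add_comm, Int.add_mul_emod_self_right, Int.emod_eq_of_lt hc hc']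

/-- The intermediate index `k` undercuts the threshold of the pair `(i, j)`. -/
def RamState.Undercuts (σ : RamState) (n : ℕ) (p i k j : ℤ) : Prop :=
  0 ≤ i ∧ i < n ∧ 0 ≤ k ∧ k < n ∧ 0 ≤ j ∧ j < n ∧
    σ.mem 3 (i * n + k) + σ.mem 3 (k * n + j) < σ.mem 4 (i * n + j) + p

/-- The search uses every witness in the triple of blocks, not just one behind the positive test, so
a single search settles all pairs that are undercut there. -/
theorem achieves_blockSearch {X D n s G R : ℕ} {σ : RamState} {Q : RamState → ℕ → Prop}
    {p io ko jo : ℤ} (hX : 2 ≤ X) (hD : 5000 ≤ D) (hs : 1 ≤ s) (hσ : HoldsParams n s G R σ)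
    (hp : σ.reg 11 = p) (h6 : σ.reg 6 = io) (h7 : σ.reg 7 = ko) (h8 : σ.reg 8 = jo)
    (hio : 0 ≤ io) (hko : 0 ≤ ko) (hjo : 0 ≤ jo)
    (hQ : ∀ (σ' : RamState) (t : ℕ), t ≤ 10000 * (s * s * s) →
      (∀ r, r ≠ 2 → σ'.reg r = σ.reg r) → (∀ A, A ≠ 5 → σ'.mem A = σ.mem A) →
      (∀ i k j, σ.Undercuts n p i k j → io ≤ i → i < io + s → ko ≤ k → k < ko + s → jo ≤ j →
        j < jo + s → σ'.mem 5 (i * n + j) = 1) →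
      (∀ z, σ'.mem 5 z = σ.mem 5 z ∨ σ'.mem 5 z = 1 ∧ ∃ i k j, σ.Undercuts n p i k j ∧
        z = i * n + j) → Q σ' t) :
    Achieves X D blockSearch σ Q := by
  have hs0 : (0 : ℤ) < s := by exact_mod_cast hs
  have er : ∀ y r, r ≠ 2 → (σ.setReg 2 y).reg r = σ.reg r := fun y r hr =>
    RamState.setReg_reg_of_ne _ hr _
  have hrow : ∀ y, RamExpr.tripleRowE.eval (σ.setReg 2 y) = io + y / (s * s) := fun y => by
    rw [RamExpr.tripleRowE, RamExpr.eval_add, RamExpr.eval_div, RamExpr.eval_mul, RamExpr.eval_var,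
      RamExpr.eval_var, RamExpr.eval_var, RamState.setReg_reg_self, er y 6 (by omega),
      er y 22 (by omega), h6, hσ.s_eq]
  have hmid : ∀ y, RamExpr.tripleMidE.eval (σ.setReg 2 y) = ko + y / s % s := fun y => by
    rw [RamExpr.tripleMidE, RamExpr.eval_add, RamExpr.eval_mod, RamExpr.eval_div, RamExpr.eval_var,
      RamExpr.eval_var, RamExpr.eval_var, RamState.setReg_reg_self, er y 7 (by omega),
      er y 22 (by omega), h7, hσ.s_eq]
  have hcol : ∀ y, RamExpr.tripleColE.eval (σ.setReg 2 y) = jo + y % s := fun y => by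
    rw [RamExpr.tripleColE, RamExpr.eval_add, RamExpr.eval_mod, RamExpr.eval_var,
      RamExpr.eval_var, RamExpr.eval_var, RamState.setReg_reg_self, er y 8 (by omega),
      er y 22 (by omega), h8, hσ.s_eq]
  have hcell : ∀ y, RamExpr.tripleCellE.eval (σ.setReg 2 y) =
      (io + y / (s * s)) * n + (jo + y % s) := fun y => by
    rw [RamExpr.tripleCellE, RamExpr.eval_add, RamExpr.eval_mul, RamExpr.eval_var, hrow, hcol,
      er y 20 (by omega), hσ.n_eq]
  refine .scatter hX (n := s * s * s) (by omega)
    ((by decide +kernel : RamExpr.tripleCellE.deg ≤ 5000).trans hD)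
    ((by decide +kernel : (RamExpr.ite .tripleCondE (.const 1) (.ld 5 .tripleCellE)).deg ≤
      5000).trans hD)
    (by decide +kernel) (by decide +kernel) (by omega) hσ.sss_eq ?_
  intro σ' t ht hr hm h1 h2
  refine hQ σ' t ?_ hr hm ?_ ?_
  · have hc : RamExpr.tripleCondE.cost + 2 * RamExpr.tripleCellE.cost + 30 ≤ 5000 := by
      decide +kernel
    have hsss : 1 ≤ s * s * s := Nat.mul_le_mul (Nat.mul_le_mul hs hs) hs
    have := ht.trans (Nat.mul_le_mul_left _ hc)
    omega
  · rintro i k j ⟨i0, i1, k0, k1, j0, j1, hlt⟩ i2 i3 k2 k3 j2 j3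
    obtain ⟨d0, d1, d2, d3, d4⟩ := Int.digits_of_triple (s := s) (a := i - io) (b := k - ko)
      (c := j - jo) (by omega) (by omega) (by omega) (by omega) (by omega) (by omega)
    have ei : io + (i - io) = i := by ring
    have ek : ko + (k - ko) = k := by ring
    have ej : jo + (j - jo) = j := by ring
    have := h1 _ d0 (by push_cast; exact d1) (by
      rw [RamExpr.eval_tripleCondE_ne_zero, hrow, hmid, hcol, d2, d3, d4, ei, ek, ej,
        er _ 20 (by omega), er _ 11 (by omega), hp, hσ.n_eq]
      exact ⟨i1, k1, j1, hlt⟩)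
    rwa [hcell, d2, d4, ei, ej] at this
  · intro z
    refine (h2 z).imp_right ?_
    rintro ⟨h, y, y0, y1, hc, hz⟩
    rw [RamExpr.eval_tripleCondE_ne_zero, hrow, hmid, hcol, er _ 20 (by omega),
      er _ 11 (by omega), hp, hσ.n_eq] at hc
    rw [hcell] at hz
    have a0 : 0 ≤ y / ((s : ℤ) * s) := Int.ediv_nonneg y0 (by positivity)
    have b0 : 0 ≤ y / (s : ℤ) % s := Int.emod_nonneg _ hs0.ne'
    have c0 : 0 ≤ y % (s : ℤ) := Int.emod_nonneg _ hs0.ne'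
    exact ⟨h, _, _, _, ⟨by omega, hc.1, by omega, hc.2.1, by omega, hc.2.2⟩, hz.symm⟩

/-- Test one triple of blocks, and search it if the test is positive. -/
def blockStep (P : RamProgram) : RamProgram :=
  .seq (.assign 6 (.bin .mul (.var 22) (.bin .div (.var 10) (.bin .mul (.var 26) (.var 26))))) <|
  .seq (.assign 7 (.bin .mul (.var 22) (.bin .mod (.bin .div (.var 10) (.var 26)) (.var 26)))) <|
  .seq (.assign 8 (.bin .mul (.var 22) (.bin .mod (.var 10) (.var 26)))) <|
  .seq (.assign 1 (.bin .add (.var 1) (.const 1))) <|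
  .seq (blockCall P) (.whenE (.var 3) blockSearch)

/-- The test ignores marked pairs. A negative answer therefore certifies that no unmarked pair is
undercut within this triple of blocks; a positive answer pays for the cubic search with at least one
newly marked pair. This is the alternative in the time bound. -/
theorem achieves_blockStep {X D B τ n s G R x : ℕ} {P : RamProgram} {σ : RamState}
    {Q : RamState → ℕ → Prop} {p : ℤ} (hX : 2 ≤ X) (hD : 5000 ≤ D) (hB : B ≤ X)
    (hP : DecidesTriangle P (3 * s) (2 * R) B τ) (hs : 1 ≤ s) (hσ : HoldsParams n s G R σ)
    (hG : n ≤ s * G) (hsG : s * G ≤ X) (hp : σ.reg 11 = p) (hx : σ.reg 10 = x)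
    (hxG : x < G * G * G) (hcur : σ.reg 1 + 1 ≤ X) (hcur0 : 0 ≤ σ.reg 1)
    (hd : ∀ i j : ℤ, 0 ≤ i → i < n → 0 ≤ j → j < n → |σ.mem 3 (i * n + j)| ≤ R)
    (hv : ∀ i j : ℤ, 0 ≤ i → i < n → 0 ≤ j → j < n → |σ.mem 4 (i * n + j) + p| ≤ R)
    (hstamp : ∀ A x, σ.mem (9 + 2 * A) x ≤ σ.reg 1)
    (hQ : ∀ (σ' : RamState) (t : ℕ), (∀ r, 9 ≤ r → σ'.reg r = σ.reg r) →
      (∀ A < 8, A ≠ 5 → σ'.mem A = σ.mem A) → σ'.reg 1 = σ.reg 1 + 1 →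
      (∀ A x, σ'.mem (9 + 2 * A) x ≤ σ'.reg 1) →
      (∀ z, σ'.mem 5 z = σ.mem 5 z ∨ σ'.mem 5 z = 1 ∧ ∃ i k j, σ.Undercuts n p i k j ∧
        z = i * n + j) →
      (∀ i k j, σ.Undercuts n p i k j → (i / s * G + k / s) * G + j / s = x →
        σ.mem 5 (i * n + j) = 0 → σ'.mem 5 (i * n + j) = 1) →
      (t ≤ 4 * τ + P.width + 200000 * (s * s) ∨
        t ≤ 4 * τ + P.width + 200000 * (s * s) + 10000 * (s * s * s) ∧
        ∃ i k j, σ.Undercuts n p i k j ∧ σ.mem 5 (i * n + j) = 0 ∧ σ'.mem 5 (i * n + j) = 1) →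
      Q σ' t) :
    Achieves X D (blockStep P) σ Q := by
  have hs0 : (0 : ℤ) < s := by exact_mod_cast hs
  have hG0 : 0 < G := by
    rcases Nat.eq_zero_or_pos G with rfl | h
    · simp at hxG
    · exact h
  have hG0' : (0 : ℤ) < G := by exact_mod_cast hG0
  have hsGX : (s : ℤ) * G ≤ X := by exact_mod_cast hsG
  have hGn : (n : ℤ) ≤ s * G := by exact_mod_cast hG
  have hxGZ : (x : ℤ) < G * G * G := by exact_mod_cast hxG
  have habs : ∀ a : ℤ, 0 ≤ a → a < G → |s * a| ≤ (X : ℤ) := fun a h0 h1 => by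
    rw [abs_of_nonneg (by positivity)]
    nlinarith
  have I0 : (0 : ℤ) ≤ x / (G * G) := by positivity
  have I1 : (x : ℤ) / (G * G) < G := Int.ediv_lt_of_lt_mul (by positivity) (by linarith)
  have K0 : (0 : ℤ) ≤ x / G % G := Int.emod_nonneg _ hG0'.ne'
  have K1 : (x : ℤ) / G % G < G := Int.emod_lt_of_pos _ hG0'
  have J0 : (0 : ℤ) ≤ x % G := Int.emod_nonneg _ hG0'.ne'
  have J1 : (x : ℤ) % G < G := Int.emod_lt_of_pos _ hG0'
  refine .seq (.assign hX ((by decide +kernel : _ ≤ 5000).trans hD) ?_ (by omega) fun t1 ht1 => ?_)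
  · rw [RamExpr.eval_mul, RamExpr.eval_div, RamExpr.eval_mul, RamExpr.eval_var, RamExpr.eval_var,
      RamExpr.eval_var, hσ.s_eq, hσ.G_eq, hx]
    exact habs _ I0 I1
  rw [RamExpr.eval_mul, RamExpr.eval_div, RamExpr.eval_mul, RamExpr.eval_var, RamExpr.eval_var,
      RamExpr.eval_var, hσ.s_eq, hσ.G_eq, hx]
  have e7 : ∀ z : ℤ, (RamExpr.bin .mul (.var 22) (.bin .mod (.bin .div (.var 10) (.var 26))
      (.var 26))).eval (σ.setReg 6 z) = s * (x / G % G) := fun z => by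
    rw [RamExpr.eval_mul, RamExpr.eval_mod, RamExpr.eval_div, RamExpr.eval_var, RamExpr.eval_var,
      RamExpr.eval_var, RamState.setReg_reg_of_ne _ (by omega),
      RamState.setReg_reg_of_ne _ (by omega), RamState.setReg_reg_of_ne _ (by omega), hσ.s_eq,
      hσ.G_eq, hx]
  refine .seq (.assign hX ((by decide +kernel : _ ≤ 5000).trans hD) ?_ (by omega) fun t2 ht2 => ?_)
  · rw [e7]; exact habs _ K0 K1
  rw [e7]
  have e8 : ∀ z z' : ℤ, (RamExpr.bin .mul (.var 22) (.bin .mod (.var 10) (.var 26))).eval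
      ((σ.setReg 6 z).setReg 7 z') = s * (x % G) := fun z z' => by
    rw [RamExpr.eval_mul, RamExpr.eval_mod, RamExpr.eval_var, RamExpr.eval_var,
      RamExpr.eval_var]
    simp only [RamState.setReg_reg_of_ne _ (by omega : 22 ≠ 7),
      RamState.setReg_reg_of_ne _ (by omega : 10 ≠ 7), RamState.setReg_reg_of_ne _ (by omega : 26 ≠ 7),
      RamState.setReg_reg_of_ne _ (by omega : 22 ≠ 6),
      RamState.setReg_reg_of_ne _ (by omega : 10 ≠ 6), RamState.setReg_reg_of_ne _ (by omega : 26 ≠ 6),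
      hσ.s_eq, hσ.G_eq, hx]
  refine .seq (.assign hX ((by decide +kernel : _ ≤ 5000).trans hD) ?_ (by omega) fun t3 ht3 => ?_)
  · rw [e8]; exact habs _ J0 J1
  rw [e8]
  have e1 : ∀ z z' z'' : ℤ, (RamExpr.bin .add (.var 1) (.const 1)).eval
      (((σ.setReg 6 z).setReg 7 z').setReg 8 z'') = σ.reg 1 + 1 := fun z z' z'' => by
    rw [RamExpr.eval_add, RamExpr.eval_var, RamExpr.eval_const]
    simp only [RamState.setReg_reg_of_ne _ (by omega : 1 ≠ 6),
      RamState.setReg_reg_of_ne _ (by omega : 1 ≠ 7), RamState.setReg_reg_of_ne _ (by omega : 1 ≠ 8)]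
  refine .seq (.assign hX ((by decide +kernel : _ ≤ 5000).trans hD) ?_ (by omega) fun t4 ht4 => ?_)
  · rw [e1, abs_of_nonneg (by linarith)]; exact hcur
  rw [e1]
  simp only [RamExpr.cost] at ht1 ht2 ht3 ht4
  generalize hσ1 : (((σ.setReg 6 (s * (x / (G * G)))).setReg 7 (s * (x / G % G))).setReg 8
    (s * (x % G))).setReg 1 (σ.reg 1 + 1) = σ1
  have m1 : σ1.mem = σ.mem := by rw [← hσ1]; rfl
  have a1 : σ1.reg 1 = σ.reg 1 + 1 := by rw [← hσ1]; simp [RamState.setReg]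
  have a6 : σ1.reg 6 = s * (x / (G * G)) := by rw [← hσ1]; simp [RamState.setReg]
  have a7 : σ1.reg 7 = s * (x / G % G) := by rw [← hσ1]; simp [RamState.setReg]
  have a8 : σ1.reg 8 = s * (x % G) := by rw [← hσ1]; simp [RamState.setReg]
  have ar : ∀ r, 9 ≤ r → σ1.reg r = σ.reg r := fun r hr => by
    rw [← hσ1, RamState.setReg_reg_of_ne _ (by omega), RamState.setReg_reg_of_ne _ (by omega),
      RamState.setReg_reg_of_ne _ (by omega), RamState.setReg_reg_of_ne _ (by omega)]
  clear hσ1 e1 e7 e8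
  have hσ1 : HoldsParams n s G R σ1 := hσ.congr fun r hr _ => ar r (by omega)
  have io0 : (0 : ℤ) ≤ s * (x / (G * G)) := by positivity
  have ko0 : (0 : ℤ) ≤ s * (x / G % G) := mul_nonneg hs0.le K0
  have jo0 : (0 : ℤ) ≤ s * (x % G) := mul_nonneg hs0.le J0
  have p1 : σ1.reg 11 = p := by rw [ar _ (by omega), hp]
  refine .seq (achieves_blockCall hX hD hB hP hs hσ1 p1 a6 a7 a8 io0 ko0 jo0
    (by rw [m1]; exact hd) (by rw [m1]; exact hv)
    (fun A x => by rw [m1, a1]; linarith [hstamp A x]) ?_)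
  intro σ2 t5 ht5 hr2 hl2 hst2 hans
  rw [m1] at hans hl2
  rw [a1] at hst2
  have b1 : σ2.reg 1 = σ.reg 1 + 1 := by rw [hr2 _ (by omega) (by omega), a1]
  -- Block `a` consists of the indices from `s * a` to `s * a + s - 1`, and the block numbers of
  -- `i`, `k`, `j` are the digits of `x` in base `G`.
  have hblock : ∀ i k j : ℤ, σ.Undercuts n p i k j → (i / s * G + k / s) * G + j / s = x →
      s * ((x : ℤ) / (G * G)) ≤ i ∧ i < s * ((x : ℤ) / (G * G)) + s ∧
      s * ((x : ℤ) / G % G) ≤ k ∧ k < s * ((x : ℤ) / G % G) + s ∧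
      s * ((x : ℤ) % G) ≤ j ∧ j < s * ((x : ℤ) % G) + s := by
    rintro i k j ⟨i0, i1, k0, k1, j0, j1, -⟩ hxe
    have hlt : ∀ i : ℤ, i < n → i / s < G := fun i hi =>
      Int.ediv_lt_of_lt_mul hs0 (by linarith)
    obtain ⟨-, -, d1, d2, d3⟩ := Int.digits_of_triple (s := G) (Int.ediv_nonneg i0 hs0.le)
      (hlt i i1) (Int.ediv_nonneg k0 hs0.le) (hlt k k1) (Int.ediv_nonneg j0 hs0.le) (hlt j j1)
    rw [hxe] at d1 d2 d3
    have hdiv : ∀ i : ℤ, s * (i / s) ≤ i ∧ i < s * (i / s) + s := fun i =>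
      ⟨Int.mul_ediv_self_le hs0.ne', Int.lt_mul_ediv_self_add hs0⟩
    rw [d1, d2, d3]
    exact ⟨(hdiv i).1, (hdiv i).2, (hdiv k).1, (hdiv k).2, (hdiv j).1, (hdiv j).2⟩
  have hss : 1 ≤ s * s := Nat.mul_le_mul hs hs
  refine .whenE hX (by simp only [RamExpr.deg]; omega) (fun hc => ?_) (fun hc t6 ht6 => ?_)
  · rw [RamExpr.eval_var, ← hans] at hc
    have hσ2 : HoldsParams n s G R σ2 := hσ1.congr fun r _ _ => hr2 r (by omega) (by omega)
    have hU : ∀ i k j, σ2.Undercuts n p i k j ↔ σ.Undercuts n p i k j := fun i k j => by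
      rw [RamState.Undercuts, RamState.Undercuts, hl2 3 (by omega), hl2 4 (by omega)]
    refine achieves_blockSearch hX hD hs hσ2 (by rw [hr2 _ (by omega) (by omega), p1])
      (by rw [hr2 _ (by omega) (by omega), a6]) (by rw [hr2 _ (by omega) (by omega), a7])
      (by rw [hr2 _ (by omega) (by omega), a8]) io0 ko0 jo0 ?_
    intro σ3 t6 ht6 hr3 hl3 h1 h2 t7 ht7 _
    simp only [hU] at h1 h2
    rw [hl2 5 (by omega)] at h2
    refine hQ σ3 _ (fun r hr => by rw [hr3 r (by omega), hr2 r (by omega) (by omega), ar r hr])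
      (fun A hA hA5 => by rw [hl3 A hA5, hl2 A hA]) (by rw [hr3 _ (by omega), b1])
      (fun A x => by rw [hl3 _ (by omega), hr3 _ (by omega), b1]; exact hst2 A x) h2 ?_ (.inr ⟨?_, ?_⟩)
    · intro i k j hu hxe _
      obtain ⟨i0, i1, k0, k1, j0, j1⟩ := hblock i k j hu hxe
      exact h1 i k j hu i0 i1 k0 k1 j0 j1
    · simp only [RamExpr.cost] at ht7
      omega
    · obtain ⟨i, k, j, i0, i1, i2, k0, k1, k2, j0, j1, j2, hm, hlt⟩ := hc
      have hu : σ.Undercuts n p i k j :=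
        ⟨by linarith, i2, by linarith, k2, by linarith, j2, hlt⟩
      exact ⟨i, k, j, hu, hm, h1 i k j hu i0 i1 k0 k1 j0 j1⟩
  · have hc' := hc
    rw [RamExpr.eval_var] at hc'
    refine hQ σ2 _ (fun r hr => by rw [hr2 r (by omega) (by omega), ar r hr])
      (fun A hA _ => by rw [hl2 A hA]) b1 (fun A x => by rw [b1]; exact hst2 A x)
      (fun z => .inl (by rw [hl2 5 (by omega)])) ?_ (.inl ?_)
    · intro i k j hu hxe hm
      obtain ⟨i0, i1, k0, k1, j0, j1⟩ := hblock i k j hu hxe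
      exact absurd hc' (hans.mp ⟨i, k, j, i0, i1, hu.2.1, k0, k1, hu.2.2.2.1, j0, j1,
        hu.2.2.2.2.2.1, hm, hu.2.2.2.2.2.2⟩)
    · simp only [RamExpr.cost] at ht6
      omega

/-! ### Marking all undercut pairs. -/

theorem Int.cell_lt {n i j : ℤ} (hi : 0 ≤ i) (hi' : i < n) (hj : 0 ≤ j) (hj' : j < n) :
    0 ≤ i * n + j ∧ i * n + j < n * n :=
  ⟨by have : 0 ≤ i * n := mul_nonneg hi (by omega)
      omega, by nlinarith⟩

theorem Int.cell_inj {n i j i' j' : ℤ} (hj : 0 ≤ j) (hj' : j < n) (hk : 0 ≤ j') (hk' : j' < n)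
    (h : i * n + j = i' * n + j') : i = i' ∧ j = j' := by
  have hn : n ≠ 0 := by omega
  have h1 : (i * n + j) / n = i := by
    rw [add_comm, Int.add_mul_ediv_right _ _ hn, Int.ediv_eq_zero_of_lt hj hj', zero_add]
  have h2 : (i' * n + j') / n = i' := by
    rw [add_comm, Int.add_mul_ediv_right _ _ hn, Int.ediv_eq_zero_of_lt hk hk', zero_add]
  obtain rfl : i = i' := by rw [← h1, h, h2]
  exact ⟨rfl, by linarith⟩

/-- Mark in bank `5` all pairs whose threshold is undercut by some intermediate index. -/
def markProgram (P : RamProgram) : RamProgram :=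
  .seq (.fill 2 5 21 (.const 0)) (.forLoop 10 27 (blockStep P))

/-- An upper bound on the running time of `markProgram`. -/
def markTime (n s G τ W : ℕ) : ℕ :=
  G * G * G * (4 * τ + W + 200100 * (s * s)) + 20000 * (n * n * (s * s * s))

/-- The number of marked cells. -/
def RamState.markCount (σ : RamState) (n : ℕ) : ℕ :=
  ((Finset.range (n * n)).filter fun z => σ.mem 5 (z : ℕ) = 1).card

theorem RamState.markCount_le (σ : RamState) (n : ℕ) : σ.markCount n ≤ n * n :=
  (Finset.card_filter_le _ _).trans (Finset.card_range _).le

theorem RamState.markCount_mono {σ σ' : RamState} {n : ℕ}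
    (h : ∀ z, σ.mem 5 z = 1 → σ'.mem 5 z = 1) : σ.markCount n ≤ σ'.markCount n :=
  Finset.card_le_card fun z hz => by
    rw [Finset.mem_filter] at hz ⊢
    exact ⟨hz.1, h _ hz.2⟩

theorem RamState.markCount_lt {σ σ' : RamState} {n : ℕ}
    (h : ∀ z, σ.mem 5 z = 1 → σ'.mem 5 z = 1) {z : ℤ} (h0 : 0 ≤ z) (h1 : z < n * n)
    (hz : σ.mem 5 z = 0) (hz' : σ'.mem 5 z = 1) : σ.markCount n < σ'.markCount n := by
  refine Finset.card_lt_card ⟨fun z hz => ?_, fun hsub => ?_⟩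
  · rw [Finset.mem_filter] at hz ⊢
    exact ⟨hz.1, h _ hz.2⟩
  · obtain ⟨z, rfl⟩ := Int.eq_ofNat_of_zero_le h0
    have : z ∈ (Finset.range (n * n)).filter fun z => σ'.mem 5 (z : ℕ) = 1 :=
      Finset.mem_filter.mpr ⟨Finset.mem_range.mpr (by exact_mod_cast h1), hz'⟩
    have := (Finset.mem_filter.mp (hsub this)).2
    rw [hz] at this
    exact absurd this (by norm_num)

/-- Cubic searches happen only when the number of marked pairs grows, hence at most `n ^ 2` times,
while all `G ^ 3` tests are made. Marks are set for undercut pairs only, and every index triple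
belongs to one of the triples of blocks. -/
theorem achieves_markProgram {X D B τ n s G R : ℕ} {P : RamProgram} {σ : RamState}
    {Q : RamState → ℕ → Prop} {p : ℤ} (hX : 2 ≤ X) (hD : 5000 ≤ D) (hB : B ≤ X)
    (hP : DecidesTriangle P (3 * s) (2 * R) B τ) (hn : 1 ≤ n) (hs : 1 ≤ s)
    (hσ : HoldsParams n s G R σ) (hG : n ≤ s * G) (hsG : s * G ≤ X) (hp : σ.reg 11 = p)
    (hcur : σ.reg 1 + (G * G * G : ℕ) ≤ X) (hcur0 : 0 ≤ σ.reg 1)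
    (hd : ∀ i j : ℤ, 0 ≤ i → i < n → 0 ≤ j → j < n → |σ.mem 3 (i * n + j)| ≤ R)
    (hv : ∀ i j : ℤ, 0 ≤ i → i < n → 0 ≤ j → j < n → |σ.mem 4 (i * n + j) + p| ≤ R)
    (hstamp : ∀ A x, σ.mem (9 + 2 * A) x ≤ σ.reg 1)
    (hQ : ∀ (σ' : RamState) (t : ℕ), t ≤ markTime n s G τ P.width →
      (∀ r, 11 ≤ r → σ'.reg r = σ.reg r) →
      (∀ A < 8, A ≠ 5 → σ'.mem A = σ.mem A) → σ'.reg 1 = σ.reg 1 + (G * G * G : ℕ) →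
      (∀ A x, σ'.mem (9 + 2 * A) x ≤ σ'.reg 1) →
      (∀ i j : ℤ, 0 ≤ i → i < n → 0 ≤ j → j < n →
        (σ'.mem 5 (i * n + j) = 1 ∧ ∃ k, σ.Undercuts n p i k j) ∨
        (σ'.mem 5 (i * n + j) = 0 ∧ ∀ k, ¬ σ.Undercuts n p i k j)) → Q σ' t) :
    Achieves X D (markProgram P) σ Q := by
  refine .of_bounded fun hbdd => ?_
  have hregX : ∀ {r m : ℕ}, σ.reg r = m → m ≤ X := fun {r m} h => by
    have := (le_abs_self _).trans (hbdd.1 r); rw [h] at this; exact_mod_cast this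
  have hs0 : (0 : ℤ) < s := by exact_mod_cast hs
  have hGn : (n : ℤ) ≤ s * G := by exact_mod_cast hG
  refine .seq (.fill hX (n := n * n) (by omega) (by simp [RamExpr.deg]) trivial (by omega) hσ.nn_eq
    (hregX hσ.nn_eq) (by intro x _ _; simp [RamExpr.eval_const]) fun t1 ht1 => ?_)
  generalize hσ1 : σ.filled 2 5 (n * n) _ = σ1
  have r1 : ∀ r, r ≠ 2 → σ1.reg r = σ.reg r := fun r hr => by
    rw [← hσ1, RamState.filled_reg_of_ne hr]
  have m1 : ∀ A, A ≠ 5 → σ1.mem A = σ.mem A := fun A hA => by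
    rw [← hσ1, RamState.filled_mem_of_ne hA]
  have m5 : ∀ z : ℤ, 0 ≤ z → z < n * n → σ1.mem 5 z = 0 := fun z h0 h1 => by
    rw [← hσ1, RamState.filled_mem_self]
    simp only
    rw [if_pos ⟨h0, by push_cast; exact h1⟩, RamExpr.eval_const]
  clear hσ1
  set T1 := 4 * τ + P.width + 200000 * (s * s) with hT1
  set T2 := 10000 * (s * s * s) with hT2
  refine .forLoop hX (n := G * G * G) (by omega) (by omega) (by rw [r1 _ (by omega), hσ.GGG_eq])
    (hregX hσ.GGG_eq)
    -- The number of marked cells is a potential that pays `T2` for each cubic search.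
    (fun x σ' t => t ≤ 3 + x * (T1 + 12) + σ'.markCount n * T2 ∧
      (∀ r, 11 ≤ r → σ'.reg r = σ.reg r) ∧ (∀ A < 8, A ≠ 5 → σ'.mem A = σ.mem A) ∧
      σ'.reg 1 = σ.reg 1 + x ∧ (∀ A x, σ'.mem (9 + 2 * A) x ≤ σ'.reg 1) ∧
      (∀ z, 0 ≤ z → z < (n : ℤ) * n → σ'.mem 5 z = 0 ∨ σ'.mem 5 z = 1 ∧
        ∃ i k j, σ.Undercuts n p i k j ∧ z = i * n + j) ∧
      ∀ i k j, σ.Undercuts n p i k j → (i / s * G + k / s) * G + j / s < x →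
        σ'.mem 5 (i * n + j) = 1) ?_ ?_ ?_
  · intro t ht
    refine ⟨by omega, fun r hr => ?_, fun A hA h5 => ?_, ?_, fun A x => ?_, fun z h0 h1 => ?_, ?_⟩
    · rw [RamState.setReg_reg_of_ne _ (by omega), r1 _ (by omega)]
    · rw [RamState.setReg_mem, m1 _ h5]
    · rw [RamState.setReg_reg_of_ne _ (by omega), r1 _ (by omega)]; simp
    · rw [RamState.setReg_reg_of_ne _ (by omega), RamState.setReg_mem, r1 _ (by omega),
        m1 _ (by omega)]
      exact hstamp A x
    · exact .inl (m5 z h0 h1)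
    · rintro i k j ⟨i0, i1, k0, k1, j0, j1, -⟩ h
      have h1 : 0 ≤ i / (s : ℤ) := Int.ediv_nonneg i0 hs0.le
      have h2 : 0 ≤ k / (s : ℤ) := Int.ediv_nonneg k0 hs0.le
      have h3 : 0 ≤ j / (s : ℤ) := Int.ediv_nonneg j0 hs0.le
      have : 0 ≤ (i / s * G + k / s) * G + j / (s : ℤ) := by positivity
      push_cast at h
      omega
  · rintro x hxG σ2 t ⟨ht, hr2, hl2, hc2, hst2, hm2, hcomp2⟩ hx -
    have hU : ∀ i k j, σ2.Undercuts n p i k j ↔ σ.Undercuts n p i k j := fun i k j => by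
      rw [RamState.Undercuts, RamState.Undercuts, hl2 3 (by omega) (by omega),
        hl2 4 (by omega) (by omega)]
    have hσ2 : HoldsParams n s G R σ2 := hσ.congr fun r _ _ => hr2 r (by omega)
    have hxGZ : (x : ℤ) + 1 ≤ (G * G * G : ℕ) := by exact_mod_cast hxG
    refine achieves_blockStep hX hD hB hP hs hσ2 hG hsG (by rw [hr2 _ (by omega), hp]) hx hxG
      (by rw [hc2]; linarith) (by rw [hc2]; positivity)
      (by rw [hl2 3 (by omega) (by omega)]; exact hd)
      (by rw [hl2 4 (by omega) (by omega)]; exact hv) hst2 ?_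
    intro σ3 t3 hr3 hl3 hc3 hst3 hch hcomp htime
    simp only [hU] at hch hcomp htime
    have hmono : ∀ z, σ2.mem 5 z = 1 → σ3.mem 5 z = 1 := fun z hz => by
      rcases hch z with h | h
      · rw [h, hz]
      · exact h.1
    refine ⟨by rw [hr3 _ (by omega), hx],
      by rw [hr3 _ (by omega), hσ2.GGG_eq], fun t4 ht4 => ⟨?_, ?_, ?_, ?_, ?_, ?_, ?_⟩⟩
    · have hcnt : (σ3.setReg 10 ((x : ℤ) + 1)).markCount n = σ3.markCount n := rfl
      rw [hcnt]
      have e1 : (x + 1) * (T1 + 12) = x * (T1 + 12) + (T1 + 12) := by ring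
      rcases htime with h | ⟨h, i, k, j, hu, h0, h1⟩
      · have := Nat.mul_le_mul_right T2 (RamState.markCount_mono (n := n) hmono)
        omega
      · obtain ⟨z0, z1⟩ := Int.cell_lt hu.1 hu.2.1 hu.2.2.2.2.1 hu.2.2.2.2.2.1
        have := Nat.mul_le_mul_right T2 (RamState.markCount_lt hmono z0 z1 h0 h1)
        rw [Nat.succ_eq_add_one, add_mul, one_mul] at this
        omega
    · intro r hr
      rw [RamState.setReg_reg_of_ne _ (by omega), hr3 _ (by omega), hr2 _ hr]
    · intro A hA h5
      rw [RamState.setReg_mem, hl3 A hA h5, hl2 A hA h5]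
    · rw [RamState.setReg_reg_of_ne _ (by omega), hc3, hc2]; push_cast; ring
    · intro A y
      rw [RamState.setReg_reg_of_ne _ (by omega), RamState.setReg_mem]; exact hst3 A y
    · intro z h0 h1
      rw [RamState.setReg_mem]
      rcases hch z with h | h
      · rw [h]; exact hm2 z h0 h1
      · exact .inr h
    · intro i k j hu hlt
      rw [RamState.setReg_mem]
      push_cast at hlt
      rcases lt_or_eq_of_le (Int.lt_add_one_iff.mp hlt) with h | h
      · exact hmono _ (hcomp2 i k j hu h)
      · obtain ⟨z0, z1⟩ := Int.cell_lt hu.1 hu.2.1 hu.2.2.2.2.1 hu.2.2.2.2.2.1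
        rcases hm2 _ z0 z1 with h' | h'
        · exact hcomp i k j hu h h'
        · exact hmono _ h'.1
  · rintro σ' t t' ht' - - ⟨ht, hr, hl, hc, hst, hm, hcomp⟩
    refine hQ σ' _ ?_ hr hl hc hst ?_
    · have h1 := Nat.mul_le_mul_right T2 (σ'.markCount_le n)
      have h2 : n * n * T2 = 10000 * (n * n * (s * s * s)) := by rw [hT2]; ring
      have hss : 1 ≤ s * s := Nat.mul_le_mul hs hs
      have hnn : 1 ≤ n * n := Nat.mul_le_mul hn hn
      have hnns : n * n ≤ n * n * (s * s * s) :=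
        Nat.le_mul_of_pos_right _ (Nat.mul_pos hss hs)
      have h3 : G * G * G * (T1 + 12) ≤ G * G * G * (4 * τ + P.width + 200100 * (s * s)) :=
        Nat.mul_le_mul_left _ (by omega)
      have h4 : t1 ≤ (n * n + 1) * 21 := ht1
      rw [markTime]
      omega
    · intro i j i0 i1 j0 j1
      obtain ⟨z0, z1⟩ := Int.cell_lt i0 i1 j0 j1
      have hmark : ∀ k, σ.Undercuts n p i k j → σ'.mem 5 (i * n + j) = 1 := fun k hu => by
        refine hcomp i k j hu ?_
        have hlt : ∀ i : ℤ, i < n → i / s < G := fun i hi =>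
          Int.ediv_lt_of_lt_mul hs0 (by linarith)
        obtain ⟨-, d, -⟩ := Int.digits_of_triple (s := G) (Int.ediv_nonneg i0 hs0.le)
          (hlt i i1) (Int.ediv_nonneg hu.2.2.1 hs0.le) (hlt k hu.2.2.2.1)
          (Int.ediv_nonneg j0 hs0.le) (hlt j j1)
        push_cast
        exact d
      rcases hm _ z0 z1 with h | ⟨h, i', k', j', hu, hz⟩
      · refine .inr ⟨h, fun k hu => ?_⟩
        rw [hmark k hu] at h
        exact absurd h (by norm_num)
      · obtain ⟨rfl, rfl⟩ := Int.cell_inj j0 j1 hu.2.2.2.2.1 hu.2.2.2.2.2.1 hz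
        exact .inl ⟨h, k', hu⟩

/-! ### The min-plus product by simultaneous binary search -/

theorem Int.exists_cell_eq {n x : ℤ} (hn : 0 < n) (h0 : 0 ≤ x) (h1 : x < n * n) :
    ∃ i j, 0 ≤ i ∧ i < n ∧ 0 ≤ j ∧ j < n ∧ i * n + j = x :=
  ⟨x / n, x % n, Int.ediv_nonneg h0 hn.le, Int.ediv_lt_of_lt_mul hn h1, Int.emod_nonneg _ hn.ne',
    Int.emod_lt_of_pos _ hn, Int.ediv_mul_add_emod _ _⟩

/-- One round of the binary search: the thresholds in bank `4` that are not undercut are raised by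
the step width in variable `11`, which is then halved. -/
def searchRound (P : RamProgram) : RamProgram :=
  .seq (markProgram P) <|
  .seq (.fill 2 6 21 (.bin .add (.ld 4 (.var 2))
    (.bin .mul (.var 11) (.bin .sub (.const 1) (.ld 5 (.var 2)))))) <|
  .seq (.fill 2 4 21 (.ld 6 (.var 2))) (.assign 11 (.bin .div (.var 11) (.const 2)))

/-- Replace the matrix in bank `3` by its min-plus square. -/
def squareProgram (P : RamProgram) : RamProgram :=
  .seq (.fill 2 4 21 (.bin .sub (.const 0) (.var 31))) <|
  .seq (.assign 11 (.var 32)) <|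
  .seq (.whileE (.var 11) (searchRound P)) (.fill 2 3 21 (.ld 4 (.var 2)))

theorem le_markTime {n s G τ W : ℕ} (hs : 1 ≤ s) : 20000 * (n * n) ≤ markTime n s G τ W := by
  have : n * n ≤ n * n * (s * s * s) :=
    Nat.le_mul_of_pos_right _ (Nat.mul_pos (Nat.mul_pos hs hs) hs)
  rw [markTime]
  omega

/-- The invariant is `v ≤ m < v + 2 ^ (l + 1)`. A pair is marked exactly if `m < v + 2 ^ l`; then
`v` stays, otherwise it rises by `2 ^ l`, and the gap is halved either way. The bound `3 * Z` for
the block weights comes from `|v| ≤ Z` and a step width of at most `2 * Z`. -/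
theorem achieves_searchRound {X D B τ n s G Z : ℕ} {P : RamProgram} {σ : RamState}
    {Q : RamState → ℕ → Prop} {l : ℕ} {m : ℤ → ℤ → ℤ} (hX : 2 ≤ X) (hD : 5000 ≤ D) (hB : B ≤ X)
    (hP : DecidesTriangle P (3 * s) (2 * (3 * Z)) B τ) (hn : 1 ≤ n) (hs : 1 ≤ s)
    (hσ : HoldsParams n s G (3 * Z) σ) (hG : n ≤ s * G) (hsG : s * G ≤ X)
    (hp : σ.reg 11 = 2 ^ l) (hl : 2 ^ l ≤ 2 * (Z : ℤ))
    (hcur : σ.reg 1 + (G * G * G : ℕ) ≤ X) (hcur0 : 0 ≤ σ.reg 1)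
    (hd : ∀ i j : ℤ, 0 ≤ i → i < n → 0 ≤ j → j < n → |σ.mem 3 (i * n + j)| ≤ Z)
    (hm : ∀ i j : ℤ, 0 ≤ i → i < n → 0 ≤ j → j < n → m i j ≤ Z ∧
      (∀ k : ℤ, 0 ≤ k → k < n → m i j ≤ σ.mem 3 (i * n + k) + σ.mem 3 (k * n + j)) ∧
      ∃ k : ℤ, 0 ≤ k ∧ k < n ∧ m i j = σ.mem 3 (i * n + k) + σ.mem 3 (k * n + j))
    (hv : ∀ i j : ℤ, 0 ≤ i → i < n → 0 ≤ j → j < n → -(Z : ℤ) ≤ σ.mem 4 (i * n + j) ∧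
      σ.mem 4 (i * n + j) ≤ m i j ∧ m i j < σ.mem 4 (i * n + j) + 2 ^ (l + 1))
    (hstamp : ∀ A x, σ.mem (9 + 2 * A) x ≤ σ.reg 1)
    (hQ : ∀ (σ' : RamState) (t : ℕ), t + 3 ≤ 2 * markTime n s G τ P.width →
      (∀ r, 12 ≤ r → σ'.reg r = σ.reg r) → σ'.reg 11 = 2 ^ l / 2 →
      (∀ A < 4, σ'.mem A = σ.mem A) → σ'.reg 1 = σ.reg 1 + (G * G * G : ℕ) →
      (∀ A x, σ'.mem (9 + 2 * A) x ≤ σ'.reg 1) →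
      (∀ i j : ℤ, 0 ≤ i → i < n → 0 ≤ j → j < n → -(Z : ℤ) ≤ σ'.mem 4 (i * n + j) ∧
        σ'.mem 4 (i * n + j) ≤ m i j ∧ m i j < σ'.mem 4 (i * n + j) + 2 ^ l) → Q σ' t) :
    Achieves X D (searchRound P) σ Q := by
  refine .of_bounded fun hbdd => ?_
  have hregX : ∀ {r m : ℕ}, σ.reg r = m → m ≤ X := fun {r m} h => by
    have := (le_abs_self _).trans (hbdd.1 r); rw [h] at this; exact_mod_cast this
  have hn0 : (0 : ℤ) < n := by exact_mod_cast hn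
  have h2l : (0 : ℤ) < 2 ^ l := by positivity
  have hRX : 2 * (3 * (Z : ℤ)) ≤ X := by
    have := (le_abs_self _).trans (hbdd.1 28); rw [hσ.big_eq] at this; push_cast at this; linarith
  have hZ0 : (0 : ℤ) ≤ Z := by positivity
  refine .seq (achieves_markProgram (p := 2 ^ l) hX hD hB hP hn hs hσ hG hsG hp hcur hcur0 ?_ ?_ hstamp ?_)
  · intro i j i0 i1 j0 j1
    exact (hd i j i0 i1 j0 j1).trans (by push_cast; linarith)
  · intro i j i0 i1 j0 j1
    obtain ⟨h1, h2, h3⟩ := hv i j i0 i1 j0 j1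
    have := (hm i j i0 i1 j0 j1).1
    rw [abs_le]
    push_cast
    constructor <;> linarith
  intro σ1 t1 ht1 hr1 hl1 hc1 hst1 hmark
  have a11 : σ1.reg 11 = 2 ^ l := by rw [hr1 _ (by omega), hp]
  have m4 : σ1.mem 4 = σ.mem 4 := hl1 4 (by omega) (by omega)
  -- The mark in bank `5` is `0` or `1`, so the case distinction becomes a product.
  have hval : ∀ x : ℤ, (RamExpr.bin .add (.ld 4 (.var 2)) (.bin .mul (.var 11)
      (.bin .sub (.const 1) (.ld 5 (.var 2))))).eval (σ1.setReg 2 x) =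
      σ.mem 4 x + 2 ^ l * (1 - σ1.mem 5 x) := fun x => by
    rw [RamExpr.eval_add, RamExpr.eval_mul, RamExpr.eval_sub, RamExpr.eval_ld, RamExpr.eval_ld,
      RamExpr.eval_var, RamExpr.eval_var, RamExpr.eval_const, RamState.setReg_reg_self,
      RamState.setReg_reg_of_ne _ (by omega), a11, RamState.setReg_mem, m4]
  have hnew : ∀ i j : ℤ, 0 ≤ i → i < n → 0 ≤ j → j < n →
      -(Z : ℤ) ≤ σ.mem 4 (i * n + j) + 2 ^ l * (1 - σ1.mem 5 (i * n + j)) ∧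
      σ.mem 4 (i * n + j) + 2 ^ l * (1 - σ1.mem 5 (i * n + j)) ≤ m i j ∧
      m i j < σ.mem 4 (i * n + j) + 2 ^ l * (1 - σ1.mem 5 (i * n + j)) + 2 ^ l := by
    intro i j i0 i1 j0 j1
    obtain ⟨h1, h2, h3⟩ := hv i j i0 i1 j0 j1
    obtain ⟨h4, h5, k, k0, k1, hk⟩ := hm i j i0 i1 j0 j1
    rw [pow_succ] at h3
    rcases hmark i j i0 i1 j0 j1 with ⟨h, k', hu⟩ | ⟨h, hu⟩
    · have := h5 k' hu.2.2.1 hu.2.2.2.1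
      have := hu.2.2.2.2.2.2
      rw [h, sub_self, mul_zero, add_zero]
      exact ⟨h1, h2, by linarith⟩
    · have : ¬ (σ.mem 3 (i * n + k) + σ.mem 3 (k * n + j) < σ.mem 4 (i * n + j) + 2 ^ l) :=
        fun hlt => hu k ⟨i0, i1, k0, k1, j0, j1, hlt⟩
      rw [h, sub_zero, mul_one]
      exact ⟨by linarith, by linarith, by linarith⟩
  -- Bank `6` is a buffer, because a bank must not be read by the expression that fills it.
  refine .seq (.fill hX (n := n * n) (by omega) ((by decide +kernel : _ ≤ 5000).trans hD)
    (by decide +kernel) (by omega) (by rw [hr1 _ (by omega), hσ.nn_eq]) (hregX hσ.nn_eq) ?_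
    fun t2 ht2 => ?_)
  · intro x x0 x1
    rw [hval]
    obtain ⟨i, j, i0, i1, j0, j1, rfl⟩ := Int.exists_cell_eq hn0 x0 (by push_cast at x1; exact x1)
    obtain ⟨h1, h2, h3⟩ := hnew i j i0 i1 j0 j1
    have := (hm i j i0 i1 j0 j1).1
    rw [abs_le]
    constructor <;> linarith
  simp only [hval]
  generalize hσ2 : σ1.filled 2 6 (n * n) _ = σ2
  have r2 : ∀ r, r ≠ 2 → σ2.reg r = σ1.reg r := fun r hr => by
    rw [← hσ2, RamState.filled_reg_of_ne hr]
  have m2 : ∀ A, A ≠ 6 → σ2.mem A = σ1.mem A := fun A hA => by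
    rw [← hσ2, RamState.filled_mem_of_ne hA]
  have m6 : ∀ z : ℤ, 0 ≤ z → z < n * n →
      σ2.mem 6 z = σ.mem 4 z + 2 ^ l * (1 - σ1.mem 5 z) := fun z h0 h1 => by
    rw [← hσ2, RamState.filled_mem_self]
    simp only
    rw [if_pos ⟨h0, by push_cast; exact h1⟩]
  clear hσ2
  refine .of_bounded fun hbdd2 => .seq (.fill hX (n := n * n) (by omega)
    ((by decide +kernel : _ ≤ 5000).trans hD)
    (by decide +kernel) (by omega) (by rw [r2 _ (by omega), hr1 _ (by omega), hσ.nn_eq])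
    (hregX hσ.nn_eq) ?_ fun t3 ht3 => ?_)
  · intro x x0 x1
    exact hbdd2.2 _ _
  generalize hσ3 : σ2.filled 2 4 (n * n) _ = σ3
  have r3 : ∀ r, r ≠ 2 → σ3.reg r = σ1.reg r := fun r hr => by
    rw [← hσ3, RamState.filled_reg_of_ne hr, r2 r hr]
  have m3 : ∀ A, A ≠ 4 → A ≠ 6 → σ3.mem A = σ1.mem A := fun A hA h6 => by
    rw [← hσ3, RamState.filled_mem_of_ne hA, m2 A h6]
  have m4' : ∀ z : ℤ, 0 ≤ z → z < n * n →
      σ3.mem 4 z = σ.mem 4 z + 2 ^ l * (1 - σ1.mem 5 z) := fun z h0 h1 => by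
    rw [← hσ3, RamState.filled_mem_self]
    simp only
    rw [if_pos ⟨h0, by push_cast; exact h1⟩, RamExpr.eval_ld, RamExpr.eval_var,
      RamState.setReg_reg_self, RamState.setReg_mem, m6 z h0 h1]
  clear hσ3
  have hdiv : (RamExpr.bin .div (.var 11) (.const 2)).eval σ3 = 2 ^ l / 2 := by
    rw [RamExpr.eval_div, RamExpr.eval_var, RamExpr.eval_const, r3 _ (by omega), a11]
  refine .assign hX ((by decide +kernel : _ ≤ 5000).trans hD) ?_ (by omega) fun t4 ht4 => ?_
  · rw [hdiv, abs_of_nonneg (by positivity)]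
    have : (2 : ℤ) ^ l / 2 ≤ 2 ^ l := Int.ediv_le_self _ h2l.le
    linarith
  rw [hdiv]
  refine hQ _ _ ?_ ?_ ?_ ?_ ?_ ?_ ?_
  · have := le_markTime (n := n) (G := G) (τ := τ) (W := P.width) hs
    have hnn : 1 ≤ n * n := Nat.mul_le_mul hn hn
    simp only [RamExpr.cost] at ht2 ht3 ht4
    omega
  · intro r hr
    rw [RamState.setReg_reg_of_ne _ (by omega), r3 _ (by omega), hr1 _ (by omega)]
  · rw [RamState.setReg_reg_self]
  · intro A hA
    rw [RamState.setReg_mem, m3 A (by omega) (by omega), hl1 A (by omega) (by omega)]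
  · rw [RamState.setReg_reg_of_ne _ (by omega), r3 _ (by omega), hc1]
  · intro A x
    rw [RamState.setReg_reg_of_ne _ (by omega), r3 _ (by omega), RamState.setReg_mem,
      m3 _ (by omega) (by omega)]
    exact hst1 A x
  · intro i j i0 i1 j0 j1
    obtain ⟨z0, z1⟩ := Int.cell_lt i0 i1 j0 j1
    rw [RamState.setReg_mem, m4' _ z0 z1]
    exact hnew i j i0 i1 j0 j1

/-- The search starts from `v = -Z` with step width `2 ^ b`; the initial gap `2 ^ (b + 1)` exceeds
`2 * Z`. After `b + 1` rounds the gap is `1`, so `v = m`. Every round raises the stamp by `G ^ 3`.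
-/
theorem achieves_squareProgram {X D B τ n s G Z b : ℕ} {P : RamProgram} {σ : RamState}
    {Q : RamState → ℕ → Prop} {m : ℤ → ℤ → ℤ} (hX : 2 ≤ X) (hD : 5000 ≤ D) (hB : B ≤ X)
    (hP : DecidesTriangle P (3 * s) (2 * (3 * Z)) B τ) (hn : 1 ≤ n) (hs : 1 ≤ s)
    (hσ : HoldsParams n s G (3 * Z) σ) (hG : n ≤ s * G) (hsG : s * G ≤ X)
    (h31 : σ.reg 31 = Z) (h32 : σ.reg 32 = 2 ^ b) (hb : (Z : ℤ) < 2 ^ b) (hb' : 2 ^ b ≤ 2 * (Z : ℤ))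
    (hcur : σ.reg 1 + ((b + 1) * (G * G * G) : ℕ) ≤ X) (hcur0 : 0 ≤ σ.reg 1)
    (hd : ∀ i j : ℤ, 0 ≤ i → i < n → 0 ≤ j → j < n → |σ.mem 3 (i * n + j)| ≤ Z)
    (hm : ∀ i j : ℤ, 0 ≤ i → i < n → 0 ≤ j → j < n → |m i j| ≤ Z ∧
      (∀ k : ℤ, 0 ≤ k → k < n → m i j ≤ σ.mem 3 (i * n + k) + σ.mem 3 (k * n + j)) ∧
      ∃ k : ℤ, 0 ≤ k ∧ k < n ∧ m i j = σ.mem 3 (i * n + k) + σ.mem 3 (k * n + j))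
    (hstamp : ∀ A x, σ.mem (9 + 2 * A) x ≤ σ.reg 1)
    (hQ : ∀ (σ' : RamState) (t : ℕ), t ≤ (b + 2) * (2 * markTime n s G τ P.width) →
      (∀ r, 12 ≤ r → σ'.reg r = σ.reg r) →
      (∀ A < 3, σ'.mem A = σ.mem A) → σ'.reg 1 = σ.reg 1 + ((b + 1) * (G * G * G) : ℕ) →
      (∀ A x, σ'.mem (9 + 2 * A) x ≤ σ'.reg 1) →
      (∀ i j : ℤ, 0 ≤ i → i < n → 0 ≤ j → j < n → σ'.mem 3 (i * n + j) = m i j) → Q σ' t) :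
    Achieves X D (squareProgram P) σ Q := by
  refine .of_bounded fun hbdd => ?_
  have hregX : ∀ {r m : ℕ}, σ.reg r = m → m ≤ X := fun {r m} h => by
    have := (le_abs_self _).trans (hbdd.1 r); rw [h] at this; exact_mod_cast this
  have hZX : (Z : ℤ) ≤ X := by exact_mod_cast hregX h31
  have hval : ∀ x : ℤ, (RamExpr.bin .sub (.const 0) (.var 31)).eval (σ.setReg 2 x) = -(Z : ℤ) :=
    fun x => by
      rw [RamExpr.eval_sub, RamExpr.eval_const, RamExpr.eval_var,
        RamState.setReg_reg_of_ne _ (by omega), h31, zero_sub]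
  refine .seq (.fill hX (n := n * n) (by omega) ((by decide +kernel : _ ≤ 5000).trans hD)
    (by decide +kernel) (by omega) hσ.nn_eq (hregX hσ.nn_eq) ?_ fun t1 ht1 => ?_)
  · intro x _ _
    rw [hval, abs_neg, Nat.abs_cast]; exact hZX
  simp only [hval]
  generalize hσ1 : σ.filled 2 4 (n * n) _ = σ1
  have r1 : ∀ r, r ≠ 2 → σ1.reg r = σ.reg r := fun r hr => by
    rw [← hσ1, RamState.filled_reg_of_ne hr]
  have m1 : ∀ A, A ≠ 4 → σ1.mem A = σ.mem A := fun A hA => by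
    rw [← hσ1, RamState.filled_mem_of_ne hA]
  have m4 : ∀ z : ℤ, 0 ≤ z → z < n * n → σ1.mem 4 z = -(Z : ℤ) := fun z h0 h1 => by
    rw [← hσ1, RamState.filled_mem_self]
    simp only
    rw [if_pos ⟨h0, by push_cast; exact h1⟩]
  clear hσ1
  have a32 : (RamExpr.var 32).eval σ1 = 2 ^ b := by rw [RamExpr.eval_var, r1 _ (by omega), h32]
  refine .seq (.assign hX (by simp [RamExpr.deg]; omega) ?_ (by omega) fun t2 ht2 => ?_)
  · rw [RamExpr.eval_var, r1 _ (by omega)]; exact hbdd.1 _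
  rw [a32]
  set T := 2 * markTime n s G τ P.width with hT
  refine .seq (.whileE hX (by simp [RamExpr.deg]; omega)
    (fun k σ' t => t ≤ k * T ∧ (∀ r, 12 ≤ r → σ'.reg r = σ.reg r) ∧
      (∀ A < 4, σ'.mem A = σ.mem A) ∧ σ'.reg 1 = σ.reg 1 + (k * (G * G * G) : ℕ) ∧
      (∀ A x, σ'.mem (9 + 2 * A) x ≤ σ'.reg 1) ∧ σ'.reg 11 = 2 ^ b / 2 ^ k ∧
      ∀ i j : ℤ, 0 ≤ i → i < n → 0 ≤ j → j < n → -(Z : ℤ) ≤ σ'.mem 4 (i * n + j) ∧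
        σ'.mem 4 (i * n + j) ≤ m i j ∧ m i j < σ'.mem 4 (i * n + j) + 2 ^ (b + 1 - k))
    (b + 1) ?_ ?_ ?_ ?_)
  · refine ⟨by omega, fun r hr => ?_, fun A hA => ?_, ?_, fun A x => ?_, ?_, ?_⟩
    · rw [RamState.setReg_reg_of_ne _ (by omega), r1 _ (by omega)]
    · rw [RamState.setReg_mem, m1 _ (by omega)]
    · rw [RamState.setReg_reg_of_ne _ (by omega), r1 _ (by omega)]; simp
    · rw [RamState.setReg_reg_of_ne _ (by omega), RamState.setReg_mem, r1 _ (by omega),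
        m1 _ (by omega)]
      exact hstamp A x
    · rw [RamState.setReg_reg_self]; simp
    · intro i j i0 i1 j0 j1
      obtain ⟨z0, z1⟩ := Int.cell_lt i0 i1 j0 j1
      have := abs_le.mp (hm i j i0 i1 j0 j1).1
      rw [RamState.setReg_mem, m4 _ z0 z1, Nat.sub_zero, pow_succ]
      exact ⟨le_rfl, this.1, by linarith⟩
  · rintro k hk σ2 t ⟨ht, hr2, hl2, hc2, hst2, hp2, hv2⟩
    obtain ⟨l, rfl⟩ : ∃ l, b = k + l := ⟨b - k, by omega⟩
    have e1 : (2 : ℤ) ^ (k + l) / 2 ^ k = 2 ^ l := by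
      rw [pow_add]; exact Int.mul_ediv_cancel_left _ (by positivity)
    have e2 : k + l + 1 - k = l + 1 := by omega
    have e3 : k + l + 1 - (k + 1) = l := by omega
    have e4 : (2 : ℤ) ^ (k + l) / 2 ^ (k + 1) = 2 ^ l / 2 := by
      rw [pow_succ, ← Int.ediv_ediv_of_nonneg (by positivity), e1]
    rw [e1] at hp2
    rw [e2] at hv2
    refine ⟨by rw [RamExpr.eval_var, hp2]; positivity, ?_⟩
    have hle : (2 : ℤ) ^ l ≤ 2 ^ (k + l) := pow_le_pow_right₀ (by norm_num) (by omega)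
    have hkG : ((k * (G * G * G) : ℕ) : ℤ) + (G * G * G : ℕ) ≤ ((k + l + 1) * (G * G * G) : ℕ) := by
      have : k * (G * G * G) + G * G * G ≤ (k + l + 1) * (G * G * G) := by
        rw [← Nat.succ_mul]; exact Nat.mul_le_mul_right _ (by omega)
      exact_mod_cast this
    refine achieves_searchRound (m := m) hX hD hB hP hn hs (hσ.congr fun r _ _ => hr2 r (by omega)) hG hsG
      hp2 (hle.trans hb') (by rw [hc2]; linarith) (by rw [hc2]; positivity)
      (by rw [hl2 3 (by omega)]; exact hd) ?_ hv2 hst2 ?_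
    · intro i j i0 i1 j0 j1
      rw [hl2 3 (by omega)]
      exact ⟨(abs_le.mp (hm i j i0 i1 j0 j1).1).2, (hm i j i0 i1 j0 j1).2⟩
    · intro σ3 t3 ht3 hr3 hp3 hl3 hc3 hst3 hv3 t4 ht4
      simp only [RamExpr.cost] at ht4
      refine ⟨?_, fun r hr => by rw [hr3 r hr, hr2 r hr], fun A hA => by rw [hl3 A hA, hl2 A hA],
        ?_, hst3, by rw [hp3, e4], by rw [e3]; exact hv3⟩
      · rw [add_mul, one_mul]; omega
      · rw [hc3, hc2]; push_cast; ring
  -- After the round with step width `1` the halved width is `0`, which ends the loop.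
  · rintro σ2 t ⟨-, -, -, -, -, hp2, -⟩
    rw [RamExpr.eval_var, hp2]
    exact Int.ediv_eq_zero_of_lt (by positivity) (pow_lt_pow_right₀ (by norm_num) (by omega))
  · rintro σ2 t t3 ht3 ⟨ht, hr2, hl2, hc2, hst2, hp2, hv2⟩
    rw [Nat.sub_self, pow_zero] at hv2
    refine .of_bounded fun hbdd2 => .fill hX (n := n * n) (by omega)
      ((by decide +kernel : _ ≤ 5000).trans hD)
      (by decide +kernel) (by omega) (by rw [hr2 _ (by omega), hσ.nn_eq])
      (hregX hσ.nn_eq) (fun x x0 x1 => hbdd2.2 _ _) fun t4 ht4 => ?_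
    refine hQ _ _ ?_ ?_ ?_ ?_ ?_ ?_
    · have := le_markTime (n := n) (G := G) (τ := τ) (W := P.width) hs
      have hnn : 1 ≤ n * n := Nat.mul_le_mul hn hn
      simp only [RamExpr.cost] at ht1 ht2 ht3 ht4
      have e : (b + 2) * T = (b + 1) * T + T := by ring
      omega
    · intro r hr
      rw [RamState.filled_reg_of_ne (by omega), hr2 r hr]
    · intro A hA
      rw [RamState.filled_mem_of_ne (by omega), hl2 A (by omega)]
    · rw [RamState.filled_reg_of_ne (by omega), hc2]
    · intro A x
      rw [RamState.filled_mem_of_ne (by omega), RamState.filled_reg_of_ne (by omega)]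
      exact hst2 A x
    · intro i j i0 i1 j0 j1
      obtain ⟨z0, z1⟩ := Int.cell_lt i0 i1 j0 j1
      obtain ⟨-, h1, h2⟩ := hv2 i j i0 i1 j0 j1
      rw [RamState.filled_mem_self]
      simp only
      rw [if_pos ⟨z0, by push_cast; exact z1⟩, RamExpr.eval_ld, RamExpr.eval_var,
        RamState.setReg_reg_self, RamState.setReg_mem]
      omega

/-! ### The program for All Pairs Shortest Paths -/

theorem RamState.setReg_setReg (σ : RamState) (r : ℕ) (a b : ℤ) :
    (σ.setReg r a).setReg r b = σ.setReg r b := by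
  simp [RamState.setReg]

theorem Achieves.assignNat {X D : ℕ} {σ : RamState} {Q : RamState → ℕ → Prop} (hX : 2 ≤ X) {v : ℕ}
    {e : RamExpr} (hD : 5000 ≤ D) (he : e.deg ≤ 5000) (z : ℕ) (hev : e.eval σ = z) (hz : z ≤ X)
    (h : ∀ t, t ≤ e.cost + 2 → Q (σ.setReg v z) t) : Achieves X D (.assign v e) σ Q := by
  refine .assign hX (he.trans hD) ?_ (by omega) ?_
  · rw [hev, Nat.abs_cast]; exact_mod_cast hz
  · rw [hev]; exact h

/-- A loop that steps a variable through a sequence of natural numbers. -/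
theorem Achieves.iterate {X D : ℕ} {σ : RamState} {Q : RamState → ℕ → Prop} (hX : 2 ≤ X) {v : ℕ}
    {e₀ c e : RamExpr} (hD : 5000 ≤ D) (hd₀ : e₀.deg ≤ 5000) (hdc : c.deg ≤ 5000)
    (hd : e.deg ≤ 5000) (f : ℕ → ℕ) (N : ℕ) (h₀ : e₀.eval σ = f 0) (hf : ∀ k ≤ N, f k ≤ X)
    (hc : ∀ k < N, c.eval (σ.setReg v (f k)) ≠ 0) (hcN : c.eval (σ.setReg v (f N)) = 0)
    (he : ∀ k < N, e.eval (σ.setReg v (f k)) = f (k + 1))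
    (hQ : ∀ t, t ≤ e₀.cost + 2 + (N + 1) * (c.cost + e.cost + 3) → Q (σ.setReg v (f N)) t) :
    Achieves X D (.seq (.assign v e₀) (.whileE c (.assign v e))) σ Q := by
  refine .seq (.assignNat hX hD hd₀ (f 0) h₀ (hf 0 (by omega)) fun t0 ht0 => ?_)
  refine .whileE hX (hdc.trans hD)
    (fun k σ' t => σ' = σ.setReg v (f k) ∧ t ≤ k * (c.cost + e.cost + 3)) N ⟨rfl, by omega⟩ ?_ ?_ ?_
  · rintro k hk σ' t ⟨rfl, ht⟩
    refine ⟨hc k hk, .assignNat hX hD hd (f (k + 1)) (he k hk) (hf _ hk) fun t1 ht1 t2 ht2 =>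
      ⟨RamState.setReg_setReg _ _ _ _, ?_⟩⟩
    rw [add_mul, one_mul]; omega
  · rintro σ' t ⟨rfl, -⟩
    exact hcN
  · rintro σ' t t' ht' ⟨rfl, ht⟩
    refine hQ _ ?_
    rw [add_mul, one_mul]; omega

/-- The fourth power of the successor of variable `22`. -/
def RamExpr.fourthPowerE : RamExpr :=
  let q := bin .mul (bin .add (var 22) (const 1)) (bin .add (var 22) (const 1))
  bin .mul q q

/-- The computation of the constants for the shortest path program. -/
def distanceSetup : RamProgram :=
  .seq (.assign 20 (.ld 0 (.const 0))) <|
  .seq (.assign 21 (.bin .mul (.var 20) (.var 20))) <|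
  .seq (.forLoop 2 21 (.assign 33 (.maxE (.var 33) (.absE (.ld 1 (.var 2)))))) <|
  .seq (.assign 34 (.bin .add (.bin .mul (.bin .mul (.const 4) (.var 20)) (.var 33)) (.const 1))) <|
  .seq (.assign 31 (.bin .mul (.bin .mul (.const 2) (.var 20)) (.var 34))) <|
  .seq (.assign 28 (.bin .mul (.const 6) (.var 31))) <|
  .seq (.seq (.assign 22 (.const 0)) (.whileE (.bin .lt .fourthPowerE (.bin .add (.var 20) (.const 1)))
    (.assign 22 (.bin .add (.var 22) (.const 1))))) <|
  .seq (.assign 23 (.bin .mul (.const 3) (.var 22))) <|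
  .seq (.assign 24 (.bin .mul (.var 23) (.var 23))) <|
  .seq (.assign 25 (.bin .mul (.bin .mul (.var 22) (.var 22)) (.var 22))) <|
  .seq (.assign 26 (.bin .add (.bin .div (.var 20) (.var 22)) (.const 1))) <|
  .seq (.assign 27 (.bin .mul (.bin .mul (.var 26) (.var 26)) (.var 26))) <|
  .seq (.assign 29 (.const 1)) <|
  .seq (.assign 32 (.const 1)) (.whileE (.bin .lt (.var 32) (.bin .add (.var 31) (.const 1)))
    (.assign 32 (.bin .mul (.const 2) (.var 32))))

/-- A bound on the entries of all matrices of distances. -/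
def distanceBound (n M : ℕ) : ℕ := 2 * n * (4 * n * M + 1)

theorem Nat.exists_fourth_root (n : ℕ) : ∃ s, s ^ 4 ≤ n ∧ n < (s + 1) ^ 4 := by
  refine ⟨(n.sqrt).sqrt, ?_, ?_⟩
  · calc (n.sqrt).sqrt ^ 4 = ((n.sqrt).sqrt ^ 2) ^ 2 := by ring
      _ ≤ n.sqrt ^ 2 := Nat.pow_le_pow_left (Nat.sqrt_le' _) 2
      _ ≤ n := Nat.sqrt_le' _
  · calc n < (n.sqrt + 1) ^ 2 := Nat.lt_succ_sqrt' _
      _ ≤ (((n.sqrt).sqrt + 1) ^ 2) ^ 2 := Nat.pow_le_pow_left (Nat.lt_succ_sqrt' _) 2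
      _ = _ := by ring

theorem ShortestPathsInstance.mem_arc (I : ShortestPathsInstance) (u v : Fin I.n) :
    (RamState.init (allPairsShortestPaths.input I)).mem 1 ((u : ℕ) * (I.n : ℤ) + (v : ℕ)) =
      (I.arc u v).getD 0 :=
  init_mem_rowMajor (input := allPairsShortestPaths.input I) (A := 1)
    (f := fun u v => (I.arc u v).getD 0) rfl u v

theorem ShortestPathsInstance.mem_adj (I : ShortestPathsInstance) (u v : Fin I.n) :
    (RamState.init (allPairsShortestPaths.input I)).mem 2 ((u : ℕ) * (I.n : ℤ) + (v : ℕ)) =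
      if (I.arc u v).isSome then 1 else 0 :=
  init_mem_rowMajor (input := allPairsShortestPaths.input I) (A := 2)
    (f := fun u v => if (I.arc u v).isSome then 1 else 0) rfl u v

theorem Fin.cell_lt {n : ℕ} (u v : Fin n) :
    0 ≤ ((u : ℕ) * (n : ℤ) + (v : ℕ)) ∧ ((u : ℕ) * (n : ℤ) + (v : ℕ)) < n * n :=
  Int.cell_lt (by positivity) (by exact_mod_cast u.2) (by positivity) (by exact_mod_cast v.2)

/-- The largest weight `m` is read off from the input, since `M` is not given; the block size `s` is
found by trying successive integers and `2 ^ b` by doubling. As `s ≤ n`, everything but the `b`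
doublings takes quadratic time. -/
theorem achieves_distanceSetup {X D M : ℕ} {I : ShortestPathsInstance} {Q : RamState → ℕ → Prop}
    (hM : allPairsShortestPaths.WeightsBoundedBy I M) (hX : 1000 * (I.n ^ 6 * (M + 1)) ≤ X)
    (hD : 5000 ≤ D)
    (hQ : ∀ (σ : RamState) (t m s b : ℕ), t ≤ 2000 * (I.n * I.n) + 100 * (b + 1) → m ≤ M →
      (∀ u v a, I.arc u v = some a → |a| ≤ (m : ℤ)) → 1 ≤ s → s ^ 4 ≤ I.n → I.n < (s + 1) ^ 4 →
      distanceBound I.n m < 2 ^ b → 2 ^ b ≤ 2 * distanceBound I.n m →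
      σ.mem = (RamState.init (allPairsShortestPaths.input I)).mem → σ.reg 1 = 0 →
      HoldsParams I.n s (I.n / s + 1) (3 * distanceBound I.n m) σ →
      σ.reg 31 = distanceBound I.n m → σ.reg 32 = 2 ^ b → σ.reg 33 = m →
      σ.reg 34 = 4 * I.n * m + 1 → Q σ t) :
    Achieves X D distanceSetup (.init (allPairsShortestPaths.input I)) Q := by
  have hn := I.n_pos
  have hpow : ∀ e, 1 ≤ I.n ^ e := fun e => Nat.one_le_pow _ _ hn
  have hpow' : ∀ e ≤ 6, I.n ^ e ≤ I.n ^ 6 := fun e he => Nat.pow_le_pow_right hn he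
  have hn6 : I.n ^ 6 ≤ I.n ^ 6 * (M + 1) := Nat.le_mul_of_pos_right _ (by omega)
  have hX1 : 1000 * I.n ^ 6 ≤ X := by omega
  have hX2 : 2 ≤ X := by have := hpow 6; omega
  have hnX : I.n ≤ X := by have := hpow' 1 (by omega); rw [pow_one] at this; omega
  have hnnX : I.n * I.n ≤ X := by have := hpow' 2 (by omega); rw [sq] at this; omega
  set σ0 := RamState.init (allPairsShortestPaths.input I) with hσ0
  have h0 : σ0.mem 0 0 = I.n := by simp [hσ0, RamState.init, allPairsShortestPaths]
  have hr0 : ∀ r, σ0.reg r = 0 := fun r => rfl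
  refine .seq (.assignNat hX2 hD (by decide) I.n h0 hnX fun t1 ht1 => ?_)
  refine .seq (.assignNat hX2 hD (by decide) (I.n * I.n)
    (by simp [RamExpr.eval, ArithOp.toWordOp, WordOp.eval, RamState.setReg]) hnnX fun t2 ht2 => ?_)
  refine .seq (.maxLoop hX2 (by omega) (n := I.n * I.n) (by omega) (by omega) (by omega)
    (RamState.setReg_reg_self _ _ _) (by omega)
    (by simp [RamState.setReg, hσ0, RamState.init]) ?_)
  intro σ t3 m ht3 hmem h33 hreg hm1 hm2
  rw [RamState.setReg_mem, RamState.setReg_mem] at hmem hm1 hm2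
  have r20 : σ.reg 20 = I.n := by
    rw [hreg 20 (by omega) (by omega)]; simp [RamState.setReg]
  have r21 : σ.reg 21 = (I.n * I.n : ℕ) := by
    rw [hreg 21 (by omega) (by omega)]; simp [RamState.setReg]
  have r1 : σ.reg 1 = 0 := by
    rw [hreg 1 (by omega) (by omega)]; simp [RamState.setReg, hr0]
  clear hreg
  have hmM : m ≤ M := by
    refine hm2 M fun x _ _ => init_mem_induction (p := fun z => |z| ≤ (M : ℤ)) (by simp)
      (forall_mem_rowMajor (f := fun u v => (I.arc u v).getD 0) fun i j => ?_) x
    cases h : I.arc i j with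
    | none => simp
    | some a => exact hM i j a h
  have hIm : ∀ u v a, I.arc u v = some a → |a| ≤ (m : ℤ) := by
    intro u v a ha
    obtain ⟨z0, z1⟩ := Fin.cell_lt u v
    have := hm1 _ z0 (by push_cast; exact z1)
    rwa [hσ0, I.mem_arc, ha] at this
  clear hm1 hm2
  have hnM : ∀ e ≤ 6, I.n ^ e * (m + 1) ≤ I.n ^ 6 * (M + 1) := fun e he =>
    Nat.mul_le_mul (hpow' e he) (by omega)
  have hZ : distanceBound I.n m ≤ 8 * (I.n ^ 6 * (M + 1)) := by
    have h1 := hnM 2 (by omega)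
    have h2 : I.n ≤ I.n ^ 2 := Nat.le_self_pow (by omega) _
    have h3 : distanceBound I.n m = 8 * (I.n ^ 2 * m) + 2 * I.n := by rw [distanceBound]; ring
    rw [mul_add, mul_one] at h1
    omega
  have hZ1 : 1 ≤ distanceBound I.n m := Nat.mul_pos (Nat.mul_pos (by omega) hn) (by omega)
  have hQX : 4 * I.n * m + 1 ≤ X := by
    have : 4 * I.n * m + 1 ≤ distanceBound I.n m :=
      Nat.le_mul_of_pos_left _ (Nat.mul_pos (by omega) hn)
    omega
  set Z := distanceBound I.n m with hZdef
  refine .seq (.assignNat hX2 hD (by decide) (4 * I.n * m + 1)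
    (by simp [RamExpr.eval, ArithOp.toWordOp, WordOp.eval, r20, h33]) hQX fun t4 ht4 => ?_)
  refine .seq (.assignNat hX2 hD (by decide) Z
    (by simp [RamExpr.eval, ArithOp.toWordOp, WordOp.eval, RamState.setReg, r20, hZdef,
      distanceBound]) (by omega) fun t5 ht5 => ?_)
  refine .seq (.assignNat hX2 hD (by decide) (6 * Z)
    (by simp [RamExpr.eval, ArithOp.toWordOp, WordOp.eval, RamState.setReg]) (by omega)
    fun t6 ht6 => ?_)
  generalize hσ1 : ((σ.setReg 34 ((4 * I.n * m + 1 : ℕ) : ℤ)).setReg 31 (Z : ℤ)).setReg 28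
    ((6 * Z : ℕ) : ℤ) = σ1
  have m1 : σ1.mem = σ0.mem := by rw [← hσ1, ← hmem]; rfl
  have a1 : σ1.reg 1 = 0 := by rw [← hσ1]; simp [RamState.setReg, r1]
  have a20 : σ1.reg 20 = I.n := by rw [← hσ1]; simp [RamState.setReg, r20]
  have a21 : σ1.reg 21 = (I.n * I.n : ℕ) := by rw [← hσ1]; simp [RamState.setReg, r21]
  have a28 : σ1.reg 28 = (6 * Z : ℕ) := by rw [← hσ1]; simp [RamState.setReg]
  have a31 : σ1.reg 31 = Z := by rw [← hσ1]; simp [RamState.setReg]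
  have a33 : σ1.reg 33 = m := by rw [← hσ1]; simp [RamState.setReg, h33]
  have a34 : σ1.reg 34 = 4 * I.n * m + 1 := by rw [← hσ1]; simp [RamState.setReg]
  clear hσ1
  obtain ⟨s, hs, hs'⟩ := Nat.exists_fourth_root I.n
  have hs1 : 1 ≤ s := by
    by_contra h
    obtain rfl : s = 0 := by omega
    norm_num at hs'
    omega
  have hsn : s ≤ I.n := (Nat.le_self_pow (by omega) s).trans hs
  have e4 : ∀ k : ℕ, RamExpr.fourthPowerE.eval (σ1.setReg 22 k) = ((k + 1) ^ 4 : ℕ) := fun k => by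
    simp only [RamExpr.fourthPowerE, RamExpr.eval_mul, RamExpr.eval_add, RamExpr.eval_var,
      RamExpr.eval_const, RamState.setReg_reg_self]
    push_cast; ring
  have e20 : ∀ k : ℕ, (RamExpr.bin .add (.var 20) (.const 1)).eval (σ1.setReg 22 k) =
      ((I.n + 1 : ℕ) : ℤ) := fun k => by
    rw [RamExpr.eval_add, RamExpr.eval_var, RamExpr.eval_const,
      RamState.setReg_reg_of_ne _ (by omega), a20]
    push_cast; rfl
  refine .seq (.iterate hX2 hD (by decide) (by decide) (by decide) (fun k => k) s rfl
    (fun k hk => by omega) ?_ ?_ ?_ fun t7 ht7 => ?_)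
  · intro k hk
    rw [RamExpr.eval_lt, e4, e20, if_pos]
    · norm_num
    · have : (k + 1) ^ 4 ≤ s ^ 4 := Nat.pow_le_pow_left hk 4
      exact_mod_cast (by omega)
  · rw [RamExpr.eval_lt_eq_zero, e4, e20]
    exact_mod_cast (by omega)
  · intro k _
    rw [RamExpr.eval_add, RamExpr.eval_var, RamExpr.eval_const, RamState.setReg_reg_self]
    push_cast; rfl
  have hGn : I.n / s + 1 ≤ 2 * I.n := by have := Nat.div_le_self I.n s; omega
  set G := I.n / s + 1 with hG
  have hG3 : G * G * G ≤ 8 * I.n ^ 6 := by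
    have := hpow' 3 (by omega)
    calc G * G * G ≤ 2 * I.n * (2 * I.n) * (2 * I.n) :=
        Nat.mul_le_mul (Nat.mul_le_mul hGn hGn) hGn
      _ = 8 * I.n ^ 3 := by ring
      _ ≤ _ := by omega
  have hs3 : s * s * s ≤ I.n ^ 6 := by
    have := hpow' 3 (by omega)
    calc s * s * s ≤ I.n * I.n * I.n := Nat.mul_le_mul (Nat.mul_le_mul hsn hsn) hsn
      _ = I.n ^ 3 := by ring
      _ ≤ _ := by omega
  have hs2 : 3 * s * (3 * s) ≤ 9 * I.n ^ 6 := by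
    have := hpow' 2 (by omega)
    calc 3 * s * (3 * s) = 9 * (s * s) := by ring
      _ ≤ 9 * (I.n * I.n) := Nat.mul_le_mul_left _ (Nat.mul_le_mul hsn hsn)
      _ = 9 * I.n ^ 2 := by ring
      _ ≤ _ := by omega
  have h61 := hpow' 1 (by omega)
  rw [pow_one] at h61
  refine .seq (.assignNat hX2 hD (by decide) (3 * s)
    (by simp [RamExpr.eval, ArithOp.toWordOp, WordOp.eval, RamState.setReg]) (by omega)
    fun t8 ht8 => ?_)
  refine .seq (.assignNat hX2 hD (by decide) (3 * s * (3 * s))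
    (by simp [RamExpr.eval, ArithOp.toWordOp, WordOp.eval, RamState.setReg]) (by omega)
    fun t9 ht9 => ?_)
  refine .seq (.assignNat hX2 hD (by decide) (s * s * s)
    (by simp [RamExpr.eval, ArithOp.toWordOp, WordOp.eval, RamState.setReg]) (by omega)
    fun t10 ht10 => ?_)
  refine .seq (.assignNat hX2 hD (by decide) G
    (by simp [RamExpr.eval, ArithOp.toWordOp, WordOp.eval, RamState.setReg, a20, hG]) (by omega)
    fun t11 ht11 => ?_)
  refine .seq (.assignNat hX2 hD (by decide) (G * G * G)
    (by simp [RamExpr.eval, ArithOp.toWordOp, WordOp.eval, RamState.setReg]) (by omega)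
    fun t12 ht12 => ?_)
  refine .seq (.assignNat hX2 hD (by decide) 1 rfl (by omega) fun t13 ht13 => ?_)
  generalize hσ2 : ((((((σ1.setReg 22 (s : ℤ)).setReg 23 ((3 * s : ℕ) : ℤ)).setReg 24
    ((3 * s * (3 * s) : ℕ) : ℤ)).setReg 25 ((s * s * s : ℕ) : ℤ)).setReg 26 (G : ℤ)).setReg 27
    ((G * G * G : ℕ) : ℤ)).setReg 29 ((1 : ℕ) : ℤ) = σ2
  have m2 : σ2.mem = σ0.mem := by rw [← hσ2, ← m1]; rfl
  have b1 : σ2.reg 1 = 0 := by rw [← hσ2]; simp [RamState.setReg, a1]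
  have b31 : σ2.reg 31 = Z := by rw [← hσ2]; simp [RamState.setReg, a31]
  have b33 : σ2.reg 33 = m := by rw [← hσ2]; simp [RamState.setReg, a33]
  have b34 : σ2.reg 34 = 4 * I.n * m + 1 := by rw [← hσ2]; simp [RamState.setReg, a34]
  have hpar : HoldsParams I.n s G (3 * Z) σ2 := by
    constructor
    all_goals rw [← hσ2]; simp [RamState.setReg, a20, a21, a28]
    ring
  clear hσ2
  obtain ⟨b, hb, hb', hb''⟩ : ∃ b, Z < 2 ^ b ∧ 2 ^ b ≤ 2 * Z ∧ ∀ k < b, 2 ^ k ≤ Z := by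
    have h1 : 2 ^ Nat.log 2 Z ≤ Z := Nat.pow_log_le_self 2 (by omega)
    refine ⟨Nat.log 2 Z + 1, Nat.lt_pow_succ_log_self (by omega) Z, ?_, fun k hk => ?_⟩
    · rw [pow_succ]; omega
    · exact (Nat.pow_le_pow_right (by omega) (by omega)).trans h1
  have e31 : ∀ k : ℕ, (RamExpr.bin .lt (.var 32) (.bin .add (.var 31) (.const 1))).eval
      (σ2.setReg 32 (2 ^ k : ℕ)) = if 2 ^ k ≤ Z then 1 else 0 := fun k => by
    rw [RamExpr.eval_lt, RamExpr.eval_add, RamExpr.eval_var, RamExpr.eval_var, RamExpr.eval_const,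
      RamState.setReg_reg_self, RamState.setReg_reg_of_ne _ (by omega), b31]
    refine if_congr ?_ rfl rfl
    rw [Int.lt_add_one_iff]; norm_cast
  refine .iterate hX2 hD (by decide) (by decide) (by decide) (fun k => 2 ^ k) b rfl
    (fun k hk => ?_) ?_ ?_ ?_ fun t14 ht14 => ?_
  · have : 2 ^ k ≤ 2 ^ b := Nat.pow_le_pow_right (by omega) hk
    omega
  · intro k hk
    rw [e31, if_pos (hb'' k hk)]; norm_num
  · rw [e31, if_neg (by omega)]
  · intro k _
    rw [RamExpr.eval_mul, RamExpr.eval_var, RamExpr.eval_const, RamState.setReg_reg_self]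
    push_cast; ring
  have hne : ∀ r, r ≠ 32 → (σ2.setReg 32 ((2 ^ b : ℕ) : ℤ)).reg r = σ2.reg r := fun r hr =>
    RamState.setReg_reg_of_ne _ hr _
  refine hQ _ _ m s b ?_ hmM hIm hs1 hs hs' hb hb' m2 ((hne _ (by omega)).trans b1)
    (hpar.congr fun r _ _ => hne r (by omega)) ((hne _ (by omega)).trans b31) ?_
    ((hne _ (by omega)).trans b33) ((hne _ (by omega)).trans b34)
  · have hnn : I.n ≤ I.n * I.n := Nat.le_mul_of_pos_left _ hn
    have hc : (RamExpr.bin .lt .fourthPowerE (.bin .add (.var 20) (.const 1))).cost ≤ 60 := by decide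
    have hsc := Nat.mul_le_mul_left (s + 1) (add_le_add (add_le_add hc
      (by decide : (RamExpr.bin .add (.var 22) (.const 1)).cost ≤ 10)) (le_refl 3))
    simp only [RamExpr.cost] at ht1 ht2 ht4 ht5 ht6 ht8 ht9 ht10 ht11 ht12 ht13 ht14
    have ht7' : t7 ≤ 3 + (s + 1) * (60 + 10 + 3) := by
      refine ht7.trans ?_
      have : (RamExpr.const 0).cost = 1 := rfl
      omega
    omega
  · rw [RamState.setReg_reg_self]; push_cast; rfl

/-- A matrix as a function of integers, with the value `0` outside of its range. -/
def intMatrix {n : ℕ} (f : Fin n → Fin n → ℤ) (i j : ℤ) : ℤ :=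
  if h : (0 ≤ i ∧ i < n) ∧ 0 ≤ j ∧ j < n then f ⟨i.toNat, by omega⟩ ⟨j.toNat, by omega⟩ else 0

theorem intMatrix_natCast {n : ℕ} (f : Fin n → Fin n → ℤ) (u v : Fin n) :
    intMatrix f ((u : ℕ) : ℤ) ((v : ℕ) : ℤ) = f u v := by
  have hu := u.2
  have hv := v.2
  rw [intMatrix, dif_pos (by omega)]
  simp

theorem Int.exists_fin_eq {n : ℕ} {i : ℤ} (h0 : 0 ≤ i) (h1 : i < n) :
    ∃ u : Fin n, i = ((u : ℕ) : ℤ) :=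
  ⟨⟨i.toNat, by omega⟩, by simp [Int.toNat_of_nonneg h0]⟩

/-- The entry with index `var 2` of `ShortestPathsInstance.arcMatrix`. -/
def RamExpr.arcMatrixE : RamExpr :=
  ite (bin .eq (bin .div (var 2) (var 20)) (bin .mod (var 2) (var 20))) (const 0)
    (ite (ld 2 (var 2)) (ld 1 (var 2)) (var 34))

/-- The program for All Pairs Shortest Paths, given a program for Negative Edge-Weighted
Triangle. -/
def distanceProgram (P : RamProgram) : RamProgram :=
  .seq distanceSetup <|
  .seq (.fill 2 3 21 .arcMatrixE) <|
  .seq (.assign 12 (.const 1)) <|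
  .seq (.whileE (.bin .lt (.var 12) (.var 20))
    (.seq (squareProgram P) (.assign 12 (.bin .mul (.const 2) (.var 12))))) <|
  .seq (.fill 2 1 21 (.ld 3 (.var 2))) <|
  .fill 2 2 21 (.bin .lt (.ld 3 (.var 2))
    (.bin .add (.bin .mul (.bin .mul (.const 2) (.var 20)) (.var 33)) (.const 1)))

theorem Int.cell_div_mod {n : ℕ} (u v : Fin n) :
    ((u : ℕ) * (n : ℤ) + (v : ℕ)) / n = (u : ℕ) ∧ ((u : ℕ) * (n : ℤ) + (v : ℕ)) % n = (v : ℕ) := by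
  have hv : ((v : ℕ) : ℤ) < n := by exact_mod_cast v.2
  have hn : (n : ℤ) ≠ 0 := by have := u.pos; omega
  constructor
  · rw [add_comm, Int.add_mul_ediv_right _ _ hn, Int.ediv_eq_zero_of_lt (by positivity) hv, zero_add]
  · rw [add_comm, Int.add_mul_emod_self_right, Int.emod_eq_of_lt (by positivity) hv]

theorem distanceBound_mono {n m M : ℕ} (h : m ≤ M) : distanceBound n m ≤ distanceBound n M :=
  Nat.mul_le_mul_left _ (Nat.add_le_add_right (Nat.mul_le_mul_left _ h) 1)

theorem ShortestPathsInstance.abs_distMatrix_le {I : ShortestPathsInstance} {m k : ℕ}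
    (hM : ∀ u v a, I.arc u v = some a → |a| ≤ (m : ℤ)) (hk : 2 ^ k ≤ 2 * I.n) (u v : Fin I.n) :
    |I.distMatrix (4 * I.n * m + 1) k u v| ≤ distanceBound I.n m := by
  have hn : (1 : ℤ) ≤ I.n := by exact_mod_cast I.n_pos
  have hm : (0 : ℤ) ≤ m := by positivity
  have hnm : (m : ℤ) ≤ I.n * m := by nlinarith
  have hkZ : (2 : ℤ) ^ k ≤ 2 * I.n := by exact_mod_cast hk
  have hQ0 : (0 : ℤ) ≤ 4 * I.n * m + 1 := by positivity
  have h1 := neg_le_distMatrix hM hQ0 k u v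
  have h2 := distMatrix_le hM (Q := 4 * I.n * m + 1) (by linarith) k u v
  have hB : (distanceBound I.n m : ℤ) = 2 * I.n * (4 * I.n * m + 1) := by
    rw [distanceBound]; push_cast; rfl
  rw [hB, abs_le]
  constructor
  · have h3 : (2 : ℤ) ^ k * m ≤ 2 * I.n * m := mul_le_mul_of_nonneg_right hkZ hm
    have h4 : 2 * (I.n : ℤ) * m ≤ 2 * I.n * (4 * I.n * m + 1) :=
      mul_le_mul_of_nonneg_left (by linarith) (by positivity)
    linarith
  · exact h2.trans (mul_le_mul_of_nonneg_right hkZ hQ0)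

/-- `Nat.clog 2 n` squarings cover walks with up to `n` arcs while `2 ^ k ≤ 2 * n` keeps all entries
within `distanceBound`. There is one call per triple of blocks, round and squaring, and the stamp
counts these calls. -/
theorem achieves_distanceProgram {X D B τ M : ℕ} {P : RamProgram} {I : ShortestPathsInstance}
    (hM : allPairsShortestPaths.WeightsBoundedBy I M) (hX : 1000 * (I.n ^ 6 * (M + 1)) ≤ X)
    (hD : 5000 ≤ D) (hB : B ≤ X)
    (hP : ∀ s m : ℕ, 1 ≤ s → s ^ 4 ≤ I.n → m ≤ M →
      DecidesTriangle P (3 * s) (2 * (3 * distanceBound I.n m)) B τ) :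
    Achieves X D (distanceProgram P) (.init (allPairsShortestPaths.input I)) fun σ t =>
      I.HoldsDistances σ ∧ ∃ s b, 1 ≤ s ∧ s ^ 4 ≤ I.n ∧ I.n < (s + 1) ^ 4 ∧
        2 ^ b ≤ 2 * distanceBound I.n M ∧
        t ≤ (Nat.clog 2 I.n + 1) * ((b + 2) * (3 * markTime I.n s (I.n / s + 1) τ P.width)) := by
  have hn := I.n_pos
  have hX2 : 2 ≤ X := by
    have : 1 ≤ I.n ^ 6 * (M + 1) := Nat.mul_pos (Nat.pow_pos hn) (by omega)
    omega
  refine .seq (achieves_distanceSetup hM hX hD ?_)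
  intro σ t1 m s b ht1 hm hIm hs hs4 hs4' hb hb' hmem r1 hpar r31 r32 r33 r34
  refine .of_bounded fun hbdd => ?_
  have hregX : ∀ {r m : ℕ}, σ.reg r = m → m ≤ X := fun {r m} h => by
    have := (le_abs_self _).trans (hbdd.1 r); rw [h] at this; exact_mod_cast this
  have hn0 : (0 : ℤ) < I.n := by exact_mod_cast hn
  have hnX : I.n ≤ X := hregX hpar.n_eq
  have hG : I.n ≤ s * (I.n / s + 1) := by
    rw [mul_add, mul_one]
    exact (Nat.lt_mul_div_succ I.n hs).le
  have hsn : s ≤ I.n := (Nat.le_self_pow (by omega) s).trans hs4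
  have hsG : s * (I.n / s + 1) ≤ X := by
    have h1 : s * (I.n / s + 1) ≤ 2 * I.n := by
      rw [mul_add, mul_one]
      have := Nat.mul_div_le I.n s
      omega
    have h2 : I.n ≤ I.n ^ 6 * (M + 1) :=
      (Nat.le_self_pow (by omega) _).trans (Nat.le_mul_of_pos_right _ (by omega))
    omega
  have hGn : I.n / s + 1 ≤ 2 * I.n := by have := Nat.div_le_self I.n s; omega
  set G := I.n / s + 1 with hGdef
  have hclog : Nat.clog 2 I.n ≤ I.n := Nat.clog_le_of_le_pow Nat.lt_two_pow_self.le
  set N := Nat.clog 2 I.n with hN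
  -- The final stamp is the total number of calls. The crude estimates `N ≤ n`, `b + 1 ≤ 2 ^ b` and
  -- `G ≤ 2 * n` already keep it polynomial in `n` and `M`.
  have hcurN : N * ((b + 1) * (G * G * G)) ≤ X := by
    have h1 : b + 1 ≤ 2 * distanceBound I.n m := (Nat.lt_two_pow_self (n := b)).trans_le hb'
    have h2 : distanceBound I.n m ≤ 8 * (I.n ^ 2 * (M + 1)) := by
      have h3 : I.n ≤ I.n ^ 2 := Nat.le_self_pow (by omega) _
      have h4 : I.n ^ 2 * m ≤ I.n ^ 2 * M := Nat.mul_le_mul_left _ hm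
      have h5 : distanceBound I.n m = 8 * (I.n ^ 2 * m) + 2 * I.n := by rw [distanceBound]; ring
      rw [mul_add, mul_one]
      omega
    calc N * ((b + 1) * (G * G * G))
        ≤ I.n * (2 * (8 * (I.n ^ 2 * (M + 1))) * (2 * I.n * (2 * I.n) * (2 * I.n))) :=
          Nat.mul_le_mul hclog (Nat.mul_le_mul (h1.trans (Nat.mul_le_mul_left _ h2))
            (Nat.mul_le_mul (Nat.mul_le_mul hGn hGn) hGn))
      _ = 128 * (I.n ^ 6 * (M + 1)) := by ring
      _ ≤ X := by omega
  set Z := distanceBound I.n m with hZ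
  set q : ℤ := 4 * I.n * m + 1 with hq
  have hbase : ∀ u v : Fin I.n, RamExpr.arcMatrixE.eval (σ.setReg 2 ((u : ℕ) * (I.n : ℤ) + (v : ℕ)))
      = I.distMatrix q 0 u v := by
    intro u v
    obtain ⟨d1, d2⟩ := Int.cell_div_mod u v
    rw [RamExpr.arcMatrixE, RamExpr.eval_ite, RamExpr.eval_ite, RamExpr.eval_eq, RamExpr.eval_div,
      RamExpr.eval_mod, RamExpr.eval_ld, RamExpr.eval_ld, RamExpr.eval_var, RamExpr.eval_var,
      RamExpr.eval_var, RamExpr.eval_const, RamState.setReg_reg_self,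
      RamState.setReg_reg_of_ne _ (by omega), RamState.setReg_reg_of_ne _ (by omega), hpar.n_eq,
      d1, d2, RamState.setReg_mem, hmem, I.mem_arc, I.mem_adj, r34,
      ShortestPathsInstance.distMatrix, ShortestPathsInstance.arcMatrix]
    by_cases huv : u = v
    · subst huv; simp
    · have : ¬ (((u : ℕ) : ℤ) = (v : ℕ)) := fun h => huv (Fin.ext (by exact_mod_cast h))
      rw [if_neg this, if_pos rfl, if_neg huv]
      cases I.arc u v <;> simp
  have hdist : ∀ k, 2 ^ k ≤ 2 * I.n → ∀ u v, |I.distMatrix q k u v| ≤ Z := fun k hk u v =>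
    ShortestPathsInstance.abs_distMatrix_le hIm hk u v
  have hZX : (Z : ℤ) ≤ X := by exact_mod_cast hregX r31
  have hcell : ∀ x : ℤ, 0 ≤ x → x < (I.n * I.n : ℕ) →
      ∃ u v : Fin I.n, x = (u : ℕ) * (I.n : ℤ) + (v : ℕ) := by
    intro x x0 x1
    obtain ⟨i, j, i0, i1, j0, j1, rfl⟩ := Int.exists_cell_eq hn0 x0 (by push_cast at x1; exact x1)
    obtain ⟨u, rfl⟩ := Int.exists_fin_eq i0 i1
    obtain ⟨v, rfl⟩ := Int.exists_fin_eq j0 j1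
    exact ⟨u, v, rfl⟩
  refine .seq (.fill hX2 (n := I.n * I.n) (by omega) ((by decide : _ ≤ 5000).trans hD)
    (by decide) (by omega) hpar.nn_eq (hregX hpar.nn_eq) ?_ fun t2 ht2 => ?_)
  · intro x x0 x1
    obtain ⟨u, v, rfl⟩ := hcell x x0 x1
    rw [hbase]
    exact (hdist 0 (by rw [pow_zero]; omega) u v).trans hZX
  generalize hσ1 : σ.filled 2 3 (I.n * I.n) _ = σ1
  have e1 : ∀ r, r ≠ 2 → σ1.reg r = σ.reg r := fun r hr => by
    rw [← hσ1, RamState.filled_reg_of_ne hr]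
  have m1 : ∀ A, A ≠ 3 → σ1.mem A = σ.mem A := fun A hA => by
    rw [← hσ1, RamState.filled_mem_of_ne hA]
  have m3 : ∀ u v : Fin I.n, σ1.mem 3 ((u : ℕ) * (I.n : ℤ) + (v : ℕ)) = I.distMatrix q 0 u v := by
    intro u v
    obtain ⟨z0, z1⟩ := Fin.cell_lt u v
    rw [← hσ1, RamState.filled_mem_self]
    simp only
    rw [if_pos ⟨z0, by push_cast; exact z1⟩, hbase]
  clear hσ1
  have hstamp0 : ∀ A x, σ.mem (9 + 2 * A) x = 0 := by
    intro A x
    have : allPairsShortestPaths.input I (9 + 2 * A) = [] := by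
      rw [show 9 + 2 * A = (6 + 2 * A) + 3 by ring]; rfl
    simp [hmem, RamState.init, this]
  refine .seq (.assignNat hX2 hD (by decide) 1 rfl (by omega) fun t3 ht3 => ?_)
  set T := markTime I.n s G τ P.width with hT
  have hTn : 20000 * (I.n * I.n) ≤ T := le_markTime hs
  have hnn : 1 ≤ I.n * I.n := Nat.mul_le_mul hn hn
  refine .seq (.whileE hX2 ((by decide : _ ≤ 5000).trans hD)
    (fun k σ' t => t ≤ k * ((b + 2) * (3 * T)) ∧ (∀ r, 13 ≤ r → σ'.reg r = σ.reg r) ∧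
      σ'.reg 12 = (2 ^ k : ℕ) ∧ σ'.reg 1 = (k * ((b + 1) * (G * G * G)) : ℕ) ∧
      (∀ A x, σ'.mem (9 + 2 * A) x ≤ σ'.reg 1) ∧
      ∀ u v : Fin I.n, σ'.mem 3 ((u : ℕ) * (I.n : ℤ) + (v : ℕ)) = I.distMatrix q k u v)
    N ?_ ?_ ?_ ?_)
  · refine ⟨by omega, fun r hr => ?_, ?_, ?_, fun A x => ?_, m3⟩
    · rw [RamState.setReg_reg_of_ne _ (by omega), e1 _ (by omega)]
    · rw [RamState.setReg_reg_self]; simp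
    · rw [RamState.setReg_reg_of_ne _ (by omega), e1 _ (by omega), r1]; simp
    · rw [RamState.setReg_reg_of_ne _ (by omega), e1 _ (by omega), r1, RamState.setReg_mem,
        m1 _ (by omega), hstamp0]
  · rintro k hk σ2 t ⟨ht, hr2, h12, h1, hst2, hd2⟩
    have hkn : 2 ^ k < I.n := Nat.pow_lt_of_lt_clog hk
    have hpar2 : HoldsParams I.n s G (3 * Z) σ2 := hpar.congr fun r _ _ => hr2 r (by omega)
    constructor
    · rw [RamExpr.eval_lt, RamExpr.eval_var, RamExpr.eval_var, h12, hr2 _ (by omega), hpar.n_eq,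
        if_pos (by exact_mod_cast hkn)]
      norm_num
    have hk1 : 2 ^ (k + 1) ≤ 2 * I.n := by rw [pow_succ]; omega
    have hkN : (k + 1) * ((b + 1) * (G * G * G)) ≤ X :=
      (Nat.mul_le_mul_right _ hk).trans hcurN
    refine .seq (achieves_squareProgram (m := intMatrix (I.distMatrix q (k + 1))) hX2 hD hB
      (hP s m hs hs4 hm) hn hs hpar2 hG hsG (by rw [hr2 _ (by omega), r31])
      (by rw [hr2 _ (by omega), r32]) (by exact_mod_cast hb) (by exact_mod_cast hb') ?_ ?_ ?_ ?_
      hst2 ?_)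
    · rw [h1]
      have : k * ((b + 1) * (G * G * G)) + (b + 1) * (G * G * G) ≤ X := by
        rw [← Nat.succ_mul]; exact hkN
      exact_mod_cast this
    · rw [h1]; positivity
    · intro i j i0 i1 j0 j1
      obtain ⟨u, rfl⟩ := Int.exists_fin_eq i0 i1
      obtain ⟨v, rfl⟩ := Int.exists_fin_eq j0 j1
      rw [hd2]
      exact hdist k (by omega) u v
    · intro i j i0 i1 j0 j1
      obtain ⟨u, rfl⟩ := Int.exists_fin_eq i0 i1
      obtain ⟨v, rfl⟩ := Int.exists_fin_eq j0 j1
      rw [intMatrix_natCast]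
      refine ⟨hdist (k + 1) hk1 u v, fun x x0 x1 => ?_, ?_⟩
      · obtain ⟨x, rfl⟩ := Int.exists_fin_eq x0 x1
        rw [hd2, hd2]
        exact ShortestPathsInstance.distMatrix_succ_le k u x v
      · obtain ⟨x, hx⟩ := ShortestPathsInstance.exists_distMatrix_succ_eq (Q := q) k u v
        exact ⟨(x : ℕ), by positivity, by exact_mod_cast x.2, by rw [hd2, hd2, hx]⟩
    intro σ3 t4 ht4 hr3 hl3 hc3 hst3 hd3
    have h12' : (RamExpr.bin .mul (.const 2) (.var 12)).eval σ3 = ((2 ^ (k + 1) : ℕ) : ℤ) := by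
      rw [RamExpr.eval_mul, RamExpr.eval_const, RamExpr.eval_var, hr3 _ (by omega), h12]
      push_cast; ring
    refine .assignNat hX2 hD (by decide) (2 ^ (k + 1)) h12' ?_ fun t5 ht5 t6 ht6 => ?_
    · have h3 : I.n ≤ I.n ^ 6 * (M + 1) :=
        (Nat.le_self_pow (by omega) _).trans (Nat.le_mul_of_pos_right _ (by omega))
      omega
    refine ⟨?_, fun r hr => ?_, RamState.setReg_reg_self _ _ _, ?_, fun A x => ?_, ?_⟩
    · simp only [RamExpr.cost] at ht5 ht6
      change t4 ≤ (b + 2) * (2 * T) at ht4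
      have h3 : (k + 1) * ((b + 2) * (3 * T)) = k * ((b + 2) * (3 * T)) + (b + 2) * (3 * T) := by
        ring
      have h4 : (b + 2) * (3 * T) = (b + 2) * (2 * T) + (b + 2) * T := by ring
      have h5 : T ≤ (b + 2) * T := Nat.le_mul_of_pos_left _ (by omega)
      omega
    · rw [RamState.setReg_reg_of_ne _ (by omega), hr3 _ (by omega), hr2 _ hr]
    · rw [RamState.setReg_reg_of_ne _ (by omega), hc3, h1]; push_cast; ring
    · rw [RamState.setReg_reg_of_ne _ (by omega), RamState.setReg_mem]; exact hst3 A x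
    · intro u v
      rw [RamState.setReg_mem, hd3 _ _ (by positivity) (by exact_mod_cast u.2) (by positivity)
        (by exact_mod_cast v.2), intMatrix_natCast]
  · rintro σ2 t ⟨-, hr2, h12, -⟩
    rw [RamExpr.eval_lt_eq_zero, RamExpr.eval_var, RamExpr.eval_var, h12, hr2 _ (by omega), hpar.n_eq,
      not_lt]
    exact_mod_cast Nat.le_pow_clog (by omega) _
  rintro σ2 t t4 ht4 ⟨ht, hr2, -, -, -, hd2⟩
  refine .of_bounded fun hbdd2 => .seq (.fill hX2 (n := I.n * I.n) (by omega)
    ((by decide : _ ≤ 5000).trans hD) (by decide) (by omega)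
    (by rw [hr2 _ (by omega), hpar.nn_eq]) (hregX hpar.nn_eq) (fun x _ _ => hbdd2.2 _ _)
    fun t5 ht5 => ?_)
  generalize hσ3 : σ2.filled 2 1 (I.n * I.n) _ = σ3
  have e3 : ∀ r, r ≠ 2 → σ3.reg r = σ2.reg r := fun r hr => by
    rw [← hσ3, RamState.filled_reg_of_ne hr]
  have n3 : ∀ A, A ≠ 1 → σ3.mem A = σ2.mem A := fun A hA => by
    rw [← hσ3, RamState.filled_mem_of_ne hA]
  have n1 : ∀ u v : Fin I.n, σ3.mem 1 ((u : ℕ) * (I.n : ℤ) + (v : ℕ)) = I.distMatrix q N u v := by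
    intro u v
    obtain ⟨z0, z1⟩ := Fin.cell_lt u v
    rw [← hσ3, RamState.filled_mem_self]
    simp only
    rw [if_pos ⟨z0, by push_cast; exact z1⟩, RamExpr.eval_ld, RamExpr.eval_var,
      RamState.setReg_reg_self, RamState.setReg_mem, hd2]
  clear hσ3
  -- The machine compares strictly, so `≤ 2 * n * m` is tested as `< 2 * n * m + 1`.
  have hlt : ∀ x : ℤ, (RamExpr.bin .lt (.ld 3 (.var 2)) (.bin .add (.bin .mul (.bin .mul (.const 2)
      (.var 20)) (.var 33)) (.const 1))).eval (σ3.setReg 2 x) =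
      if σ2.mem 3 x ≤ 2 * I.n * m then 1 else 0 := by
    intro x
    rw [RamExpr.eval_lt, RamExpr.eval_ld, RamExpr.eval_add, RamExpr.eval_mul, RamExpr.eval_mul,
      RamExpr.eval_const, RamExpr.eval_const, RamExpr.eval_var, RamExpr.eval_var, RamExpr.eval_var,
      RamState.setReg_reg_self, RamState.setReg_reg_of_ne _ (by omega),
      RamState.setReg_reg_of_ne _ (by omega), RamState.setReg_mem, n3 _ (by omega),
      e3 _ (by omega), e3 _ (by omega), hr2 _ (by omega), hr2 _ (by omega), hpar.n_eq, r33]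
    simp only [Int.lt_add_one_iff]
  refine .fill hX2 (n := I.n * I.n) (by omega) ((by decide : _ ≤ 5000).trans hD) (by decide)
    (by omega) (by rw [e3 _ (by omega), hr2 _ (by omega), hpar.nn_eq]) (hregX hpar.nn_eq) ?_
    fun t6 ht6 => ⟨?_, s, b, hs, hs4, hs4', ?_, ?_⟩
  · intro x _ _
    rw [hlt]
    split_ifs
    · rw [abs_one]; exact_mod_cast (by omega)
    · rw [abs_zero]; positivity
  · intro u v
    obtain ⟨z0, z1⟩ := Fin.cell_lt u v
    have hN2 : 2 ^ N ≤ 2 * I.n := by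
      rcases Nat.eq_zero_or_pos N with h | h
      · rw [h]; omega
      · obtain ⟨k, hk⟩ : ∃ k, N = k + 1 := ⟨N - 1, by omega⟩
        have : 2 ^ k < I.n := Nat.pow_lt_of_lt_clog (by omega)
        rw [hk, pow_succ]
        omega
    have hcorrect := ShortestPathsInstance.distMatrix_correct (Q := q) hIm
      (Nat.le_pow_clog (by omega) I.n) hN2 rfl u v
    simp only
    rw [RamState.filled_mem_self, RamState.filled_mem_of_ne (by omega), n1]
    simp only
    rw [if_pos ⟨z0, by push_cast; exact z1⟩, hlt, hd2]
    rcases hcorrect with ⟨h1, h2⟩ | ⟨h1, h2⟩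
    · exact .inl ⟨if_pos h1, h2⟩
    · exact .inr ⟨if_neg h1, h2⟩
  · exact hb'.trans (Nat.mul_le_mul_left _ (distanceBound_mono hm))
  · have h3 : (N + 1) * ((b + 2) * (3 * T)) = N * ((b + 2) * (3 * T)) + (b + 2) * (3 * T) := by
      ring
    have h4 : (b + 2) * (3 * T) = 2 * T + ((b + 2) * T * 2 + b * T) := by ring
    have h5 : b ≤ b * T := Nat.le_mul_of_pos_right _ (by omega)
    have h6 : 100 * (b + 1) ≤ (b + 2) * T := by
      calc 100 * (b + 1) ≤ T * (b + 2) := Nat.mul_le_mul (by omega) (by omega)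
        _ = _ := mul_comm _ _
    have hc : RamExpr.arcMatrixE.cost ≤ 30 := by decide
    have ht2' : t2 ≤ (I.n * I.n + 1) * 50 := ht2.trans (Nat.mul_le_mul_left _ (by omega))
    simp only [RamExpr.cost] at ht3 ht4 ht5 ht6
    change _ ≤ (N + 1) * ((b + 2) * (3 * T))
    omega

/-! ### The running time for All Pairs Shortest Paths -/

theorem Exec.mono {B B' : ℕ} (hB : B ≤ B') {P : RamProgram} {s s' : RamState} {t : ℕ}
    (h : Exec B P s t s') : Exec B' P s t s' := by
  have hB' : (B : ℤ) ≤ B' := by exact_mod_cast hB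
  induction h with
  | skip s => exact .skip s
  | const r c s h => exact .const r c s (h.trans hB')
  | op o r a b s h => exact .op o r a b s (h.trans hB')
  | load r A a s h => exact .load r A a s (h.trans hB')
  | store A a b s => exact .store A a b s
  | seq _ _ ih₁ ih₂ => exact .seq ih₁ ih₂
  | ite_true hr _ ih => exact .ite_true hr ih
  | ite_false hr _ ih => exact .ite_false hr ih
  | loop_stop hr => exact Exec.loop_stop hr
  | loop_step hr _ _ ih₁ ih₂ => exact .loop_step hr ih₁ ih₂

/-- The size of blocks compared to the fourth root of the number of rows. -/
theorem blockSize_bounds {n s : ℕ} {x : ℝ} (hs : 1 ≤ s) (h : s ^ 4 ≤ n) (h' : n < (s + 1) ^ 4)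
    (hx : 0 ≤ x) (hxn : x ^ 4 = n) :
    1 ≤ x ∧ (s : ℝ) ≤ x ∧ ((n / s + 1 : ℕ) : ℝ) ≤ 4 * x ^ 3 := by
  have hs1 : (1 : ℝ) ≤ s := by exact_mod_cast hs
  have h1 : (s : ℝ) ≤ x := by
    refine le_of_pow_le_pow_left₀ (n := 4) (by norm_num) hx ?_
    rw [hxn]; exact_mod_cast h
  have h2 : x ≤ s + 1 := by
    refine le_of_pow_le_pow_left₀ (n := 4) (by norm_num) (by positivity) ?_
    rw [hxn]; exact_mod_cast h'.le
  refine ⟨hs1.trans h1, h1, ?_⟩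
  have h3 : ((n / s : ℕ) : ℝ) ≤ n / s := Nat.cast_div_le
  -- Here `n = x ^ 4` and `x ≤ s + 1 ≤ 2 * s`.
  have h4 : (n : ℝ) / s ≤ 2 * x ^ 3 := by
    rw [div_le_iff₀ (by linarith), ← hxn]
    have : x ^ 4 = x ^ 3 * x := by ring
    rw [this]
    nlinarith [pow_nonneg hx 3]
  have h5 : 1 ≤ x ^ 3 := one_le_pow₀ (hs1.trans h1)
  push_cast
  linarith

/-- With `x = n ^ (1/4)`, `s ≤ x` and `G ≤ 4 * x ^ 3`, the tests cost `G ^ 3 * x ^ (3 - δ)`, of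
order `x ^ (12 - δ)` up to logarithms. The searches cost `n ^ 2 * s ^ 3` and writing the instances
`G ^ 3 * s ^ 2`; both are of order `x ^ 11`, which is no more because `δ ≤ 1`. -/
theorem markTime_le {n s τ W k : ℕ} {x δ C Λ : ℝ} (hs : 1 ≤ s) (h : s ^ 4 ≤ n)
    (h' : n < (s + 1) ^ 4) (hx : 0 ≤ x) (hxn : x ^ 4 = n) (hδ : δ ≤ 1) (hΛ : 1 ≤ Λ)
    (hτ : (τ : ℝ) ≤ C * x ^ (3 - δ) * Λ ^ k) :
    (markTime n s (n / s + 1) τ W : ℝ) ≤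
      (256 * C + 64 * W + 64 * 200100 + 20000) * x ^ (12 - δ) * Λ ^ k := by
  obtain ⟨hx1, hsx, hG⟩ := blockSize_bounds hs h h' hx hxn
  have hx0 : 0 < x := by linarith
  have hs0 : (0 : ℝ) ≤ s := by positivity
  set G : ℝ := ((n / s + 1 : ℕ) : ℝ) with hGdef
  have hG0 : 0 ≤ G := by positivity
  have hΛk : 1 ≤ Λ ^ k := one_le_pow₀ hΛ
  have hG3 : G * G * G ≤ 64 * x ^ 9 := by
    calc G * G * G = G ^ 3 := by ring
      _ ≤ (4 * x ^ 3) ^ 3 := pow_le_pow_left₀ hG0 hG 3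
      _ = 64 * x ^ 9 := by ring
  have hs2 : (s : ℝ) * s ≤ x ^ 2 := by rw [sq]; exact mul_le_mul hsx hsx hs0 hx
  have hs3 : (s : ℝ) * s * s ≤ x ^ 3 := by
    calc (s : ℝ) * s * s = (s : ℝ) ^ 3 := by ring
      _ ≤ x ^ 3 := pow_le_pow_left₀ hs0 hsx 3
  have hnat : ∀ m : ℕ, m ≤ 11 → x ^ m ≤ x ^ (12 - δ) := fun m hm => by
    rw [← Real.rpow_natCast]
    refine Real.rpow_le_rpow_of_exponent_le hx1 ?_
    have : (m : ℝ) ≤ 11 := by exact_mod_cast hm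
    linarith
  have h9 : x ^ 9 * x ^ (3 - δ) = x ^ (12 - δ) := by
    rw [← Real.rpow_natCast, ← Real.rpow_add hx0]
    congr 1; push_cast; ring
  set p := x ^ (12 - δ) with hp
  have hp0 : 0 ≤ p := by positivity
  have hpΛ : p ≤ p * Λ ^ k := le_mul_of_one_le_right hp0 hΛk
  have e1 : G * G * G * (4 * τ) ≤ 256 * C * p * Λ ^ k := by
    calc G * G * G * (4 * τ) ≤ 64 * x ^ 9 * (4 * (C * x ^ (3 - δ) * Λ ^ k)) :=
          mul_le_mul hG3 (by linarith) (by positivity) (by positivity)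
      _ = 256 * C * (x ^ 9 * x ^ (3 - δ)) * Λ ^ k := by ring
      _ = _ := by rw [h9]
  have e2 : G * G * G * W ≤ 64 * W * p := by
    calc G * G * G * W ≤ 64 * x ^ 9 * W := mul_le_mul_of_nonneg_right hG3 (by positivity)
      _ = 64 * W * x ^ 9 := by ring
      _ ≤ _ := mul_le_mul_of_nonneg_left (hnat 9 (by omega)) (by positivity)
  have e3 : G * G * G * (200100 * (s * s)) ≤ 64 * 200100 * p := by
    calc G * G * G * (200100 * (s * s)) ≤ 64 * x ^ 9 * (200100 * x ^ 2) :=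
          mul_le_mul hG3 (by linarith) (by positivity) (by positivity)
      _ = 64 * 200100 * x ^ 11 := by ring
      _ ≤ _ := mul_le_mul_of_nonneg_left (hnat 11 (by omega)) (by positivity)
  have e4 : 20000 * ((n : ℝ) * n * (s * s * s)) ≤ 20000 * p := by
    refine mul_le_mul_of_nonneg_left ?_ (by norm_num)
    calc (n : ℝ) * n * (s * s * s) ≤ n * n * x ^ 3 :=
          mul_le_mul_of_nonneg_left hs3 (by positivity)
      _ = x ^ 11 := by rw [← hxn]; ring
      _ ≤ _ := hnat 11 (by omega)
  have e5 : (64 * (W : ℝ) + 64 * 200100 + 20000) * p ≤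
      (64 * (W : ℝ) + 64 * 200100 + 20000) * (p * Λ ^ k) :=
    mul_le_mul_of_nonneg_left hpΛ (by positivity)
  have hcast : (markTime n s (n / s + 1) τ W : ℝ) =
      G * G * G * (4 * τ + W + 200100 * (s * s)) + 20000 * ((n : ℝ) * n * (s * s * s)) := by
    rw [markTime, hGdef]; push_cast; rfl
  rw [hcast]
  linarith

/-- The auxiliary weights are polynomial in `n` as well as in `M`: the argument of the logarithm is
at most `2 ^ 6 * n ^ 2 * (M + 2)`. The resulting `log n` is traded for an arbitrarily small power of
`n`. -/
theorem log_distanceBound_le {n M : ℕ} (hn : 1 ≤ n) {η : ℝ} (hη : 0 < η) :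
    Real.log (((6 * distanceBound n M : ℕ) : ℝ) + 2) ≤
      (7 + 4 / η) * (n : ℝ) ^ η * Real.log ((M : ℝ) + 2) := by
  have hnR : (1 : ℝ) ≤ n := by exact_mod_cast hn
  have hM0 : (0 : ℝ) ≤ M := Nat.cast_nonneg M
  have hL2 := log_two_le_log_add_two M
  have hlog2 : (1 / 2 : ℝ) ≤ Real.log 2 := by linarith [Real.log_two_gt_d9]
  set L := Real.log ((M : ℝ) + 2) with hL
  have h1 : ((6 * distanceBound n M : ℕ) : ℝ) + 2 ≤ 2 ^ 6 * ((n : ℝ) ^ 2 * ((M : ℝ) + 2)) := by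
    rw [distanceBound]
    push_cast
    have h2 : (n : ℝ) ≤ (n : ℝ) ^ 2 := by nlinarith
    have h3 : (0 : ℝ) ≤ (n : ℝ) ^ 2 * M := by positivity
    nlinarith
  have h2 : Real.log (((6 * distanceBound n M : ℕ) : ℝ) + 2) ≤
      6 * Real.log 2 + (2 * Real.log n + L) := by
    refine (Real.log_le_log (by positivity) h1).trans_eq ?_
    rw [Real.log_mul (by norm_num) (by positivity), Real.log_mul (by positivity) (by positivity),
      Real.log_pow, Real.log_pow]
    norm_num
    rfl
  have h3 : Real.log n ≤ (n : ℝ) ^ η / η := Real.log_le_rpow_div (by positivity) hη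
  have h4 : 1 ≤ (n : ℝ) ^ η := Real.one_le_rpow hnR hη.le
  have h5 : 7 * L ≤ 7 * ((n : ℝ) ^ η * L) := by nlinarith
  have h6 : (n : ℝ) ^ η / η ≤ 2 * ((n : ℝ) ^ η / η * L) := by
    have : 0 ≤ (n : ℝ) ^ η / η := by positivity
    nlinarith
  calc _ ≤ 7 * ((n : ℝ) ^ η * L) + 4 * ((n : ℝ) ^ η / η * L) := by linarith
    _ = _ := by ring

theorem natCast_le_two_mul_log {b : ℕ} {y : ℝ} (h : (2 : ℝ) ^ b ≤ y) : (b : ℝ) ≤ 2 * Real.log y := by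
  have h1 := Real.log_le_log (by positivity) h
  rw [Real.log_pow] at h1
  have h2 : (1 / 2 : ℝ) ≤ Real.log 2 := by linarith [Real.log_two_gt_d9]
  have h3 : (b : ℝ) * (1 / 2) ≤ b * Real.log 2 := mul_le_mul_of_nonneg_left h2 (by positivity)
  linarith

/-- The factor `27` bounds the `3 ^ (3 - δ)` coming from `3 * s` vertices. Stating the bound with
`M` and `x` instead of the actual weights and block size gives one time bound for all calls. -/
theorem decidesTriangle_of_solvable {P : RamProgram} {C δ : ℝ} {k c : ℕ} (hδ0 : 0 ≤ δ) (hδ : δ ≤ 3)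
    (h : ∀ (J : TriangleInstance) (M : ℕ), EdgeWeightsBoundedBy J.w M → ∃ t s,
      Exec ((J.n + M + 2) ^ c) P (.init (negativeTriangle.input J)) t s ∧
      DecidesAs J.HasNegativeTriangle s ∧
      (t : ℝ) ≤ C * (J.n : ℝ) ^ (3 - δ) * Real.log ((M : ℝ) + 2) ^ k)
    {n s m M : ℕ} {x : ℝ} (hsx : (s : ℝ) ≤ x) (hsn : s ≤ n) (hm : m ≤ M) :
    DecidesTriangle P (3 * s) m ((3 * n + M + 2) ^ c)
      ⌊27 * |C| * x ^ (3 - δ) * Real.log ((M : ℝ) + 2) ^ k⌋₊ := by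
  intro J hJn hJm
  obtain ⟨t, p, he, hd, ht⟩ := h J M fun e he => (hJm e he).trans (by exact_mod_cast hm)
  have hs0 : (0 : ℝ) ≤ s := by positivity
  have hL : 0 ≤ Real.log ((M : ℝ) + 2) ^ k :=
    pow_nonneg (Real.log_nonneg (by linarith [Nat.cast_nonneg (α := ℝ) M])) k
  refine ⟨t, Nat.le_floor (ht.trans ?_), p, he.mono (Nat.pow_le_pow_left (by omega) c), hd⟩
  refine mul_le_mul_of_nonneg_right ?_ hL
  have h3 : (3 : ℝ) ^ (3 - δ) ≤ 27 := by
    calc (3 : ℝ) ^ (3 - δ) ≤ (3 : ℝ) ^ (3 : ℝ) :=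
        Real.rpow_le_rpow_of_exponent_le (by norm_num) (by linarith)
      _ = 27 := by norm_num
  calc C * (J.n : ℝ) ^ (3 - δ) ≤ |C| * (3 * x) ^ (3 - δ) := by
        refine mul_le_mul (le_abs_self C) (Real.rpow_le_rpow (by positivity) ?_ (by linarith))
          (by positivity) (abs_nonneg C)
        rw [hJn]; push_cast; linarith
    _ = |C| * (3 : ℝ) ^ (3 - δ) * x ^ (3 - δ) := by
        rw [Real.mul_rpow (by norm_num) (hs0.trans hsx)]; ring
    _ ≤ |C| * 27 * x ^ (3 - δ) :=
        mul_le_mul_of_nonneg_right (mul_le_mul_of_nonneg_left h3 (abs_nonneg C))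
          (Real.rpow_nonneg (hs0.trans hsx) _)
    _ = 27 * |C| * x ^ (3 - δ) := by ring

/-- The running time of `distanceProgram` in terms of the number `n` of vertices and the largest
weight `M`. -/
theorem distanceTime_le {n M s b W k t : ℕ} {C δ x : ℝ} (hC : 0 ≤ C) (hn : 1 ≤ n) (hs : 1 ≤ s)
    (h : s ^ 4 ≤ n) (h' : n < (s + 1) ^ 4) (hx : 0 ≤ x) (hxn : x ^ 4 = n) (hδ0 : 0 < δ) (hδ : δ ≤ 1)
    (hb : 2 ^ b ≤ 2 * distanceBound n M)
    (ht : t ≤ (Nat.clog 2 n + 1) * ((b + 2) * (3 * markTime n s (n / s + 1)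
      ⌊C * x ^ (3 - δ) * Real.log (((6 * distanceBound n M : ℕ) : ℝ) + 2) ^ k⌋₊ W))) :
    (t : ℝ) ≤ 36 * (256 * C + 64 * W + 64 * 200100 + 20000) *
      (7 + 4 / (δ / (8 * (k + 2 : ℕ)))) ^ (k + 2) * (n : ℝ) ^ (3 - δ / 8) *
      Real.log ((M : ℝ) + 2) ^ (k + 2) := by
  have hnR : (1 : ℝ) ≤ n := by exact_mod_cast hn
  have hk0 : (0 : ℝ) < (k + 2 : ℕ) := by positivity
  obtain ⟨hx1, -, -⟩ := blockSize_bounds hs h h' hx hxn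
  -- The logarithm occurs to the power `k + 2`: `k` from the triangle algorithm, one from the rounds
  -- of the search and one from the squarings. With this `η` the total loss is `n ^ (δ / 8)`.
  have hη : 0 < δ / (8 * (k + 2 : ℕ)) := by positivity
  have hlog := log_distanceBound_le (M := M) hn hη
  have hηk : δ / (8 * (k + 2 : ℕ)) * (k + 2 : ℕ) = δ / 8 := by field_simp
  set η := δ / (8 * (k + 2 : ℕ)) with hηdef
  set L := Real.log ((M : ℝ) + 2) with hL
  have hdist : 2 * n ≤ distanceBound n M := Nat.le_mul_of_pos_right _ (by omega)
  have hlog2 : (1 / 2 : ℝ) ≤ Real.log 2 := by linarith [Real.log_two_gt_d9]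
  have hdR : 2 * (n : ℝ) ≤ (distanceBound n M : ℕ) := by exact_mod_cast hdist
  set y : ℝ := ((6 * distanceBound n M : ℕ) : ℝ) + 2 with hy
  have hy' : y = 6 * (distanceBound n M : ℕ) + 2 := by rw [hy]; push_cast; rfl
  have hΛ1 : 1 ≤ Real.log y := by
    have h4 : Real.log (2 ^ 2) ≤ Real.log y := Real.log_le_log (by norm_num) (by rw [hy']; linarith)
    rw [Real.log_pow] at h4
    push_cast at h4
    linarith
  have hbΛ : (b : ℝ) ≤ 2 * Real.log y := by
    refine natCast_le_two_mul_log ?_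
    have : (2 : ℝ) ^ b ≤ 2 * (distanceBound n M : ℕ) := by exact_mod_cast hb
    rw [hy']; linarith
  have hNΛ : (Nat.clog 2 n : ℝ) ≤ 2 * Real.log y := by
    refine natCast_le_two_mul_log ?_
    rcases Nat.eq_zero_or_pos (Nat.clog 2 n) with h0 | h0
    · rw [h0, hy', pow_zero]; linarith
    · obtain ⟨l, hl⟩ : ∃ l, Nat.clog 2 n = l + 1 := ⟨Nat.clog 2 n - 1, by omega⟩
      have h2 : 2 ^ l < n := Nat.pow_lt_of_lt_clog (by omega)
      have h2R : (2 : ℝ) ^ l < n := by exact_mod_cast h2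
      rw [hl, hy', pow_succ]
      linarith
  have hτ := Nat.floor_le (a := C * x ^ (3 - δ) * Real.log y ^ k) (by positivity)
  have hmark := markTime_le (W := W) hs h h' hx hxn hδ hΛ1 hτ
  set T := markTime n s (n / s + 1) ⌊C * x ^ (3 - δ) * Real.log y ^ k⌋₊ W with hT
  have hA : (0 : ℝ) ≤ 256 * C + 64 * W + 64 * 200100 + 20000 := by positivity
  set A : ℝ := 256 * C + 64 * W + 64 * 200100 + 20000 with hAdef
  have hxp : x ^ (12 - δ) = (n : ℝ) ^ (3 - δ / 4) := by
    rw [← hxn, ← Real.rpow_natCast, ← Real.rpow_mul hx]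
    congr 1; push_cast; ring
  rw [hxp] at hmark
  have hpow : Real.log y ^ (k + 2) ≤ ((7 + 4 / η) * (n : ℝ) ^ η * L) ^ (k + 2) :=
    pow_le_pow_left₀ (by linarith) hlog _
  have hnη : ((n : ℝ) ^ η) ^ (k + 2) = (n : ℝ) ^ (δ / 8) := by
    rw [← Real.rpow_natCast, ← Real.rpow_mul (by positivity), hηk]
  have hnn : (n : ℝ) ^ (3 - δ / 4) * (n : ℝ) ^ (δ / 8) = (n : ℝ) ^ (3 - δ / 8) := by
    rw [← Real.rpow_add (by linarith)]; congr 1; ring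
  have htR : (t : ℝ) ≤ ((Nat.clog 2 n : ℝ) + 1) * (((b : ℝ) + 2) * (3 * T)) := by exact_mod_cast ht
  have hT0 : (0 : ℝ) ≤ T := by positivity
  calc (t : ℝ) ≤ ((Nat.clog 2 n : ℝ) + 1) * (((b : ℝ) + 2) * (3 * T)) := htR
    _ ≤ 3 * Real.log y * (4 * Real.log y *
        (3 * (A * (n : ℝ) ^ (3 - δ / 4) * Real.log y ^ k))) := by
        refine mul_le_mul (by linarith) (mul_le_mul (by linarith) (by linarith) (by positivity)
          (by positivity)) (by positivity) (by positivity)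
    _ = 36 * A * (n : ℝ) ^ (3 - δ / 4) * Real.log y ^ (k + 2) := by ring
    _ ≤ 36 * A * (n : ℝ) ^ (3 - δ / 4) * ((7 + 4 / η) * (n : ℝ) ^ η * L) ^ (k + 2) :=
        mul_le_mul_of_nonneg_left hpow (by positivity)
    _ = 36 * A * (7 + 4 / η) ^ (k + 2) * ((n : ℝ) ^ (3 - δ / 4) * ((n : ℝ) ^ η) ^ (k + 2)) *
        L ^ (k + 2) := by rw [mul_pow, mul_pow]; ring
    _ = _ := by rw [hnη, hnn]

/-- Blocks of size about `n ^ (1/4)` turn a gain of `δ` in the exponent into `δ / 4`, and half of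
that pays for the powers of `log n`. -/
theorem allPairsShortestPaths_solvable {δ : ℝ} (hδ0 : 0 < δ) (hδ : δ ≤ 1)
    (h : negativeTriangle.SolvableInTime (3 - δ)) :
    allPairsShortestPaths.SolvableInTime (3 - δ / 8) := by
  obtain ⟨P, C, k, c, h⟩ := h
  refine ⟨distanceProgram P, 36 * (256 * (27 * |C|) + 64 * P.width + 64 * 200100 + 20000) *
    (7 + 4 / (δ / (8 * (k + 2 : ℕ)))) ^ (k + 2), k + 2, (7 * c + 14) * 5000, fun I M hM => ?_⟩
  have hn := I.n_pos
  change ∃ t s, Exec ((I.n + M + 2) ^ ((7 * c + 14) * 5000)) _ _ t s ∧ I.HoldsDistances s ∧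
    (t : ℝ) ≤ _ * (I.n : ℝ) ^ (3 - δ / 8) * _
  set Y := I.n + M + 2 with hY
  obtain ⟨x, hx, hxn⟩ : ∃ x : ℝ, 0 ≤ x ∧ x ^ 4 = I.n :=
    ⟨(I.n : ℝ) ^ (1 / 4 : ℝ), by positivity, by
      rw [← Real.rpow_natCast, ← Real.rpow_mul (by positivity)]; norm_num⟩
  have hY7 : 1000 ≤ Y ^ 7 := by
    calc 1000 ≤ 3 ^ 7 := by norm_num
      _ ≤ Y ^ 7 := Nat.pow_le_pow_left (by omega) 7
  have hY14 : Y ^ 14 ≤ Y ^ (7 * c + 14) := Nat.pow_le_pow_right (by omega) (by omega)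
  have hX : 1000 * (I.n ^ 6 * (M + 1)) ≤ Y ^ (7 * c + 14) := by
    refine le_trans ?_ hY14
    calc 1000 * (I.n ^ 6 * (M + 1)) ≤ Y ^ 7 * (Y ^ 6 * Y) :=
          Nat.mul_le_mul hY7 (Nat.mul_le_mul (Nat.pow_le_pow_left (by omega) 6) (by omega))
      _ = Y ^ 14 := by ring
  have hB : (3 * I.n + 6 * distanceBound I.n M + 2) ^ c ≤ Y ^ (7 * c + 14) := by
    have h1 : 3 * I.n + 6 * distanceBound I.n M + 2 ≤ Y ^ 7 := by
      have h2 : 3 * I.n + 6 * distanceBound I.n M + 2 = 48 * (I.n * I.n * M) + 15 * I.n + 2 := by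
        rw [distanceBound]; ring
      have h3 : I.n * I.n * M ≤ Y * Y * Y :=
        Nat.mul_le_mul (Nat.mul_le_mul (by omega) (by omega)) (by omega)
      have h4 : 3 ^ 4 ≤ Y ^ 4 := Nat.pow_le_pow_left (by omega) 4
      have h5 : 3 ^ 4 * (Y * Y * Y) ≤ Y ^ 7 := by
        calc 3 ^ 4 * (Y * Y * Y) ≤ Y ^ 4 * (Y * Y * Y) := Nat.mul_le_mul_right _ h4
          _ = Y ^ 7 := by ring
      have h6 : Y ≤ Y * Y * Y := by
        calc Y = 1 * 1 * Y := by ring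
          _ ≤ Y * Y * Y := Nat.mul_le_mul_right _ (Nat.mul_le_mul (by omega) (by omega))
      omega
    calc (3 * I.n + 6 * distanceBound I.n M + 2) ^ c ≤ (Y ^ 7) ^ c := Nat.pow_le_pow_left h1 c
      _ = Y ^ (7 * c) := (pow_mul _ _ _).symm
      _ ≤ _ := Nat.pow_le_pow_right (by omega) (by omega)
  have hrun := achieves_distanceProgram (D := 5000) (P := P) (τ := ⌊27 * |C| * x ^ (3 - δ) *
      Real.log (((6 * distanceBound I.n M : ℕ) : ℝ) + 2) ^ k⌋₊) hM hX le_rfl hB fun s m hs hs4 hm =>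
    decidesTriangle_of_solvable hδ0.le (by linarith) h (le_of_pow_le_pow_left₀ (n := 4)
      (by norm_num) hx (by rw [hxn]; exact_mod_cast hs4))
      ((Nat.le_self_pow (by omega) s).trans hs4) (by
        have := distanceBound_mono (n := I.n) hm
        omega)
  obtain ⟨t, s, σ, he, hs, ⟨hdist, s', b, h1, h2, h3, h4, h5⟩⟩ := hrun.exists_exec (by
    have hXM : M ≤ Y ^ (7 * c + 14) ∧ I.n ≤ Y ^ (7 * c + 14) ∧ 1 ≤ Y ^ (7 * c + 14) := by
      have : Y ≤ Y ^ (7 * c + 14) := Nat.le_self_pow (by omega) _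
      omega
    generalize Y ^ (7 * c + 14) = X at hXM
    obtain ⟨hXM, hXn, hX1⟩ := hXM
    have hXM' : (M : ℤ) ≤ X := by exact_mod_cast hXM
    have hXn' : (I.n : ℤ) ≤ X := by exact_mod_cast hXn
    have hX1' : (1 : ℤ) ≤ X := by exact_mod_cast hX1
    have a1 : ∀ z ∈ rowMajor (fun u v => (I.arc u v).getD 0), |z| ≤ (X : ℤ) :=
      forall_mem_rowMajor fun u v => by
        cases h : I.arc u v with
        | none => simp
        | some a => exact (hM u v a h).trans hXM'
    have a2 : ∀ z ∈ rowMajor (fun u v : Fin I.n => if (I.arc u v).isSome then (1 : ℤ) else 0),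
        |z| ≤ (X : ℤ) := forall_mem_rowMajor fun u v => by
      split_ifs
      · rwa [abs_one]
      · simp
    intro A z hz
    match A with
    | 0 =>
      obtain rfl : z = I.n := by simpa [allPairsShortestPaths] using hz
      rwa [Nat.abs_cast]
    | 1 => exact a1 z hz
    | 2 => exact a2 z hz
    | A + 3 => simp [allPairsShortestPaths] at hz)
  rw [← pow_mul] at he
  refine ⟨t, s, he, ?_, ?_⟩
  · intro u v
    rw [hs.mem]
    exact hdist u v
  · exact distanceTime_le (by positivity) hn h1 h2 h3 hx hxn hδ0 hδ h4 h5

/-! ### The main theorem. -/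

theorem mainTheorem4 :
    (∃ ε : ℝ, 0 < ε ∧ (kOptDetection 4).SolvableInTime (3 - ε)) →
      ∃ δ : ℝ, 0 < δ ∧
        negativeTriangle.SolvableInTime (3 - δ) ∧
        allPairsShortestPaths.SolvableInTime (3 - δ) := by
  rintro ⟨ε, hε, h⟩
  -- Both reductions have overheads that are dominated only for a gain of at most `1`, so `ε` is
  -- replaced by `min ε 1`.
  have hδ : 0 < min ε 1 := lt_min hε one_pos
  have htri : negativeTriangle.SolvableInTime (3 - min ε 1) :=
    negativeTriangle_solvable (min_le_right _ _)
      (h.mono (fun I => by have := I.three_le; exact le_trans (by norm_num) this)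
        (by linarith [min_le_left ε 1]))
  exact ⟨min ε 1 / 8, by positivity, htri.mono (fun I => I.n_pos) (by linarith),
    allPairsShortestPaths_solvable hδ (min_le_right _ _) htri⟩
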